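/- Let $d\ge 1$, let $\mathcal M$ be the closure of a bounded open set in $\mathbb R^d$, let $\omega$ be an open neighbourhood of $\partial\mathcal M$ in $\mathcal M$ (that is, $\omega\subset\mathcal M$ is relatively open and $\partial\mathcal M\subset\omega$), and fix any $x_1\in\mathbb R^d$. Assume that $$T>\sup\{|x-x_1| : x\in\mathcal M\setminus\omega\}$$ (with the convention $\sup\emptyset=0$), and let $q_0,q_1\in L^\infty((-T,T)\times\mathcal M;\mathbb C)$ and $q_2\in L^\infty((-T,T)\times\mathcal M;\mathbb C^d)$. Let $u$ be any complex-valued function with $$u\in H^1\big((-T,T)\times\mathrm{Int}(\mathcal M)\big),\qquad (\partial_t^2-\Delta)u+q_0u+q_1\partial_tu+q_2\cdot\nabla_xu=0\ \text{ in }(-T,T)\times\mathrm{Int}(\mathcal M)$$ in the sense of distributions, and $u=0$ almost everywhere in $(-T,T)\times\omega$. Then $$(u,\partial_tu)|_{t=0}=(0,0)\quad\text{in }\mathrm{Int}(\mathcal M).$$ Here the Cauchy data are understood as follows: $u$ has a representative in $C^0\big((-T,T);H^1_{\mathrm{loc}}(\mathrm{Int}(\mathcal M))\big)\cap C^1\big((-T,T);L^2_{\mathrm{loc}}(\mathrm{Int}(\mathcal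 M))\big)$, and $(u,\partial_tu)|_{t=0}$ is the pair formed by the value at $t=0$ of this (unique) representative and the value at $t=0$ of its time derivative. -/

import Mathlib

open MeasureTheory Set Filter Topology TopologicalSpace
open scoped ENNReal Distributions LineDeriv

noncomputable section

/-- The Euclidean space `ℝ^d`. -/
abbrev Space (d : ℕ) : Type := EuclideanSpace ℝ (Fin d)

/-- Space-time `ℝ^{1+d}`, with points `(t, x)`. -/
abbrev SpaceTime (d : ℕ) : Type := ℝ × Space d

/-- The direction of the time axis. -/
def timeDir (d : ℕ) : SpaceTime d := (1, 0)

/-- The direction of the `i`-th coordinate axis of space, in space-time. -/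
def spaceDir {d : ℕ} (i : Fin d) : SpaceTime d := (0, EuclideanSpace.single i 1)

/-- The cylinder `(-T, T) × U`. -/
def timeCylinder {d : ℕ} (T : ℝ) (U : Opens (Space d)) : Opens (SpaceTime d) :=
  ⟨Ioo (-T) T ×ˢ (U : Set (Space d)), isOpen_Ioo.prod U.isOpen⟩

/-- `g` is the weak derivative of `u` in the direction `v` on the open set `Ω`. -/
def IsWeakDeriv {V : Type*} [NormedAddCommGroup V] [NormedSpace ℝ V] [MeasureSpace V]
    (Ω : Opens V) (v : V) (u g : V → ℂ) : Prop :=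
  LocallyIntegrableOn u (Ω : Set V) volume ∧ LocallyIntegrableOn g (Ω : Set V) volume ∧
    ∀ φ : 𝓓(Ω, ℝ), ∫ z, (∂_{v} φ) z • u z = - ∫ z, φ z • g z

/-- `u ∈ H¹(Ω)`, with weak time derivative `ut` and weak spatial gradient `ux`, for an open set
`Ω` of space-time. -/
structure IsH1 {d : ℕ} (Ω : Opens (SpaceTime d)) (u ut : SpaceTime d → ℂ)
    (ux : Fin d → SpaceTime d → ℂ) : Prop where
  memLp : MemLp u 2 (volume.restrict (Ω : Set (SpaceTime d)))
  memLp_time : MemLp ut 2 (volume.restrict (Ω : Set (SpaceTime d)))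
  memLp_space : ∀ i, MemLp (ux i) 2 (volume.restrict (Ω : Set (SpaceTime d)))
  deriv_time : IsWeakDeriv Ω (timeDir d) u ut
  deriv_space : ∀ i, IsWeakDeriv Ω (spaceDir i) u (ux i)

/-- The wave operator `∂_t² - Δ` on test functions. -/
def waveOp {d : ℕ} {Ω : Opens (SpaceTime d)} (φ : 𝓓(Ω, ℝ)) : 𝓓(Ω, ℝ) :=
  ∂_{timeDir d} (∂_{timeDir d} φ) - ∑ i : Fin d, ∂_{spaceDir i} (∂_{spaceDir i} φ)

/-- `u ∈ H¹(Ω)` solves `(∂_t² - Δ) u + q₀ u + q₁ ∂_t u + q₂ · ∇_x u = 0` in the sense of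
distributions on `Ω`. -/
def IsWaveSolution {d : ℕ} (Ω : Opens (SpaceTime d)) (q₀ q₁ : SpaceTime d → ℂ)
    (q₂ : SpaceTime d → EuclideanSpace ℂ (Fin d)) (u : SpaceTime d → ℂ) : Prop :=
  ∃ (ut : SpaceTime d → ℂ) (ux : Fin d → SpaceTime d → ℂ), IsH1 Ω u ut ux ∧
    ∀ φ : 𝓓(Ω, ℝ),
      ∫ z, (waveOp φ z • u z
        + φ z • (q₀ z * u z + q₁ z * ut z + ∑ i, q₂ z i * ux i z)) = 0

/-- `v ∈ C⁰(I; L²_loc(U))`. -/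
def ContinuousOnL2loc {d : ℕ} (I : Set ℝ) (U : Opens (Space d)) (v : ℝ → Space d → ℂ) : Prop :=
  ∀ t ∈ I, ∀ K : Set (Space d), IsCompact K → K ⊆ U →
    MemLp (v t) 2 (volume.restrict K) ∧
    Tendsto (fun s => eLpNorm (fun x => v s x - v t x) 2 (volume.restrict K)) (𝓝[I] t) (𝓝 0)

/-- At every time `t` of the open set `I`, the map `v`, with values in `L²_loc(U)`, is
differentiable with derivative `w t`. -/
def HasDerivOnL2loc {d : ℕ} (I : Set ℝ) (U : Opens (Space d)) (v w : ℝ → Space d → ℂ) : Prop :=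
  ∀ t ∈ I, ∀ K : Set (Space d), IsCompact K → K ⊆ U →
    Tendsto (fun s => eLpNorm (fun x => ((s - t)⁻¹ : ℝ) • (v s x - v t x) - w t x) 2
      (volume.restrict K)) (𝓝[≠] t) (𝓝 0)

/-- `u` has a representative `v` in `C⁰((-T,T); H¹_loc(U)) ∩ C¹((-T,T); L²_loc(U))`, with time
derivative `w` and weak spatial gradient `g`, such that `(v, w)` is `(u₀, u₁)` at `t = 0`; that is,
`(u, ∂_t u)|_{t=0} = (u₀, u₁)` in `U`. (The representative is unique.) -/
def HasCauchyData {d : ℕ} (T : ℝ) (U : Opens (Space d)) (u : SpaceTime d → ℂ)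
    (u₀ u₁ : Space d → ℂ) : Prop :=
  ∃ (v w : ℝ → Space d → ℂ) (g : Fin d → ℝ → Space d → ℂ),
    (∀ᵐ t ∂(volume.restrict (Ioo (-T) T)),
      ∀ᵐ x ∂(volume.restrict (U : Set (Space d))), u (t, x) = v t x) ∧
    ContinuousOnL2loc (Ioo (-T) T) U v ∧
    (∀ i, ∀ t ∈ Ioo (-T) T, IsWeakDeriv U (EuclideanSpace.single i (1 : ℝ)) (v t) (g i t)) ∧
    (∀ i, ContinuousOnL2loc (Ioo (-T) T) U (g i)) ∧
    HasDerivOnL2loc (Ioo (-T) T) U v w ∧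
    ContinuousOnL2loc (Ioo (-T) T) U w ∧
    (∀ᵐ x ∂(volume.restrict (U : Set (Space d))), v 0 x = u₀ x) ∧
    (∀ᵐ x ∂(volume.restrict (U : Set (Space d))), w 0 x = u₁ x)

end

/-! The proof is a Carleman argument with the hyperbolic weight `ψ = |x - x₁|² - β t²`. Let `K₀ = M
\ ω`, a compact subset of the interior of `M`, and let `R` be the supremum of `|x - x₁|` over `K₀`.
Since `R < T`, some `β < 1` satisfies `R² < β T²`. On `{ψ > 0}` with `x ∈ K₀` this gives `β t² < R²
< β T²`, so the superlevel sets of `ψ`, within the region where `u` may be nonzero, stay away from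
`t = ±T`. No information at the ends of the time interval is needed, and none on the lateral
boundary, near which `u` vanishes.

For a quadratic weight the conjugated operator `e^{sψ} (∂_t² - Δ) e^{-sψ}` is explicit, and
`conjugated_estimate` bounds its square below by integration by parts. The gradient terms are
positive once a multiple `γ` of the identity, with `β < γ < 1`, is moved from the skew part to the
symmetric part. The zeroth order term is positive because `ψ > 0`. No further convexification of the
weight is required. `carleman_smooth` states the resulting inequality for smooth functions, and
`carleman_weak` extends it by mollification to compactly supported functions with weak derivatives
in `L²`.

In `ae_eq_zero_of_lt_quadWeight`, the inequality is applied to `χ u` with `χ = 1` near `{ψ ≥ c} ∩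
supp u`. For large `s` the lower order terms are absorbed, the commutator terms live at levels at
most `c`, and letting `s → ∞` gives `u = 0` on `{ψ > c'}` for each `c' > c`. Taking arbitrarily
small positive levels, `u = 0` on `{|x - x₁|² > β t²}` (`ae_eq_zero_of_hyperboloid`).

That region meets `t = 0` in everything but `x₁`, and away from `x₁` it contains a short time
interval. What remains is the meaning of the Cauchy data. Energy estimates on time slices make the
regularizations of a cut-off solution uniformly Cauchy in time, which yields curves in `C⁰(H¹) ∩
C¹(L²)` (`exists_continuous_curves`, `exists_curves`). A differentiable curve that vanishes on a set
of `x` for all small times has zero value and zero derivative there (`ae_eq_zero_of_curve`). -/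

noncomputable section

set_option linter.unusedSectionVars false

/-! ### Directional derivatives of smooth compactly supported functions -/

section Calculus

variable {E F : Type*} [NormedAddCommGroup E] [NormedSpace ℝ E]
  [NormedAddCommGroup F] [NormedSpace ℝ F]

/-- The derivative of `f` in the direction `e`. -/
def dirDeriv (e : E) (f : E → F) : E → F := fun z => fderiv ℝ f z e

/-- Smooth functions with compact support. -/
structure IsTest (f : E → F) : Prop where
  smooth : ContDiff ℝ (⊤ : ℕ∞) f
  compact : HasCompactSupport f

theorem ContDiff.dirDeriv {f : E → F} (hf : ContDiff ℝ (⊤ : ℕ∞) f) (e : E) :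
    ContDiff ℝ (⊤ : ℕ∞) (dirDeriv e f) := by
  have h : ContDiff ℝ (⊤ : ℕ∞) (fderiv ℝ f) :=
    hf.fderiv_right (m := ((⊤ : ℕ∞) : WithTop ℕ∞)) (by simp)
  exact h.clm_apply contDiff_const

theorem ContDiff.differentiable_of_top {f : E → F} (hf : ContDiff ℝ (⊤ : ℕ∞) f) :
    Differentiable ℝ f :=
  hf.differentiable (by simp)

theorem tsupport_dirDeriv_subset (e : E) (f : E → F) : tsupport (dirDeriv e f) ⊆ tsupport f := by
  refine (closure_mono ?_).trans (tsupport_fderiv_subset ℝ (f := f))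
  intro z hz h
  exact hz (by simp [dirDeriv, h])

theorem dirDeriv_add {f g : E → F} (hf : Differentiable ℝ f) (hg : Differentiable ℝ g) (e : E) :
    dirDeriv e (fun z => f z + g z) = fun z => dirDeriv e f z + dirDeriv e g z := by
  ext z
  simp only [dirDeriv]
  rw [fderiv_fun_add (hf z) (hg z)]; rfl

theorem dirDeriv_sum {ι : Type*} (s : Finset ι) {f : ι → E → F} (hf : ∀ i, Differentiable ℝ (f i))
    (e : E) : dirDeriv e (fun z => ∑ i ∈ s, f i z) = fun z => ∑ i ∈ s, dirDeriv e (f i) z := by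
  ext z
  simp only [dirDeriv]
  rw [fderiv_fun_sum fun i _ => hf i z, sum_apply]

theorem dirDeriv_sub {f g : E → F} (hf : Differentiable ℝ f) (hg : Differentiable ℝ g) (e : E) :
    dirDeriv e (fun z => f z - g z) = fun z => dirDeriv e f z - dirDeriv e g z := by
  ext z
  simp only [dirDeriv]
  rw [fderiv_fun_sub (hf z) (hg z)]; rfl

theorem dirDeriv_mul {f g : E → ℝ} (hf : Differentiable ℝ f) (hg : Differentiable ℝ g) (e : E) :
    dirDeriv e (fun z => f z * g z) = fun z => dirDeriv e f z * g z + f z * dirDeriv e g z := by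
  ext z
  simp only [dirDeriv]
  rw [fderiv_fun_mul (hf z) (hg z)]
  simp only [add_apply, smul_apply, smul_eq_mul]
  ring

theorem dirDeriv_clm_comp {G : Type*} [NormedAddCommGroup G] [NormedSpace ℝ G] (L : F →L[ℝ] G)
    {f : E → F} (hf : Differentiable ℝ f) (e : E) :
    dirDeriv e (fun z => L (f z)) = fun z => L (dirDeriv e f z) := by
  ext z
  simp only [dirDeriv]
  have := (L.hasFDerivAt.comp z (hf z).hasFDerivAt).fderiv
  simp only [Function.comp_def] at this
  rw [this]; rfl

theorem dirDeriv_comm {f : E → F} (hf : ContDiff ℝ (⊤ : ℕ∞) f) (e e' : E) :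
    dirDeriv e (dirDeriv e' f) = dirDeriv e' (dirDeriv e f) := by
  ext z
  have h : Differentiable ℝ (fderiv ℝ f) :=
    (hf.fderiv_right (m := ((⊤ : ℕ∞) : WithTop ℕ∞)) (by simp)).differentiable (by simp)
  have key : ∀ a b : E, dirDeriv a (dirDeriv b f) z = fderiv ℝ (fderiv ℝ f) z a b := by
    intro a b
    have h1 : HasFDerivAt (dirDeriv b f)
        ((ContinuousLinearMap.apply ℝ F b).comp (fderiv ℝ (fderiv ℝ f) z)) z :=
      (ContinuousLinearMap.apply ℝ F b).hasFDerivAt.comp z (h z).hasFDerivAt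
    rw [dirDeriv, h1.fderiv]; rfl
  rw [key, key]
  have hs : IsSymmSndFDerivAt ℝ f z := by
    apply hf.contDiffAt.isSymmSndFDerivAt
    simp only [minSmoothness_of_isRCLikeNormedField]
    exact WithTop.coe_le_coe.2 (le_top : (2 : ℕ∞) ≤ ⊤)
  exact hs e e'

namespace IsTest

variable {f g : E → F}

theorem continuous (hf : IsTest f) : Continuous f := hf.smooth.continuous

theorem differentiable (hf : IsTest f) : Differentiable ℝ f := hf.smooth.differentiable_of_top

theorem dirDeriv (hf : IsTest f) (e : E) : IsTest (dirDeriv e f) :=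
  ⟨hf.smooth.dirDeriv e,
    hf.compact.of_isClosed_subset (isClosed_tsupport _) (tsupport_dirDeriv_subset e f)⟩

theorem add (hf : IsTest f) (hg : IsTest g) : IsTest (fun z => f z + g z) :=
  ⟨hf.smooth.add hg.smooth, hf.compact.add hg.compact⟩

theorem sub (hf : IsTest f) (hg : IsTest g) : IsTest (fun z => f z - g z) :=
  ⟨hf.smooth.sub hg.smooth, hf.compact.sub hg.compact⟩

theorem mul_left {f g : E → ℝ} (hf : ContDiff ℝ (⊤ : ℕ∞) f) (hg : IsTest g) :
    IsTest (fun z => f z * g z) :=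
  ⟨hf.mul hg.smooth, hg.compact.mul_left⟩

theorem mul {f g : E → ℝ} (hf : IsTest f) (hg : IsTest g) : IsTest (fun z => f z * g z) :=
  mul_left hf.smooth hg

theorem const_mul {f : E → ℝ} (c : ℝ) (hf : IsTest f) : IsTest (fun z => c * f z) :=
  mul_left contDiff_const hf

theorem zero : IsTest (fun _ : E => (0 : F)) := ⟨contDiff_const, HasCompactSupport.zero⟩

theorem sum {ι : Type*} {f : ι → E → F} (s : Finset ι) (hf : ∀ i, IsTest (f i)) :
    IsTest (fun z => ∑ i ∈ s, f i z) := by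
  classical
  induction s using Finset.induction_on with
  | empty => simpa using zero
  | insert a s ha ih =>
    simp only [Finset.sum_insert ha]
    exact (hf a).add ih

theorem clm_comp {G : Type*} [NormedAddCommGroup G] [NormedSpace ℝ G] (L : F →L[ℝ] G)
    (hf : IsTest f) : IsTest (fun z => L (f z)) :=
  ⟨L.contDiff.comp hf.smooth, hf.compact.comp_left (g := L) (map_zero L)⟩

variable [MeasurableSpace E] [BorelSpace E] {μ : Measure E}

theorem integrable [IsFiniteMeasureOnCompacts μ] (hf : IsTest f) : Integrable f μ :=
  hf.continuous.integrable_of_hasCompactSupport hf.compact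

theorem memLp [IsFiniteMeasureOnCompacts μ] (hf : IsTest f) (p : ℝ≥0∞) : MemLp f p μ :=
  hf.continuous.memLp_of_hasCompactSupport hf.compact

end IsTest

/-! ### Integration by parts for Haar measure -/

section Integration

variable [MeasurableSpace E] [BorelSpace E] [FiniteDimensional ℝ E] {μ : Measure E}
  [μ.IsAddHaarMeasure]

theorem integral_dirDeriv_eq_zero {f : E → ℝ} (hf : IsTest f) (e : E) :
    ∫ z, dirDeriv e f z ∂μ = 0 := by
  have h := integral_bilinear_hasLineDerivAt_right_eq_neg_left_of_integrable (μ := μ)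
    (f := fun _ : E => (1 : ℝ)) (f' := fun _ => 0) (g := f) (g' := dirDeriv e f) (v := e)
    (B := ContinuousLinearMap.mul ℝ ℝ) (by simp) (by simpa using (hf.dirDeriv e).integrable)
    (by simpa using hf.integrable)
    (fun x _ => by
      simpa using ((hasFDerivAt_const (1 : ℝ) x).hasLineDerivAt e))
    (fun x _ => (hf.differentiable x).hasFDerivAt.hasLineDerivAt e)
  simpa using h

theorem integral_dirDeriv_mul {f g : E → ℝ} (hf : ContDiff ℝ (⊤ : ℕ∞) f) (hg : IsTest g) (e : E) :
    ∫ z, dirDeriv e f z * g z ∂μ = - ∫ z, f z * dirDeriv e g z ∂μ := by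
  have h := integral_dirDeriv_eq_zero (μ := μ) (IsTest.mul_left hf hg) e
  rw [dirDeriv_mul hf.differentiable_of_top hg.differentiable, integral_add] at h
  · linarith
  · exact (IsTest.mul_left (hf.dirDeriv e) hg).integrable
  · exact (IsTest.mul_left hf (hg.dirDeriv e)).integrable

end Integration

end Calculus

/-! ### The Carleman estimate for smooth functions -/

section Carleman

variable {E : Type*} [NormedAddCommGroup E] [NormedSpace ℝ E] {ι : Type*}

/-- `y` is a system of affine coordinates dual to the directions `e`. -/
structure IsCoordSystem [DecidableEq ι] (e : ι → E) (y : ι → E → ℝ) : Prop where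
  smooth : ∀ a, ContDiff ℝ (⊤ : ℕ∞) (y a)
  deriv : ∀ a b, dirDeriv (e b) (y a) = fun _ => if a = b then 1 else 0

/-- The second order operator `∑ σ a ∂_a²`. -/
def diagOp [Fintype ι] {F : Type*} [NormedAddCommGroup F] [NormedSpace ℝ F]
    (e : ι → E) (σ : ι → ℝ) (f : E → F) : E → F :=
  fun z => ∑ a, σ a • dirDeriv (e a) (dirDeriv (e a) f) z

theorem IsTest.sq {f : E → ℝ} (hf : IsTest f) : IsTest (fun z => f z ^ 2) := by
  simpa only [pow_two] using hf.mul hf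

theorem dirDeriv_sq {v : E → ℝ} (hv : Differentiable ℝ v) (e : E) :
    dirDeriv e (fun z => v z ^ 2) = fun z => 2 * (v z * dirDeriv e v z) := by
  simp only [sq]
  rw [dirDeriv_mul hv hv]
  ext z; ring

variable [DecidableEq ι] {e : ι → E} {y : ι → E → ℝ}

theorem dirDeriv_exp_mul {φ w : E → ℝ} (hφ : ContDiff ℝ (⊤ : ℕ∞) φ) (hw : Differentiable ℝ w)
    (d : E) : dirDeriv d (fun z => Real.exp (φ z) * w z)
      = fun z => Real.exp (φ z) * (dirDeriv d w z + dirDeriv d φ z * w z) := by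
  have h : dirDeriv d (fun z => Real.exp (φ z)) = fun z => Real.exp (φ z) * dirDeriv d φ z := by
    ext z
    simp only [dirDeriv]
    rw [((hφ.differentiable_of_top z).hasFDerivAt.exp).fderiv]
    simp
  rw [dirDeriv_mul (hφ.exp).differentiable_of_top hw, h]
  ext z; ring

/-- The quadratic weight `∑ ρ a y_a²`. -/
def quadWeight [Fintype ι] (y : ι → E → ℝ) (ρ : ι → ℝ) (z : E) : ℝ := ∑ a, ρ a * y a z ^ 2

theorem contDiff_quadWeight [Fintype ι] (hy : IsCoordSystem e y) (ρ : ι → ℝ) :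
    ContDiff ℝ (⊤ : ℕ∞) (quadWeight y ρ) :=
  ContDiff.sum fun a _ => contDiff_const.mul ((hy.smooth a).pow 2)

theorem dirDeriv_quadWeight [Fintype ι] (hy : IsCoordSystem e y) (ρ : ι → ℝ) (s : ℝ) (b : ι) :
    dirDeriv (e b) (fun z => s * quadWeight y ρ z) = fun z => 2 * s * ρ b * y b z := by
  ext z
  have h : HasFDerivAt (fun z => s * quadWeight y ρ z)
      (s • ∑ a, ρ a • ((2 * y a z) • fderiv ℝ (y a) z)) z := by
    refine HasFDerivAt.const_mul (HasFDerivAt.fun_sum fun a _ => HasFDerivAt.const_mul ?_ _) _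
    simpa using ((hy.smooth a).differentiable_of_top z).hasFDerivAt.pow 2
  have hd : ∀ a, fderiv ℝ (y a) z (e b) = if a = b then 1 else 0 := fun a =>
    congrFun (hy.deriv a b) z
  rw [dirDeriv, h.fderiv]
  simp [hd]
  ring

/-- Conjugation replaces `∂_a` by `∂_a - 2sρ_a y_a`. The first two terms form the symmetric part.
The last two form the skew part, with coefficients `m a = -σ a * ρ a`: its zeroth order term is half
the divergence of its vector field. The terms are grouped as in `conjugated_estimate`. -/
theorem exp_mul_diagOp [Fintype ι] (hy : IsCoordSystem e y) {w : E → ℝ}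
    (hw : ContDiff ℝ (⊤ : ℕ∞) w) (σ ρ : ι → ℝ) (s : ℝ) (v : E → ℝ)
    (hv : v = fun z => Real.exp (s * quadWeight y ρ z) * w z) (z : E) :
    Real.exp (s * quadWeight y ρ z) * diagOp e σ w z
      = diagOp e σ v z + s ^ 2 * (∑ a, 4 * σ a * ρ a ^ 2 * y a z ^ 2) * v z
        + 4 * s * (∑ a, (- σ a * ρ a) * (y a z * dirDeriv (e a) v z))
        + 2 * s * (∑ a, - σ a * ρ a) * v z := by
  have hφ : ContDiff ℝ (⊤ : ℕ∞) (fun z => s * quadWeight y ρ z) :=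
    contDiff_const.mul (contDiff_quadWeight hy ρ)
  have h1 : ∀ a, dirDeriv (e a) v = fun z => Real.exp (s * quadWeight y ρ z) *
      (dirDeriv (e a) w z + 2 * s * ρ a * y a z * w z) := by
    intro a
    rw [hv, dirDeriv_exp_mul hφ hw.differentiable_of_top, dirDeriv_quadWeight hy]
  have h2 : ∀ a, dirDeriv (e a) (dirDeriv (e a) v) = fun z => Real.exp (s * quadWeight y ρ z) *
      (dirDeriv (e a) (dirDeriv (e a) w) z + 4 * s * ρ a * y a z * dirDeriv (e a) w z
        + (2 * s * ρ a + 4 * s ^ 2 * ρ a ^ 2 * y a z ^ 2) * w z) := by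
    intro a
    have hya : ContDiff ℝ (⊤ : ℕ∞) (fun z => 2 * s * ρ a * y a z) :=
      contDiff_const.mul (hy.smooth a)
    have hc : dirDeriv (e a) (fun z => 2 * s * ρ a * y a z) = fun _ => 2 * s * ρ a := by
      rw [dirDeriv_mul (differentiable_const _) (hy.smooth a).differentiable_of_top, hy.deriv]
      ext z
      simp [dirDeriv]
    rw [h1, dirDeriv_exp_mul hφ ((hw.dirDeriv _).add (hya.mul hw)).differentiable_of_top,
      dirDeriv_quadWeight hy, dirDeriv_add (hw.dirDeriv _).differentiable_of_top
      (hya.mul hw).differentiable_of_top, dirDeriv_mul hya.differentiable_of_top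
      hw.differentiable_of_top, hc]
    ext z; ring
  simp only [diagOp, h2, smul_eq_mul]
  simp only [h1]
  rw [hv]
  simp only [Finset.mul_sum, Finset.sum_mul, ← Finset.sum_add_distrib]
  exact Finset.sum_congr rfl fun a _ => by ring

/-! ### Multiplier identities and positivity of the commutator -/

variable [MeasurableSpace E] [BorelSpace E] [FiniteDimensional ℝ E] {μ : Measure E}
  [μ.IsAddHaarMeasure] {v : E → ℝ}

theorem integral_second_deriv_mul_self (hv : IsTest v) (d : E) :
    ∫ z, dirDeriv d (dirDeriv d v) z * v z ∂μ = - ∫ z, dirDeriv d v z ^ 2 ∂μ := by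
  rw [integral_dirDeriv_mul (hv.dirDeriv d).smooth hv]
  simp only [sq]

theorem integral_coord_mul_self_mul_deriv (hy : IsCoordSystem e y) {f : E → ℝ} (hf : IsTest f)
    (b : ι) : ∫ z, y b z * (f z * dirDeriv (e b) f z) ∂μ = - (1 / 2) * ∫ z, f z ^ 2 ∂μ := by
  have h := integral_dirDeriv_mul (μ := μ) (hy.smooth b) hf.sq (e b)
  rw [dirDeriv_sq hf.differentiable, hy.deriv] at h
  simp only [if_true, one_mul] at h
  rw [h, ← integral_neg, ← integral_const_mul]
  congr 1; ext z; ring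

/-- A Rellich identity. After `∂_a` is moved, its action on `y_b` gives the Kronecker term; what is
left is `y_b ∂_b` of half the square of `∂_a v`, handled by `integral_coord_mul_self_mul_deriv`. -/
theorem integral_second_deriv_mul_radial (hy : IsCoordSystem e y) (hv : IsTest v) (a b : ι) :
    ∫ z, dirDeriv (e a) (dirDeriv (e a) v) z * (y b z * dirDeriv (e b) v z) ∂μ
      = (1 / 2 - if a = b then 1 else 0) * ∫ z, dirDeriv (e a) v z ^ 2 ∂μ := by
  have ha := hv.dirDeriv (e a)
  have hb := hv.dirDeriv (e b)
  rw [integral_dirDeriv_mul ha.smooth (IsTest.mul_left (hy.smooth b) hb),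
    dirDeriv_mul (hy.smooth b).differentiable_of_top hb.differentiable, hy.deriv,
    dirDeriv_comm hv.smooth (e a) (e b)]
  have h1 : ∀ z, dirDeriv (e a) v z * ((if b = a then 1 else 0) * dirDeriv (e b) v z
      + y b z * dirDeriv (e b) (dirDeriv (e a) v) z)
      = (if a = b then 1 else 0) * dirDeriv (e a) v z ^ 2
        + y b z * (dirDeriv (e a) v z * dirDeriv (e b) (dirDeriv (e a) v) z) := by
    intro z
    by_cases h : a = b
    · subst h; simp; ring
    · simp [h, Ne.symm h]; ring
  simp only [h1]
  rw [integral_add (ha.sq.const_mul _).integrable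
    (IsTest.mul_left (hy.smooth b) (ha.mul (ha.dirDeriv _))).integrable, integral_const_mul,
    integral_coord_mul_self_mul_deriv hy ha]
  ring

/-- This is `integral_coord_mul_self_mul_deriv` for the function `y_a v`; the Kronecker term comes
from `∂_b y_a`. -/
theorem integral_coord_sq_mul_radial (hy : IsCoordSystem e y) (hv : IsTest v) (a b : ι) :
    ∫ z, (y a z ^ 2 * v z) * (y b z * dirDeriv (e b) v z) ∂μ
      = - (1 / 2 + if a = b then 1 else 0) * ∫ z, y a z ^ 2 * v z ^ 2 ∂μ := by
  have hs : IsTest (fun z => y a z * v z) := IsTest.mul_left (hy.smooth a) hv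
  have h := integral_coord_mul_self_mul_deriv (μ := μ) hy hs b
  rw [dirDeriv_mul (hy.smooth a).differentiable_of_top hv.differentiable, hy.deriv] at h
  have h1 : ∀ z, y b z * (y a z * v z *
      ((if a = b then 1 else 0) * v z + y a z * dirDeriv (e b) v z))
      = (if a = b then 1 else 0) * (y a z * v z) ^ 2
        + (y a z ^ 2 * v z) * (y b z * dirDeriv (e b) v z) := by
    intro z
    by_cases h : a = b
    · subst h; simp; ring
    · simp [h]; ring
  simp only [h1] at h
  rw [integral_add (hs.sq.const_mul _).integrable, integral_const_mul] at h
  · simp only [mul_pow] at h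
    linarith
  · exact (IsTest.mul_left ((hy.smooth a).pow 2) hv |>.mul
      (IsTest.mul_left (hy.smooth b) (hv.dirDeriv _))).integrable

theorem sum_mul_sub_ite {κ : Type*} [Fintype κ] [DecidableEq κ] (m : κ → ℝ) (c : ℝ) (a : κ) :
    ∑ b, m b * (c - if a = b then 1 else 0) = c * (∑ b, m b) - m a := by
  simp only [mul_sub, mul_ite, mul_one, mul_zero, Finset.sum_sub_distrib, Finset.sum_ite_eq,
    Finset.mem_univ, if_true, Finset.mul_sum]
  congr 1
  exact Finset.sum_congr rfl fun b _ => mul_comm _ _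

/-- The commutator estimate for the conjugated operator, with quadratic weight. -/
theorem conjugated_estimate [Fintype ι] (hy : IsCoordSystem e y) (hv : IsTest v)
    (σ m q : ι → ℝ) (s γ : ℝ) :
    8 * s * (∑ a, σ a * (γ - m a) * ∫ z, dirDeriv (e a) v z ^ 2 ∂μ)
      - 8 * s ^ 3 * (∑ a, (m a + γ) * q a * ∫ z, y a z ^ 2 * v z ^ 2 ∂μ)
      - 16 * γ ^ 2 * s ^ 2 * ∫ z, v z ^ 2 ∂μ
    ≤ ∫ z, (diagOp e σ v z + s ^ 2 * (∑ a, q a * y a z ^ 2) * v z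
        + 4 * s * (∑ a, m a * (y a z * dirDeriv (e a) v z)) + 2 * s * (∑ a, m a) * v z) ^ 2 ∂μ := by
  set M := ∑ a, m a with hM
  have hR : ∀ b, IsTest (fun z => y b z * dirDeriv (e b) v z) := fun b =>
    IsTest.mul_left (hy.smooth b) (hv.dirDeriv _)
  have hD : ∀ a, IsTest (dirDeriv (e a) (dirDeriv (e a) v)) := fun a =>
    (hv.dirDeriv _).dirDeriv _
  have hQ : ∀ a, IsTest (fun z => y a z ^ 2 * v z) := fun a =>
    IsTest.mul_left ((hy.smooth a).pow 2) hv
  -- the four families of products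
  have e1 : ∀ a b, ∫ z, σ a * dirDeriv (e a) (dirDeriv (e a) v) z *
      (m b * (y b z * dirDeriv (e b) v z)) ∂μ
      = σ a * m b * ((1 / 2 - if a = b then 1 else 0) * ∫ z, dirDeriv (e a) v z ^ 2 ∂μ) := by
    intro a b
    rw [← integral_second_deriv_mul_radial hy hv, ← integral_const_mul]
    congr 1; ext z; ring
  have e2 : ∀ a b, ∫ z, q a * (y a z ^ 2 * v z) * (m b * (y b z * dirDeriv (e b) v z)) ∂μ
      = q a * m b * (- (1 / 2 + if a = b then 1 else 0) * ∫ z, y a z ^ 2 * v z ^ 2 ∂μ) := by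
    intro a b
    rw [← integral_coord_sq_mul_radial hy hv, ← integral_const_mul]
    congr 1; ext z; ring
  have e3 : ∀ a, ∫ z, σ a * dirDeriv (e a) (dirDeriv (e a) v) z * v z ∂μ
      = - σ a * ∫ z, dirDeriv (e a) v z ^ 2 ∂μ := by
    intro a
    rw [neg_mul, ← mul_neg, ← integral_second_deriv_mul_self hv, ← integral_const_mul]
    congr 1; ext z; ring
  have e4 : ∀ a, ∫ z, q a * (y a z ^ 2 * v z) * v z ∂μ
      = q a * ∫ z, y a z ^ 2 * v z ^ 2 ∂μ := by
    intro a
    rw [← integral_const_mul]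
    congr 1; ext z; ring
  have i1 : ∫ z, (∑ a, σ a * dirDeriv (e a) (dirDeriv (e a) v) z) *
      (∑ b, m b * (y b z * dirDeriv (e b) v z)) ∂μ
      = ∑ a, σ a * (M / 2 - m a) * ∫ z, dirDeriv (e a) v z ^ 2 ∂μ := by
    simp only [Finset.sum_mul_sum]
    rw [integral_finsetSum _ fun a _ => (IsTest.sum _ fun b =>
      ((hD a).const_mul (σ a)).mul ((hR b).const_mul (m b))).integrable]
    refine Finset.sum_congr rfl fun a _ => ?_
    rw [integral_finsetSum _ fun b _ =>
      (((hD a).const_mul (σ a)).mul ((hR b).const_mul (m b))).integrable]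
    simp only [e1]
    have h := sum_mul_sub_ite m (1 / 2) a
    rw [show σ a * (M / 2 - m a) * ∫ z, dirDeriv (e a) v z ^ 2 ∂μ
      = σ a * (∑ b, m b * (1 / 2 - if a = b then 1 else 0)) * ∫ z, dirDeriv (e a) v z ^ 2 ∂μ by
        rw [h]; ring, Finset.mul_sum, Finset.sum_mul]
    exact Finset.sum_congr rfl fun b _ => by ring
  have i2 : ∫ z, (∑ a, q a * (y a z ^ 2 * v z)) *
      (∑ b, m b * (y b z * dirDeriv (e b) v z)) ∂μ
      = ∑ a, q a * (- (M / 2) - m a) * ∫ z, y a z ^ 2 * v z ^ 2 ∂μ := by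
    simp only [Finset.sum_mul_sum]
    rw [integral_finsetSum _ fun a _ => (IsTest.sum _ fun b =>
      ((hQ a).const_mul (q a)).mul ((hR b).const_mul (m b))).integrable]
    refine Finset.sum_congr rfl fun a _ => ?_
    rw [integral_finsetSum _ fun b _ =>
      (((hQ a).const_mul (q a)).mul ((hR b).const_mul (m b))).integrable]
    simp only [e2]
    have h := sum_mul_sub_ite m (- (1 / 2)) a
    rw [show q a * (- (M / 2) - m a) * ∫ z, y a z ^ 2 * v z ^ 2 ∂μ
      = q a * (∑ b, m b * (- (1 / 2) - if a = b then 1 else 0)) * ∫ z, y a z ^ 2 * v z ^ 2 ∂μ by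
        rw [h]; ring, Finset.mul_sum, Finset.sum_mul]
    exact Finset.sum_congr rfl fun b _ => by ring
  have i3 : ∫ z, (∑ a, σ a * dirDeriv (e a) (dirDeriv (e a) v) z) * v z ∂μ
      = ∑ a, - σ a * ∫ z, dirDeriv (e a) v z ^ 2 ∂μ := by
    simp only [Finset.sum_mul]
    rw [integral_finsetSum _ fun a _ => (((hD a).const_mul (σ a)).mul hv).integrable]
    exact Finset.sum_congr rfl fun a _ => e3 a
  have i4 : ∫ z, (∑ a, q a * (y a z ^ 2 * v z)) * v z ∂μ
      = ∑ a, q a * ∫ z, y a z ^ 2 * v z ^ 2 ∂μ := by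
    simp only [Finset.sum_mul]
    rw [integral_finsetSum _ fun a _ => (((hQ a).const_mul (q a)).mul hv).integrable]
    exact Finset.sum_congr rfl fun a _ => e4 a
  have tD : IsTest (fun z => ∑ a, σ a * dirDeriv (e a) (dirDeriv (e a) v) z) :=
    IsTest.sum _ fun a => (hD a).const_mul _
  have tQ : IsTest (fun z => ∑ a, q a * (y a z ^ 2 * v z)) :=
    IsTest.sum _ fun a => (hQ a).const_mul _
  have tR : IsTest (fun z => ∑ b, m b * (y b z * dirDeriv (e b) v z)) :=
    IsTest.sum _ fun b => (hR b).const_mul _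
  have hexp : ∀ z, diagOp e σ v z + s ^ 2 * (∑ a, q a * y a z ^ 2) * v z
        + 4 * s * (∑ a, m a * (y a z * dirDeriv (e a) v z)) + 2 * s * M * v z
      = (∑ a, σ a * dirDeriv (e a) (dirDeriv (e a) v) z)
        + s ^ 2 * (∑ a, q a * (y a z ^ 2 * v z))
        + 4 * s * (∑ a, m a * (y a z * dirDeriv (e a) v z)) + 2 * s * M * v z := by
    intro z
    simp only [diagOp, smul_eq_mul, mul_assoc, Finset.sum_mul]
  simp only [hexp]
  -- With `X` the symmetric part and `Y` the skew part applied to `v`, `(X + Y)² = (X + 4γsv)² + Y²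
  -- + 2X(Y - 4γsv) - 16γ²s²v²`. The integrand here consists of the last two terms, expanded; the
  -- two squares are discarded at the end. In the integral the trace `M` cancels and `γ` takes its
  -- place.
  have lower : ∫ z, (8 * s * ((∑ a, σ a * dirDeriv (e a) (dirDeriv (e a) v) z) *
        (∑ b, m b * (y b z * dirDeriv (e b) v z)))
      + 8 * s ^ 3 * ((∑ a, q a * (y a z ^ 2 * v z)) *
        (∑ b, m b * (y b z * dirDeriv (e b) v z)))
      + 2 * (2 * s * M - 4 * γ * s) *
        ((∑ a, σ a * dirDeriv (e a) (dirDeriv (e a) v) z) * v z)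
      + 2 * s ^ 2 * (2 * s * M - 4 * γ * s) * ((∑ a, q a * (y a z ^ 2 * v z)) * v z)
      - 16 * γ ^ 2 * s ^ 2 * v z ^ 2) ∂μ
    = 8 * s * (∑ a, σ a * (γ - m a) * ∫ z, dirDeriv (e a) v z ^ 2 ∂μ)
      - 8 * s ^ 3 * (∑ a, (m a + γ) * q a * ∫ z, y a z ^ 2 * v z ^ 2 ∂μ)
      - 16 * γ ^ 2 * s ^ 2 * ∫ z, v z ^ 2 ∂μ := by
    have j1 := (tD.mul tR).const_mul (8 * s)
    have j2 := (tQ.mul tR).const_mul (8 * s ^ 3)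
    have j3 := (tD.mul hv).const_mul (2 * (2 * s * M - 4 * γ * s))
    have j4 := (tQ.mul hv).const_mul (2 * s ^ 2 * (2 * s * M - 4 * γ * s))
    have j5 := hv.sq.const_mul (16 * γ ^ 2 * s ^ 2)
    rw [integral_sub (((j1.add j2).add j3).add j4).integrable j5.integrable,
      integral_add ((j1.add j2).add j3).integrable j4.integrable,
      integral_add (j1.add j2).integrable j3.integrable,
      integral_add j1.integrable j2.integrable]
    simp only [integral_const_mul]
    rw [i1, i2, i3, i4]
    simp only [Finset.mul_sum, ← Finset.sum_add_distrib, ← Finset.sum_sub_distrib]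
    congr 1
    exact Finset.sum_congr rfl fun a _ => by ring
  rw [← lower]
  have tP := ((tD.add (tQ.const_mul (s ^ 2))).add (tR.const_mul (4 * s))).add
    (hv.const_mul (2 * s * M))
  refine integral_mono (((((tD.mul tR).const_mul _).add ((tQ.mul tR).const_mul _)).add
    ((tD.mul hv).const_mul _)).add ((tQ.mul hv).const_mul _) |>.sub
    (hv.sq.const_mul _)).integrable tP.sq.integrable fun z => ?_
  simp only
  nlinarith [sq_nonneg ((∑ a, σ a * dirDeriv (e a) (dirDeriv (e a) v) z)
        + s ^ 2 * (∑ a, q a * (y a z ^ 2 * v z)) + 4 * γ * s * v z), sq_nonneg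
    ((4 * s * (∑ a, m a * (y a z * dirDeriv (e a) v z)) + 2 * s * M * v z))]

/-- A Carleman estimate with quadratic weight for smooth functions supported in `S`. -/
theorem carleman_smooth [Fintype ι] (hy : IsCoordSystem e y) (σ ρ : ι → ℝ) {γ δ κ R : ℝ}
    (hδ : 0 < δ) (hκ : 0 < κ) {S : Set E} (hR : ∀ z ∈ S, ∀ a, y a z ^ 2 ≤ R)
    (hσ : ∀ a, δ ≤ σ a * (γ + σ a * ρ a))
    (hS : ∀ z ∈ S, κ ≤ ∑ a, 4 * σ a * ρ a ^ 2 * (σ a * ρ a - γ) * y a z ^ 2) :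
    ∃ η > 0, ∃ s₀ : ℝ, ∀ s ≥ s₀, ∀ w : E → ℝ, IsTest w → Function.support w ⊆ S →
      s * η * ((∑ a, ∫ z, (Real.exp (s * quadWeight y ρ z) * dirDeriv (e a) w z) ^ 2 ∂μ)
        + ∫ z, (Real.exp (s * quadWeight y ρ z) * w z) ^ 2 ∂μ)
      ≤ ∫ z, (Real.exp (s * quadWeight y ρ z) * diagOp e σ w z) ^ 2 ∂μ := by
  set P := ∑ a, ρ a ^ 2 with hP
  have hP0 : 0 ≤ P := Finset.sum_nonneg fun a _ => sq_nonneg _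
  have hden : 0 < 8 * |R| * P + 1 := by positivity
  -- The gain is `8sδ` on the gradient and `8s³κ` on `v²`. The bound `η ≤ 4δ` fits the gradient. The
  -- second bound on `η`, with `s ≥ 1`, makes the zeroth order terms cost at most `4s³κ`, and `s ≥
  -- 4γ²/κ` puts the error `16γ²s²` in the other `4s³κ`.
  refine ⟨min (4 * δ) (4 * κ / (8 * |R| * P + 1)), lt_min (by positivity) (by positivity),
    max 1 (4 * γ ^ 2 / κ), fun s hs w hw hwS => ?_⟩
  set η := min (4 * δ) (4 * κ / (8 * |R| * P + 1)) with hη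
  have hη1 : η ≤ 4 * δ := min_le_left _ _
  have hη2 : η * (8 * |R| * P + 1) ≤ 4 * κ := by
    rw [← le_div_iff₀ hden]; exact min_le_right _ _
  have hη0 : 0 ≤ η := le_min (by positivity) (by positivity)
  have hs1 : 1 ≤ s := (le_max_left _ _).trans hs
  have hs2 : 4 * γ ^ 2 ≤ s * κ := by
    rw [← div_le_iff₀ hκ]; exact (le_max_right _ _).trans hs
  have hs0 : 0 < s := by linarith
  set v : E → ℝ := fun z => Real.exp (s * quadWeight y ρ z) * w z with hvdef
  have hφ : ContDiff ℝ (⊤ : ℕ∞) (fun z => s * quadWeight y ρ z) :=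
    contDiff_const.mul (contDiff_quadWeight hy ρ)
  have hv : IsTest v := IsTest.mul_left hφ.exp hw
  have hvS : ∀ z, z ∉ S → v z = 0 := fun z hz => by
    have : w z = 0 := by_contra fun h => hz (hwS h)
    simp [hvdef, this]
  have hmain := conjugated_estimate (μ := μ) hy hv σ (fun a => - σ a * ρ a)
    (fun a => 4 * σ a * ρ a ^ 2) s γ
  have hL : (fun z => (Real.exp (s * quadWeight y ρ z) * diagOp e σ w z) ^ 2)
      = fun z => (diagOp e σ v z + s ^ 2 * (∑ a, 4 * σ a * ρ a ^ 2 * y a z ^ 2) * v z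
        + 4 * s * (∑ a, (- σ a * ρ a) * (y a z * dirDeriv (e a) v z))
        + 2 * s * (∑ a, - σ a * ρ a) * v z) ^ 2 := by
    ext z; rw [exp_mul_diagOp hy hw.smooth σ ρ s v hvdef]
  rw [hL]
  refine le_trans ?_ hmain
  -- the zeroth order term
  have hyv : ∀ a, IsTest (fun z => y a z ^ 2 * v z ^ 2) := fun a =>
    IsTest.mul_left ((hy.smooth a).pow 2) hv.sq
  have hK : κ * ∫ z, v z ^ 2 ∂μ ≤
      - ∑ a, (- σ a * ρ a + γ) * (4 * σ a * ρ a ^ 2) * ∫ z, y a z ^ 2 * v z ^ 2 ∂μ := by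
    have : - ∑ a, (- σ a * ρ a + γ) * (4 * σ a * ρ a ^ 2) * ∫ z, y a z ^ 2 * v z ^ 2 ∂μ
        = ∫ z, ∑ a, - ((- σ a * ρ a + γ) * (4 * σ a * ρ a ^ 2)) * (y a z ^ 2 * v z ^ 2) ∂μ := by
      rw [integral_finsetSum _ fun a _ => ((hyv a).const_mul _).integrable,
        ← Finset.sum_neg_distrib]
      refine Finset.sum_congr rfl fun a _ => ?_
      rw [integral_const_mul]; ring
    rw [this, ← integral_const_mul]
    refine integral_mono (hv.sq.const_mul _).integrable
      (IsTest.sum _ fun a => (hyv a).const_mul _).integrable fun z => ?_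
    by_cases hz : z ∈ S
    · have := mul_le_mul_of_nonneg_right (hS z hz) (sq_nonneg (v z))
      simp only
      refine this.trans (le_of_eq ?_)
      rw [Finset.sum_mul]
      exact Finset.sum_congr rfl fun a _ => by ring
    · simp [hvS z hz]
  -- the first order terms
  have hJ : ∀ a, ∫ z, (Real.exp (s * quadWeight y ρ z) * dirDeriv (e a) w z) ^ 2 ∂μ
      ≤ 2 * ∫ z, dirDeriv (e a) v z ^ 2 ∂μ + 8 * s ^ 2 * ρ a ^ 2 * |R| * ∫ z, v z ^ 2 ∂μ := by
    intro a
    rw [← integral_const_mul, ← integral_const_mul,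
      ← integral_add ((hv.dirDeriv _).sq.const_mul _).integrable (hv.sq.const_mul _).integrable]
    refine integral_mono (IsTest.mul_left hφ.exp (hw.dirDeriv _)).sq.integrable
      (((hv.dirDeriv _).sq.const_mul _).add (hv.sq.const_mul _)).integrable fun z => ?_
    have h1 : Real.exp (s * quadWeight y ρ z) * dirDeriv (e a) w z
        = dirDeriv (e a) v z - 2 * s * ρ a * y a z * v z := by
      rw [hvdef, dirDeriv_exp_mul hφ hw.differentiable, dirDeriv_quadWeight hy]
      ring
    have h2 : y a z ^ 2 * v z ^ 2 ≤ |R| * v z ^ 2 := by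
      by_cases hz : z ∈ S
      · exact mul_le_mul_of_nonneg_right ((hR z hz a).trans (le_abs_self R)) (sq_nonneg _)
      · simp [hvS z hz]
    simp only
    rw [h1]
    have h3 : 8 * s ^ 2 * ρ a ^ 2 * (y a z ^ 2 * v z ^ 2)
        ≤ 8 * s ^ 2 * ρ a ^ 2 * (|R| * v z ^ 2) :=
      mul_le_mul_of_nonneg_left h2 (by positivity)
    nlinarith [sq_nonneg (dirDeriv (e a) v z + 2 * s * ρ a * y a z * v z)]
  have hsum := Finset.sum_le_sum fun a (_ : a ∈ Finset.univ) => hJ a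
  rw [Finset.sum_add_distrib, ← Finset.mul_sum, ← Finset.sum_mul] at hsum
  have hPs : ∑ a, 8 * s ^ 2 * ρ a ^ 2 * |R| = 8 * s ^ 2 * |R| * P := by
    rw [hP, Finset.mul_sum]
    exact Finset.sum_congr rfl fun a _ => by ring
  rw [hPs] at hsum
  have hδJ : δ * ∑ a, ∫ z, dirDeriv (e a) v z ^ 2 ∂μ
      ≤ ∑ a, σ a * (γ - (- σ a * ρ a)) * ∫ z, dirDeriv (e a) v z ^ 2 ∂μ := by
    rw [Finset.mul_sum]
    refine Finset.sum_le_sum fun a _ => mul_le_mul_of_nonneg_right ?_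
      (integral_nonneg fun z => sq_nonneg _)
    simpa using hσ a
  set J := ∑ a, ∫ z, dirDeriv (e a) v z ^ 2 ∂μ
  set V := ∫ z, v z ^ 2 ∂μ
  set G := ∑ a, ∫ z, (Real.exp (s * quadWeight y ρ z) * dirDeriv (e a) w z) ^ 2 ∂μ
  have hV0 : 0 ≤ V := integral_nonneg fun z => sq_nonneg _
  have hJ0 : 0 ≤ J := Finset.sum_nonneg fun a _ => integral_nonneg fun z => sq_nonneg _
  have b1 : s * η * (G + V) ≤ s * η * (2 * J + (8 * s ^ 2 * |R| * P + 1) * V) :=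
    mul_le_mul_of_nonneg_left (by linarith) (by positivity)
  have b2 : s * η * (2 * J) ≤ s * (4 * δ) * (2 * J) := by gcongr
  have b3 : s * η * ((8 * s ^ 2 * |R| * P + 1) * V) ≤ 4 * κ * s ^ 3 * V := by
    have : 8 * s ^ 2 * |R| * P + 1 ≤ s ^ 2 * (8 * |R| * P + 1) := by nlinarith
    calc s * η * ((8 * s ^ 2 * |R| * P + 1) * V)
        ≤ s * η * ((s ^ 2 * (8 * |R| * P + 1)) * V) := by gcongr
      _ = s ^ 3 * V * (η * (8 * |R| * P + 1)) := by ring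
      _ ≤ s ^ 3 * V * (4 * κ) := by gcongr
      _ = _ := by ring
  have b4 : 16 * γ ^ 2 * s ^ 2 * V ≤ 4 * κ * s ^ 3 * V := by
    have := mul_le_mul_of_nonneg_right hs2 (show 0 ≤ 4 * s ^ 2 * V by positivity)
    nlinarith
  have b5 := mul_le_mul_of_nonneg_left hδJ (show 0 ≤ 8 * s by positivity)
  have b6 := mul_le_mul_of_nonneg_left hK (show 0 ≤ 8 * s ^ 3 by positivity)
  nlinarith

end Carleman

/-! ### Energy estimates on time slices -/

section Energy

theorem isClosedEmbedding_slice {X : Type*} [TopologicalSpace X] (t : ℝ) : IsClosedEmbedding fun x : X => (t, x) where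
  eq_induced := (isEmbedding_prodMkRight t).eq_induced
  injective := fun x y h => (Prod.mk.inj h).2
  isClosed_range := by
    have : range (fun x : X => (t, x)) = {z : ℝ × X | z.1 = t} := by
      ext z; constructor
      · rintro ⟨x, rfl⟩; rfl
      · intro h; exact ⟨z.2, Prod.ext h.symm rfl⟩
    rw [this]
    exact isClosed_eq continuous_fst continuous_const

variable {X F : Type*} [NormedAddCommGroup X] [NormedSpace ℝ X]
  [NormedAddCommGroup F] [NormedSpace ℝ F]

theorem IsTest.slice {f : ℝ × X → F} (hf : IsTest f) (t : ℝ) : IsTest (fun x => f (t, x)) :=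
  ⟨hf.smooth.comp (contDiff_const.prodMk contDiff_id),
    hf.compact.comp_isClosedEmbedding (isClosedEmbedding_slice t)⟩

theorem dirDeriv_slice {f : ℝ × X → F} (hf : Differentiable ℝ f) (t : ℝ) (b : X) :
    dirDeriv b (fun x => f (t, x)) = fun x => dirDeriv ((0, b) : ℝ × X) f (t, x) := by
  ext x
  have h : HasFDerivAt (fun x : X => f (t, x))
      ((fderiv ℝ f (t, x)).comp (ContinuousLinearMap.inr ℝ ℝ X)) x :=
    (hf (t, x)).hasFDerivAt.comp x ((hasFDerivAt_prodMk_right t x))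
  rw [dirDeriv, h.fderiv]; rfl

theorem hasDerivAt_slice {f : ℝ × X → F} (hf : Differentiable ℝ f) (t : ℝ) (x : X) :
    HasDerivAt (fun s => f (s, x)) (dirDeriv ((1, 0) : ℝ × X) f (t, x)) t := by
  have h : HasFDerivAt (fun s : ℝ => f (s, x))
      ((fderiv ℝ f (t, x)).comp (ContinuousLinearMap.inl ℝ ℝ X)) t :=
    (hf (t, x)).hasFDerivAt.comp t ((hasFDerivAt_prodMk_left t x))
  simpa [dirDeriv] using h.hasDerivAt

theorem IsTest.hasCompactSupport_slice_left {f : ℝ × X → F} (hf : IsTest f) (x : X) :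
    HasCompactSupport fun s => f (s, x) := by
  refine HasCompactSupport.intro (hf.compact.image continuous_fst) fun s hs => ?_
  by_contra h
  exact hs ⟨(s, x), subset_tsupport _ h, rfl⟩

/-- The wave operator `∂_t² - ∑ ∂_i²`. -/
def dalembertian {κ : Type*} [Fintype κ] (b : κ → X) (f : ℝ × X → F) : ℝ × X → F := fun z =>
  dirDeriv ((1, 0) : ℝ × X) (dirDeriv ((1, 0) : ℝ × X) f) z
    - ∑ i, dirDeriv ((0, b i) : ℝ × X) (dirDeriv ((0, b i) : ℝ × X) f) z

theorem IsTest.dalembertian {κ : Type*} [Fintype κ] {b : κ → X} {f : ℝ × X → F} (hf : IsTest f) :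
    IsTest (dalembertian b f) :=
  ((hf.dirDeriv _).dirDeriv _).sub (IsTest.sum _ fun _ => (hf.dirDeriv _).dirDeriv _)

/-- The space-time directions. -/
def waveDir {κ : Type*} (b : κ → X) : Option κ → ℝ × X
  | none => (1, 0)
  | some i => (0, b i)

/-- The signature of the wave operator. -/
def waveSign {κ : Type*} : Option κ → ℝ
  | none => 1
  | some _ => -1

theorem diagOp_wave {κ : Type*} [Fintype κ] (b : κ → X) (f : ℝ × X → F) :
    diagOp (waveDir b) waveSign f = dalembertian b f := by
  ext z
  simp [diagOp, dalembertian, Fintype.sum_option, waveDir, waveSign, sub_eq_add_neg]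

theorem eLpNorm_two_eq {α G : Type*} [NormedAddCommGroup G] [MeasurableSpace α] {μ : Measure α} {f : α → G}
    (hf : MemLp f 2 μ) : eLpNorm f 2 μ = ENNReal.ofReal (√(∫ z, ‖f z‖ ^ 2 ∂μ)) := by
  rw [hf.eLpNorm_eq_integral_rpow_norm (by simp) (by simp), Real.sqrt_eq_rpow]
  simp

theorem integrable_re_im_sq {α : Type*} [MeasurableSpace α] {μ : Measure α} {f : α → ℂ}
    (hf : MemLp f 2 μ) :
    ∫ z, ‖f z‖ ^ 2 ∂μ = ∫ z, (f z).re ^ 2 ∂μ + ∫ z, (f z).im ^ 2 ∂μ := by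
  rw [← integral_add]
  · congr 1; ext z
    rw [Complex.sq_norm, Complex.normSq_apply]; ring
  · exact hf.re.integrable_sq
  · exact hf.im.integrable_sq

theorem dirDeriv_re {f : X → ℂ} (hf : Differentiable ℝ f) (e : X) :
    dirDeriv e (fun z => (f z).re) = fun z => (dirDeriv e f z).re :=
  dirDeriv_clm_comp Complex.reCLM hf e

theorem dirDeriv_im {f : X → ℂ} (hf : Differentiable ℝ f) (e : X) :
    dirDeriv e (fun z => (f z).im) = fun z => (dirDeriv e f z).im :=
  dirDeriv_clm_comp Complex.imCLM hf e

theorem IsTest.re {f : X → ℂ} (hf : IsTest f) : IsTest fun z => (f z).re :=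
  hf.clm_comp Complex.reCLM

theorem IsTest.im {f : X → ℂ} (hf : IsTest f) : IsTest fun z => (f z).im :=
  hf.clm_comp Complex.imCLM

theorem diagOp_re {ι : Type*} [Fintype ι] (e : ι → X) (σ : ι → ℝ) {f : X → ℂ} (hf : IsTest f) :
    diagOp e σ (fun z => (f z).re) = fun z => (diagOp e σ f z).re := by
  ext z
  simp [diagOp, dirDeriv_re hf.differentiable, dirDeriv_re (hf.dirDeriv _).differentiable]

theorem diagOp_im {ι : Type*} [Fintype ι] (e : ι → X) (σ : ι → ℝ) {f : X → ℂ} (hf : IsTest f) :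
    diagOp e σ (fun z => (f z).im) = fun z => (diagOp e σ f z).im := by
  ext z
  simp [diagOp, dirDeriv_im hf.differentiable, dirDeriv_im (hf.dirDeriv _).differentiable]

theorem IsTest.diagOp {ι : Type*} [Fintype ι] {e : ι → X} {σ : ι → ℝ} {f : X → F}
    (hf : IsTest f) : IsTest (diagOp e σ f) :=
  IsTest.sum _ fun a => ((hf.dirDeriv _).dirDeriv _).clm_comp (σ a • ContinuousLinearMap.id ℝ F)

variable [MeasurableSpace X] [BorelSpace X] [FiniteDimensional ℝ X] {ν : Measure X}
  [ν.IsAddHaarMeasure]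

/-- Fubini and the fundamental theorem of calculus from `-∞`. It turns quantities on a time slice
into space-time integrals, which are the ones controlled by mollification. -/
theorem setIntegral_past_dirDeriv_time {h : ℝ × X → ℝ} (hh : IsTest h) (t : ℝ) :
    ∫ z in Iic t ×ˢ univ, dirDeriv ((1, 0) : ℝ × X) h z ∂((volume : Measure ℝ).prod ν)
      = ∫ x, h (t, x) ∂ν := by
  have hi : Integrable (dirDeriv ((1, 0) : ℝ × X) h) ((volume : Measure ℝ).prod ν) :=
    (hh.dirDeriv _).integrable
  rw [← Measure.prod_restrict, Measure.restrict_univ, integral_prod_symm]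
  · congr 1; ext x
    have hs : ContDiff ℝ 1 fun s => h (s, x) :=
      (hh.smooth.comp (contDiff_id.prodMk contDiff_const)).of_le (by simp)
    rw [← (hh.hasCompactSupport_slice_left x).integral_Iic_deriv_eq hs t]
    congr 1; ext s
    exact (hasDerivAt_slice hh.differentiable s x).deriv.symm
  · have := hi.restrict (s := Iic t ×ˢ univ)
    rwa [← Measure.prod_restrict, Measure.restrict_univ] at this

theorem setIntegral_past_dirDeriv_space {h : ℝ × X → ℝ} (hh : IsTest h) (t : ℝ) (b : X) :
    ∫ z in Iic t ×ˢ univ, dirDeriv ((0, b) : ℝ × X) h z ∂((volume : Measure ℝ).prod ν) = 0 := by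
  have hi : Integrable (dirDeriv ((0, b) : ℝ × X) h) ((volume : Measure ℝ).prod ν) :=
    (hh.dirDeriv _).integrable
  rw [setIntegral_prod _ hi.integrableOn]
  simp only [Measure.restrict_univ]
  have : ∀ s : ℝ, ∫ x, dirDeriv ((0, b) : ℝ × X) h (s, x) ∂ν = 0 := fun s => by
    have h0 := integral_dirDeriv_eq_zero (μ := ν) (hh.slice s) b
    rwa [dirDeriv_slice hh.differentiable] at h0
  simp [this]

theorem integral_slice_sq_le {f : ℝ × X → ℝ} (hf : IsTest f) (t : ℝ) :
    ∫ x, f (t, x) ^ 2 ∂ν ≤ ∫ z, f z ^ 2 ∂((volume : Measure ℝ).prod ν)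
      + ∫ z, dirDeriv ((1, 0) : ℝ × X) f z ^ 2 ∂((volume : Measure ℝ).prod ν) := by
  have hd := hf.dirDeriv ((1, 0) : ℝ × X)
  rw [← setIntegral_past_dirDeriv_time hf.sq t, ← integral_add hf.sq.integrable hd.sq.integrable,
    dirDeriv_sq hf.differentiable]
  refine le_trans (integral_mono ((hf.mul hd).const_mul 2).integrable.restrict
    (hf.sq.add hd.sq).integrable.restrict fun z => ?_)
    (setIntegral_le_integral (hf.sq.add hd.sq).integrable (ae_of_all _ fun z => by positivity))
  simp only
  nlinarith [sq_nonneg (f z - dirDeriv ((1, 0) : ℝ × X) f z)]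

/-- The time derivative of the energy density is `2 ∂_t f □f` plus the spatial divergence of `2 ∂_t
f ∂_i f`, and the divergence integrates to zero on each slice. -/
theorem energy_identity {κ : Type*} [Fintype κ] (b : κ → X) {f : ℝ × X → ℝ} (hf : IsTest f)
    (t : ℝ) :
    ∫ x, (dirDeriv ((1, 0) : ℝ × X) f (t, x) ^ 2
        + ∑ i, dirDeriv ((0, b i) : ℝ × X) f (t, x) ^ 2) ∂ν
      = ∫ z in Iic t ×ˢ univ, 2 * (dirDeriv ((1, 0) : ℝ × X) f z * dalembertian b f z)
        ∂((volume : Measure ℝ).prod ν) := by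
  set e₀ : ℝ × X := (1, 0)
  set e : κ → ℝ × X := fun i => (0, b i)
  have h0 := hf.dirDeriv e₀
  have hi : ∀ i, IsTest (dirDeriv (e i) f) := fun i => hf.dirDeriv _
  have hE : IsTest fun z => dirDeriv e₀ f z ^ 2 + ∑ i, dirDeriv (e i) f z ^ 2 :=
    h0.sq.add (IsTest.sum _ fun i => (hi i).sq)
  have hk : ∀ i, IsTest fun z => dirDeriv e₀ f z * dirDeriv (e i) f z := fun i => h0.mul (hi i)
  have hdE : ∀ z, dirDeriv e₀ (fun z => dirDeriv e₀ f z ^ 2 + ∑ i, dirDeriv (e i) f z ^ 2) z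
      = 2 * (dirDeriv e₀ f z * dalembertian b f z)
        + ∑ i, 2 * dirDeriv (e i) (fun z => dirDeriv e₀ f z * dirDeriv (e i) f z) z := by
    intro z
    have hs : dirDeriv e₀ (fun z => ∑ i, dirDeriv (e i) f z ^ 2) z
        = ∑ i, 2 * (dirDeriv (e i) f z * dirDeriv e₀ (dirDeriv (e i) f) z) := by
      have := fun i => congrFun (dirDeriv_sq (hi i).differentiable e₀) z
      rw [dirDeriv_sum _ fun i => (hi i).sq.differentiable]
      exact Finset.sum_congr rfl fun i _ => this i
    rw [dirDeriv_add h0.sq.differentiable (IsTest.sum _ fun i => (hi i).sq).differentiable]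
    simp only
    rw [hs, dirDeriv_sq h0.differentiable]
    simp only [dirDeriv_mul h0.differentiable (hi _).differentiable, dalembertian]
    rw [mul_sub, mul_sub, Finset.mul_sum, Finset.mul_sum, sub_add, ← Finset.sum_sub_distrib,
      sub_eq_add_neg, ← Finset.sum_neg_distrib]
    congr 1
    refine Finset.sum_congr rfl fun i _ => ?_
    rw [dirDeriv_comm hf.smooth e₀ (e i)]
    ring
  rw [← setIntegral_past_dirDeriv_time hE t]
  change ∫ z in Iic t ×ˢ univ, dirDeriv e₀ _ z ∂_ = _
  simp only [hdE]
  rw [integral_add ((h0.mul hf.dalembertian).const_mul 2).integrable.restrict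
    (IsTest.sum _ fun i => ((hk i).dirDeriv (e i)).const_mul 2).integrable.restrict,
    integral_finsetSum _ fun i _ => (((hk i).dirDeriv (e i)).const_mul 2).integrable.restrict]
  have : ∀ i, ∫ z in Iic t ×ˢ univ, 2 * dirDeriv (e i) (fun z => dirDeriv e₀ f z *
      dirDeriv (e i) f z) z ∂((volume : Measure ℝ).prod ν) = 0 := fun i => by
    rw [integral_const_mul, setIntegral_past_dirDeriv_space (hk i), mul_zero]
  simp only [this, Finset.sum_const_zero, add_zero]

theorem energy_estimate {κ : Type*} [Fintype κ] (b : κ → X) {f : ℝ × X → ℝ} (hf : IsTest f)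
    (t : ℝ) :
    ∫ x, (dirDeriv ((1, 0) : ℝ × X) f (t, x) ^ 2
        + ∑ i, dirDeriv ((0, b i) : ℝ × X) f (t, x) ^ 2) ∂ν
      ≤ ∫ z, dirDeriv ((1, 0) : ℝ × X) f z ^ 2 ∂((volume : Measure ℝ).prod ν)
        + ∫ z, dalembertian b f z ^ 2 ∂((volume : Measure ℝ).prod ν) := by
  have h0 := hf.dirDeriv ((1, 0) : ℝ × X)
  have hb : IsTest (dalembertian b f) := hf.dalembertian
  rw [energy_identity b hf, ← integral_add h0.sq.integrable hb.sq.integrable]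
  refine le_trans (integral_mono ((h0.mul hb).const_mul 2).integrable.restrict
    (h0.sq.add hb.sq).integrable.restrict fun z => ?_)
    (setIntegral_le_integral (h0.sq.add hb.sq).integrable (ae_of_all _ fun z => by positivity))
  simp only
  nlinarith [sq_nonneg (dirDeriv ((1, 0) : ℝ × X) f z - dalembertian b f z)]

theorem integral_slice_le_integral_add {f : ℝ × X → ℂ} (hf : IsTest f) (t : ℝ) :
    ∫ x, ‖f (t, x)‖ ^ 2 ∂ν ≤ ∫ z, ‖f z‖ ^ 2 ∂((volume : Measure ℝ).prod ν)
      + ∫ z, ‖dirDeriv ((1, 0) : ℝ × X) f z‖ ^ 2 ∂((volume : Measure ℝ).prod ν) := by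
  rw [integrable_re_im_sq ((hf.slice t).memLp 2), integrable_re_im_sq (hf.memLp 2),
    integrable_re_im_sq ((hf.dirDeriv _).memLp 2)]
  have h1 := integral_slice_sq_le (ν := ν) hf.re t
  have h2 := integral_slice_sq_le (ν := ν) hf.im t
  rw [dirDeriv_re hf.differentiable] at h1
  rw [dirDeriv_im hf.differentiable] at h2
  linarith

/-- The energy estimate for the real and imaginary parts, keeping a single derivative of the energy.
The right side does not depend on `t`, which gives uniformity in time. -/
theorem integral_slice_dirDeriv_le {κ : Type*} [Fintype κ] (b : κ → X) {f : ℝ × X → ℂ}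
    (hf : IsTest f) (t : ℝ) (a : Option κ) :
    ∫ x, ‖dirDeriv (waveDir b a) f (t, x)‖ ^ 2 ∂ν
      ≤ ∫ z, ‖dirDeriv ((1, 0) : ℝ × X) f z‖ ^ 2 ∂((volume : Measure ℝ).prod ν)
      + ∫ z, ‖diagOp (waveDir b) waveSign f z‖ ^ 2 ∂((volume : Measure ℝ).prod ν) := by
  have key : ∀ {g : ℝ × X → ℝ}, IsTest g → ∫ x, dirDeriv (waveDir b a) g (t, x) ^ 2 ∂ν
      ≤ ∫ z, dirDeriv ((1, 0) : ℝ × X) g z ^ 2 ∂((volume : Measure ℝ).prod ν)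
        + ∫ z, diagOp (waveDir b) waveSign g z ^ 2 ∂((volume : Measure ℝ).prod ν) := by
    intro g hg
    rw [diagOp_wave]
    refine le_trans ?_ (energy_estimate b hg t)
    have i0 := (hg.dirDeriv ((1, 0) : ℝ × X)).sq.slice t
    have i1 : ∀ i, IsTest fun x => dirDeriv ((0, b i) : ℝ × X) g (t, x) ^ 2 :=
      fun i => (hg.dirDeriv ((0, b i) : ℝ × X)).sq.slice t
    refine integral_mono ((hg.dirDeriv (waveDir b a)).sq.slice t).integrable
      (i0.add (IsTest.sum _ i1)).integrable fun x => ?_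
    cases a with
    | none =>
      exact le_add_of_nonneg_right (Finset.sum_nonneg fun i _ => sq_nonneg _)
    | some i =>
      exact le_add_of_nonneg_of_le (sq_nonneg _) (Finset.single_le_sum
        (f := fun i => dirDeriv ((0, b i) : ℝ × X) g (t, x) ^ 2)
        (fun i _ => sq_nonneg _) (Finset.mem_univ i))
  have h1 := key hf.re
  have h2 := key hf.im
  simp only [diagOp_re _ _ hf, dirDeriv_re hf.differentiable] at h1
  simp only [diagOp_im _ _ hf, dirDeriv_im hf.differentiable] at h2
  rw [integrable_re_im_sq (((hf.dirDeriv _).slice t).memLp 2),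
    integrable_re_im_sq ((hf.dirDeriv _).memLp 2), integrable_re_im_sq (hf.diagOp.memLp 2)]
  linarith

theorem ofReal_sqrt_le_add {a b c : ℝ} (h : a ≤ b + c) (hb : 0 ≤ b) (hc : 0 ≤ c) :
    ENNReal.ofReal √a ≤ ENNReal.ofReal √b + ENNReal.ofReal √c := by
  rw [← ENNReal.ofReal_add (Real.sqrt_nonneg _) (Real.sqrt_nonneg _)]
  refine ENNReal.ofReal_le_ofReal (Real.sqrt_le_iff.2 ⟨by positivity, h.trans ?_⟩)
  nlinarith [Real.sq_sqrt hb, Real.sq_sqrt hc, mul_nonneg (Real.sqrt_nonneg b) (Real.sqrt_nonneg c)]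

theorem eLpNorm_slice_le {f : ℝ × X → ℂ} (hf : IsTest f) (t : ℝ) :
    eLpNorm (fun x => f (t, x)) 2 ν ≤ eLpNorm f 2 ((volume : Measure ℝ).prod ν)
      + eLpNorm (dirDeriv ((1, 0) : ℝ × X) f) 2 ((volume : Measure ℝ).prod ν) := by
  rw [eLpNorm_two_eq ((hf.slice t).memLp 2), eLpNorm_two_eq (hf.memLp 2),
    eLpNorm_two_eq ((hf.dirDeriv _).memLp 2)]
  exact ofReal_sqrt_le_add (integral_slice_le_integral_add hf t)
    (integral_nonneg fun _ => sq_nonneg _) (integral_nonneg fun _ => sq_nonneg _)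

theorem eLpNorm_slice_dirDeriv_le {κ : Type*} [Fintype κ] (b : κ → X) {f : ℝ × X → ℂ}
    (hf : IsTest f) (t : ℝ) (a : Option κ) :
    eLpNorm (fun x => dirDeriv (waveDir b a) f (t, x)) 2 ν
      ≤ eLpNorm (dirDeriv ((1, 0) : ℝ × X) f) 2 ((volume : Measure ℝ).prod ν)
      + eLpNorm (diagOp (waveDir b) waveSign f) 2 ((volume : Measure ℝ).prod ν) := by
  rw [eLpNorm_two_eq (((hf.dirDeriv _).slice t).memLp 2),
    eLpNorm_two_eq ((hf.dirDeriv _).memLp 2), eLpNorm_two_eq (hf.diagOp.memLp 2)]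
  exact ofReal_sqrt_le_add (integral_slice_dirDeriv_le b hf t a)
    (integral_nonneg fun _ => sq_nonneg _) (integral_nonneg fun _ => sq_nonneg _)

end Energy

/-! ### Mollification in `L²` -/

section Mollification

variable {E F : Type*} [NormedAddCommGroup E] [NormedSpace ℝ E] [FiniteDimensional ℝ E]
  [MeasurableSpace E] [BorelSpace E] [NormedAddCommGroup F] [NormedSpace ℝ F]

/-- The convolution of `f` with the kernel `ρ`. -/
def mollify (μ : Measure E) (ρ : E → ℝ) (f : E → F) : E → F :=
  convolution ρ f (ContinuousLinearMap.lsmul ℝ ℝ) μ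

variable {μ : Measure E} [μ.IsAddHaarMeasure] {ρ : E → ℝ} {f g : E → F}

theorem mollify_apply (z : E) : mollify μ ρ f z = ∫ y, ρ (z - y) • f y ∂μ :=
  convolution_lsmul_swap

theorem contDiff_mollify (hρ : IsTest ρ) (hf : LocallyIntegrable f μ) :
    ContDiff ℝ (⊤ : ℕ∞) (mollify μ ρ f) :=
  hρ.compact.contDiff_convolution_left _ hρ.smooth hf

theorem dirDeriv_mollify (hρ : IsTest ρ) (hf : LocallyIntegrable f μ) (e : E) :
    dirDeriv e (mollify μ ρ f) = mollify μ (dirDeriv e ρ) f := by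
  by_cases hF : CompleteSpace F
  · ext z
    have h1 : ContDiff ℝ 1 ρ := hρ.smooth.of_le (by simp)
    have h := hρ.compact.hasFDerivAt_convolution_left (ContinuousLinearMap.lsmul ℝ ℝ (E := F))
      h1 hf z
    rw [dirDeriv, mollify, h.fderiv, mollify, convolution, convolution,
      ContinuousLinearMap.integral_apply]
    · rfl
    · exact (HasCompactSupport.convolutionExists_left
        ((ContinuousLinearMap.lsmul ℝ ℝ (E := F)).precompL E) (hρ.compact.fderiv ℝ)
        (h1.continuous_fderiv one_ne_zero) hf z)
  · have h : ∀ ρ : E → ℝ, mollify μ ρ f = 0 := fun ρ => by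
      ext z; simp [mollify, convolution, integral, hF]
    ext z
    simp [dirDeriv, h]

theorem support_mollify_subset {r : ℝ} (hρ : Function.support ρ ⊆ Metric.ball 0 r) {K : Set E}
    (hf : Function.support f ⊆ K) :
    Function.support (mollify μ ρ f) ⊆ Metric.cthickening r K := by
  refine (support_convolution_subset _).trans ?_
  rintro _ ⟨a, ha, b, hb, rfl⟩
  refine Metric.mem_cthickening_of_dist_le (a + b) b r K (hf hb) ?_
  have := hρ ha
  rw [mem_ball_zero_iff] at this
  simpa using this.le

theorem isTest_mollify (hρ : IsTest ρ) (hf : LocallyIntegrable f μ) {K : Set E} (hK : IsCompact K)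
    (hfK : Function.support f ⊆ K) : IsTest (mollify μ ρ f) := by
  refine ⟨contDiff_mollify hρ hf, ?_⟩
  refine HasCompactSupport.intro (hρ.compact.isCompact.add hK) fun z hz => ?_
  by_contra h
  refine hz ?_
  obtain ⟨a, ha, b, hb, rfl⟩ := support_convolution_subset _ h
  exact ⟨a, subset_tsupport _ ha, b, hfK hb, rfl⟩

/-- `g` is the weak derivative of `f` on the whole space. -/
def IsGlobalWeakDeriv (μ : Measure E) (e : E) (f g : E → F) : Prop :=
  ∀ φ : E → ℝ, IsTest φ → ∫ z, dirDeriv e φ z • f z ∂μ = - ∫ z, φ z • g z ∂μ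

/-- `∑ σ a ∂_a² f = g` weakly on the whole space. -/
def IsGlobalWeakDiagOp {ι : Type*} [Fintype ι] (μ : Measure E) (e : ι → E) (σ : ι → ℝ)
    (f g : E → F) : Prop :=
  ∀ φ : E → ℝ, IsTest φ → ∫ z, diagOp e σ φ z • f z ∂μ = ∫ z, φ z • g z ∂μ

theorem IsTest.reflect (hρ : IsTest ρ) (z : E) : IsTest fun y => ρ (z - y) :=
  ⟨hρ.smooth.comp (contDiff_const.sub contDiff_id),
    hρ.compact.comp_homeomorph (Homeomorph.subLeft z)⟩

theorem dirDeriv_reflect {ρ : E → ℝ} (hρ : Differentiable ℝ ρ) (z e : E) :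
    dirDeriv e (fun y => ρ (z - y)) = fun y => - dirDeriv e ρ (z - y) := by
  ext y
  have h : HasFDerivAt (fun y => ρ (z - y)) ((fderiv ℝ ρ (z - y)).comp
      (-(ContinuousLinearMap.id ℝ E))) y := by
    refine (hρ (z - y)).hasFDerivAt.comp y ?_
    simpa using (hasFDerivAt_id y).const_sub z
  rw [dirDeriv, h.fderiv]
  simp [dirDeriv]

/-- The reflected kernel `y ↦ ρ (z - y)` is an admissible test function, and the sign from the
reflection cancels the one in the definition of the weak derivative. -/
theorem dirDeriv_mollify_eq (hρ : IsTest ρ) (hf : LocallyIntegrable f μ) {e : E}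
    (h : IsGlobalWeakDeriv μ e f g) : dirDeriv e (mollify μ ρ f) = mollify μ ρ g := by
  rw [dirDeriv_mollify hρ hf]
  ext z
  have := h _ (hρ.reflect z)
  rw [dirDeriv_reflect hρ.differentiable] at this
  simp only [neg_smul, integral_neg, neg_inj] at this
  rw [mollify_apply, mollify_apply, this]

theorem diagOp_mollify_eq {ι : Type*} [Fintype ι] (hρ : IsTest ρ) (hf : LocallyIntegrable f μ)
    {e : ι → E} {σ : ι → ℝ} (h : IsGlobalWeakDiagOp μ e σ f g) :
    diagOp e σ (mollify μ ρ f) = mollify μ ρ g := by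
  ext z
  have h2 : ∀ a, dirDeriv (e a) (dirDeriv (e a) fun y => ρ (z - y))
      = fun y => dirDeriv (e a) (dirDeriv (e a) ρ) (z - y) := by
    intro a
    rw [dirDeriv_reflect hρ.differentiable]
    have := dirDeriv_reflect (hρ.dirDeriv (e a)).differentiable z (e a)
    ext y
    have h3 : dirDeriv (e a) (fun y => - dirDeriv (e a) ρ (z - y)) y
        = - dirDeriv (e a) (fun y => dirDeriv (e a) ρ (z - y)) y := by
      simp [dirDeriv]
    rw [h3, this, neg_neg]
  have h3 := h _ (hρ.reflect z)
  rw [mollify_apply, ← h3]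
  simp only [diagOp, dirDeriv_mollify hρ hf, dirDeriv_mollify (hρ.dirDeriv _) hf, mollify_apply,
    h2, smul_eq_mul, Finset.sum_smul, mul_smul]
  rw [integral_finsetSum]
  · exact Finset.sum_congr rfl fun a _ => (integral_smul _ _).symm
  · intro a _
    refine Integrable.smul (σ a) ?_
    have ht := ((hρ.dirDeriv (e a)).dirDeriv (e a)).reflect z
    exact hf.integrable_smul_left_of_hasCompactSupport ht.continuous ht.compact

theorem isTest_normed (φ : ContDiffBump (0 : E)) : IsTest (φ.normed μ) :=
  ⟨φ.contDiff_normed, φ.hasCompactSupport_normed⟩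

theorem lintegral_normed (φ : ContDiffBump (0 : E)) : ∫⁻ y, ‖φ.normed μ y‖ₑ ∂μ = 1 := by
  have h := ofReal_integral_norm_eq_lintegral_enorm (μ := μ) (isTest_normed (μ := μ) φ).integrable
  rw [← h]
  simp only [Real.norm_eq_abs, abs_of_nonneg (φ.nonneg_normed (μ := μ) _), φ.integral_normed,
    ENNReal.ofReal_one]

/-- Cauchy-Schwarz against the constant `1` for the probability measure `k dμ`. -/
theorem sq_lintegral_mul_le {α : Type*} [MeasurableSpace α] {μ : Measure α} {k g : α → ℝ≥0∞}
    (hk : Measurable k) (hg : Measurable g) (h1 : ∫⁻ y, k y ∂μ = 1) :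
    (∫⁻ y, k y * g y ∂μ) ^ 2 ≤ ∫⁻ y, k y * g y ^ 2 ∂μ := by
  have h := ENNReal.lintegral_mul_le_Lp_mul_Lq (μ.withDensity k) Real.HolderConjugate.two_two
    (f := g) (g := 1) hg.aemeasurable aemeasurable_const
  have hmass : (∫⁻ a, (1 : α → ℝ≥0∞) a ^ (2 : ℝ) ∂(μ.withDensity k)) = 1 := by
    simp [h1]
  rw [hmass] at h
  simp only [mul_one, ENNReal.one_rpow, ENNReal.rpow_two] at h
  rw [lintegral_withDensity_eq_lintegral_mul _ hk hg,
    lintegral_withDensity_eq_lintegral_mul _ hk (hg.pow_const 2)] at h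
  calc _ ≤ ((∫⁻ y, k y * g y ^ 2 ∂μ) ^ (1 / 2 : ℝ)) ^ 2 := by
        gcongr; exact h
    _ = _ := by rw [← ENNReal.rpow_two, ← ENNReal.rpow_mul]; norm_num

theorem eLpNorm_two_sq {α F : Type*} [NormedAddCommGroup F] [MeasurableSpace α] {μ : Measure α} (f : α → F) :
    eLpNorm f 2 μ ^ 2 = ∫⁻ x, ‖f x‖ₑ ^ 2 ∂μ := by
  rw [eLpNorm_eq_lintegral_rpow_enorm_toReal (by simp) (by simp), ← ENNReal.rpow_two,
    ← ENNReal.rpow_mul]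
  norm_num

/-- Young's inequality for a kernel of mass one: `sq_lintegral_mul_le` pointwise, then Tonelli and
translation invariance. -/
theorem eLpNorm_mollify_le (φ : ContDiffBump (0 : E)) (hf : AEStronglyMeasurable f μ) :
    eLpNorm (mollify μ (φ.normed μ) f) 2 μ ≤ eLpNorm f 2 μ := by
  have hc : mollify μ (φ.normed μ) f = mollify μ (φ.normed μ) (hf.mk f) :=
    convolution_congr _ ae_eq_rfl hf.ae_eq_mk
  rw [hc, eLpNorm_congr_ae hf.ae_eq_mk]
  have hg := hf.stronglyMeasurable_mk
  set g := hf.mk f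
  rw [← ENNReal.pow_le_pow_left_iff two_ne_zero, eLpNorm_two_sq, eLpNorm_two_sq]
  have hk : Measurable fun y => ‖φ.normed μ y‖ₑ := (isTest_normed (μ := μ) φ).continuous.measurable.enorm
  have hm : Measurable (Function.uncurry fun x y : E => ‖φ.normed μ y‖ₑ * ‖g (x - y)‖ₑ ^ 2) :=
    (hk.comp measurable_snd).mul
      ((hg.enorm.comp (measurable_fst.sub measurable_snd)).pow_const 2)
  calc ∫⁻ x, ‖mollify μ (φ.normed μ) g x‖ₑ ^ 2 ∂μ
      ≤ ∫⁻ x, ∫⁻ y, ‖φ.normed μ y‖ₑ * ‖g (x - y)‖ₑ ^ 2 ∂μ ∂μ := by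
        refine lintegral_mono fun x => ?_
        refine le_trans ?_ (sq_lintegral_mul_le hk
          (hg.enorm.comp (measurable_const.sub measurable_id)) (lintegral_normed φ))
        gcongr
        refine (enorm_integral_le_lintegral_enorm _).trans (lintegral_mono fun y => ?_)
        simp [enorm_smul]
    _ = ∫⁻ y, ∫⁻ x, ‖φ.normed μ y‖ₑ * ‖g (x - y)‖ₑ ^ 2 ∂μ ∂μ :=
        lintegral_lintegral_swap hm.aemeasurable
    _ = ∫⁻ y, ‖φ.normed μ y‖ₑ * ∫⁻ x, ‖g x‖ₑ ^ 2 ∂μ ∂μ := by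
        congr 1; ext y
        have hmy : Measurable fun x => ‖g (x - y)‖ₑ ^ 2 :=
          (hg.enorm.comp (measurable_id.sub measurable_const)).pow_const 2
        rw [lintegral_const_mul _ hmy, lintegral_sub_right_eq_self (fun x => ‖g x‖ₑ ^ 2) y]
    _ = ∫⁻ x, ‖g x‖ₑ ^ 2 ∂μ := by
        rw [lintegral_mul_const _ hk, lintegral_normed, one_mul]

theorem exists_eLpNorm_mollify_sub_le_of_continuous [CompleteSpace F] (hf : Continuous f)
    (hc : HasCompactSupport f) {ε : ℝ≥0∞} (hε : ε ≠ 0) :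
    ∃ δ > 0, ∀ φ : ContDiffBump (0 : E), φ.rOut ≤ δ →
      eLpNorm (fun z => mollify μ (φ.normed μ) f z - f z) 2 μ ≤ ε := by
  set K := Metric.cthickening 1 (tsupport f)
  have hK : IsCompact K := hc.isCompact.cthickening
  set c := μ K ^ (2⁻¹ : ℝ) with hcdef
  have hctop : c ≠ ∞ := ENNReal.rpow_ne_top_of_nonneg (by norm_num) hK.measure_lt_top.ne
  obtain ⟨η, hη0, hη⟩ : ∃ η : ℝ, 0 < η ∧ c * ENNReal.ofReal η ≤ ε := by
    have ht : Tendsto (fun η : ℝ => c * ENNReal.ofReal η) (𝓝[>] 0) (𝓝 (c * ENNReal.ofReal 0)) :=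
      (ENNReal.Tendsto.const_mul (ENNReal.tendsto_ofReal tendsto_id) (Or.inr hctop)).mono_left
        nhdsWithin_le_nhds
    rw [ENNReal.ofReal_zero, mul_zero] at ht
    obtain ⟨η, h1, h2⟩ := ((ht.eventually (ge_mem_nhds (pos_iff_ne_zero.2 hε))).and
      self_mem_nhdsWithin).exists
    exact ⟨η, h2, h1⟩
  obtain ⟨δ, hδ0, hδ⟩ := Metric.uniformContinuous_iff.1 (hc.uniformContinuous_of_continuous hf)
    η hη0
  refine ⟨min δ 1, lt_min hδ0 one_pos, fun φ hφ => ?_⟩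
  have hsupp : Function.support (fun z => mollify μ (φ.normed μ) f z - f z) ⊆ K := by
    intro z hz
    by_contra hzK
    have h1 : mollify μ (φ.normed μ) f z = 0 := by
      by_contra h
      refine hzK (Metric.cthickening_mono (hφ.trans (min_le_right _ _)) _
        (support_mollify_subset (by rw [φ.support_normed_eq]) (subset_tsupport f) h))
    have h2 : f z = 0 := by
      by_contra h
      exact hzK (Metric.self_subset_cthickening _ (subset_tsupport f h))
    exact hz (by simp [h1, h2])
  rw [← eLpNorm_restrict_eq_of_support_subset hsupp]
  refine le_trans (eLpNorm_le_of_ae_bound (C := η) (ae_of_all _ fun z => ?_)) ?_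
  · rw [← dist_eq_norm]
    refine ContDiffBump.dist_normed_convolution_le hf.aestronglyMeasurable fun x hx => ?_
    exact (hδ (lt_of_lt_of_le hx (hφ.trans (min_le_left _ _)))).le
  · simpa [hcdef] using hη

/-- Density of continuous compactly supported functions; the error of the approximation is not
enlarged by mollification, which is a contraction of `L²`. -/
theorem exists_eLpNorm_mollify_sub_le [CompleteSpace F] (hf : MemLp f 2 μ) {ε : ℝ≥0∞}
    (hε : ε ≠ 0) : ∃ δ > 0, ∀ φ : ContDiffBump (0 : E), φ.rOut ≤ δ →
      eLpNorm (fun z => mollify μ (φ.normed μ) f z - f z) 2 μ ≤ ε := by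
  have hε3 : ε / 3 ≠ 0 := (ENNReal.div_pos hε (by simp)).ne'
  obtain ⟨g, hgc, hfg, hg, hgL⟩ := hf.exists_hasCompactSupport_eLpNorm_sub_le (by simp) hε3
  obtain ⟨δ, hδ, h⟩ := exists_eLpNorm_mollify_sub_le_of_continuous (μ := μ) hg hgc hε3
  refine ⟨δ, hδ, fun φ hφ => ?_⟩
  have hlin : mollify μ (φ.normed μ) f
      = mollify μ (φ.normed μ) (f - g) + mollify μ (φ.normed μ) g := by
    have ht := isTest_normed (μ := μ) φ
    have hex : ∀ {k : E → F}, MemLp k 2 μ →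
        ConvolutionExists (φ.normed μ) k (ContinuousLinearMap.lsmul ℝ ℝ) μ := fun hk =>
      ht.compact.convolutionExists_left _ ht.continuous (hk.locallyIntegrable one_le_two)
    have := (hex (hf.sub hgL)).distrib_add (hex hgL)
    rw [sub_add_cancel] at this
    exact this
  have hsplit : (fun z => mollify μ (φ.normed μ) f z - f z)
      = (mollify μ (φ.normed μ) (f - g) + fun z => mollify μ (φ.normed μ) g z - g z)
        + (g - f) := by
    ext z
    simp only [hlin, Pi.add_apply, Pi.sub_apply]
    abel
  have hsm : ∀ {k : E → F}, MemLp k 2 μ → AEStronglyMeasurable (mollify μ (φ.normed μ) k) μ :=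
    fun hk => (contDiff_mollify (isTest_normed φ)
      (hk.locallyIntegrable one_le_two)).continuous.aestronglyMeasurable
  rw [hsplit]
  refine (eLpNorm_add_le ((hsm (hf.sub hgL)).add ((hsm hgL).sub hgL.1)) (hgL.1.sub hf.1)
    one_le_two).trans ?_
  refine (add_le_add_left (eLpNorm_add_le (hsm (hf.sub hgL)) ((hsm hgL).sub hgL.1)
    one_le_two) _).trans ?_
  have h1 : eLpNorm (mollify μ (φ.normed μ) (f - g)) 2 μ ≤ ε / 3 :=
    (eLpNorm_mollify_le φ (hf.sub hgL).1).trans hfg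
  have h3 : eLpNorm (g - f) 2 μ ≤ ε / 3 := by rwa [eLpNorm_sub_comm]
  calc _ ≤ ε / 3 + ε / 3 + ε / 3 := add_le_add (add_le_add h1 (h φ hφ)) h3
    _ = ε := ENNReal.add_thirds ε

/-- A sequence of bump functions shrinking to the origin. -/
def shrinkingBump (E : Type*) [NormedAddCommGroup E] (n : ℕ) : ContDiffBump (0 : E) where
  rIn := 1 / (n + 2)
  rOut := 1 / (n + 1)
  rIn_pos := by positivity
  rIn_lt_rOut := one_div_lt_one_div_of_lt (by positivity) (by linarith)

theorem tendsto_shrinkingBump_rOut :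
    Tendsto (fun n => (shrinkingBump E n).rOut) atTop (𝓝 0) :=
  tendsto_one_div_add_atTop_nhds_zero_nat

/-- The regularization of `f` at scale `1 / (n + 1)`. -/
def smoothApprox (μ : Measure E) (n : ℕ) (f : E → F) : E → F :=
  mollify μ ((shrinkingBump E n).normed μ) f

theorem tendsto_eLpNorm_smoothApprox_sub [CompleteSpace F] (hf : MemLp f 2 μ) :
    Tendsto (fun n => eLpNorm (fun z => smoothApprox μ n f z - f z) 2 μ) atTop (𝓝 0) := by
  rw [ENNReal.tendsto_nhds_zero]
  intro ε hε
  obtain ⟨δ, hδ, h⟩ := exists_eLpNorm_mollify_sub_le hf hε.ne'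
  filter_upwards [(tendsto_order.1 (tendsto_shrinkingBump_rOut (E := E))).2 δ hδ] with n hn
  exact h _ hn.le

end Mollification

/-! ### The Carleman estimate for weak solutions -/

section WeakCarleman

theorem tendsto_eLpNorm_of_tendsto_sub {α G : Type*} [MeasurableSpace α] [NormedAddCommGroup G]
    {μ : Measure α} {f : ℕ → α → G} {g : α → G} (hf : ∀ n, AEStronglyMeasurable (f n) μ)
    (hg : AEStronglyMeasurable g μ)
    (h : Tendsto (fun n => eLpNorm (fun z => f n z - g z) 2 μ) atTop (𝓝 0)) :
    Tendsto (fun n => eLpNorm (f n) 2 μ) atTop (𝓝 (eLpNorm g 2 μ)) := by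
  have hl : Tendsto (fun n => eLpNorm g 2 μ - eLpNorm (fun z => f n z - g z) 2 μ) atTop
      (𝓝 (eLpNorm g 2 μ - 0)) :=
    ENNReal.Tendsto.sub tendsto_const_nhds h (Or.inr ENNReal.zero_ne_top)
  have hu : Tendsto (fun n => eLpNorm g 2 μ + eLpNorm (fun z => f n z - g z) 2 μ) atTop
      (𝓝 (eLpNorm g 2 μ + 0)) := tendsto_const_nhds.add h
  rw [tsub_zero] at hl
  rw [add_zero] at hu
  refine tendsto_of_tendsto_of_tendsto_of_le_of_le hl hu (fun n => ?_) (fun n => ?_)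
  · rw [tsub_le_iff_right]
    have : g = f n - fun z => f n z - g z := by ext z; simp
    calc eLpNorm g 2 μ = eLpNorm (f n - fun z => f n z - g z) 2 μ := by rw [← this]
      _ ≤ _ := eLpNorm_sub_le (hf n) ((hf n).sub hg) one_le_two
  · have : f n = g + fun z => f n z - g z := by ext z; simp
    calc eLpNorm (f n) 2 μ = eLpNorm (g + fun z => f n z - g z) 2 μ := by rw [← this]
      _ ≤ _ := eLpNorm_add_le hg ((hf n).sub hg) one_le_two

/-- The exponential weight is unbounded on the whole space, so passing to the limit in weighted
norms uses a common compact set containing the supports. -/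
theorem tendsto_eLpNorm_smul_of_support {α : Type*} [TopologicalSpace α] [MeasurableSpace α]
    [BorelSpace α] {μ : Measure α} {f : ℕ → α → ℂ} {g : α → ℂ}
    (hf : ∀ n, AEStronglyMeasurable (f n) μ) (hg : AEStronglyMeasurable g μ) {K : Set α}
    (hK : IsCompact K) (hfK : ∀ᶠ n in atTop, Function.support (f n) ⊆ K)
    (hgK : Function.support g ⊆ K) {a : α → ℝ} (ha : Continuous a)
    (h : Tendsto (fun n => eLpNorm (fun z => f n z - g z) 2 μ) atTop (𝓝 0)) :
    Tendsto (fun n => eLpNorm (fun z => a z • f n z) 2 μ) atTop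
      (𝓝 (eLpNorm (fun z => a z • g z) 2 μ)) := by
  obtain ⟨C, hC⟩ := hK.exists_bound_of_continuousOn ha.continuousOn
  refine tendsto_eLpNorm_of_tendsto_sub (fun n => ha.aestronglyMeasurable.smul (hf n))
    (ha.aestronglyMeasurable.smul hg) ?_
  have h0 : Tendsto (fun n => ENNReal.ofReal |C| * eLpNorm (fun z => f n z - g z) 2 μ) atTop
      (𝓝 (ENNReal.ofReal |C| * 0)) :=
    ENNReal.Tendsto.const_mul h (Or.inr ENNReal.ofReal_ne_top)
  rw [mul_zero] at h0
  refine tendsto_of_tendsto_of_tendsto_of_le_of_le' tendsto_const_nhds h0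
    (Eventually.of_forall fun n => zero_le) ?_
  filter_upwards [hfK] with n hn
  refine eLpNorm_le_mul_eLpNorm_of_ae_le_mul (ae_of_all _ fun z => ?_) 2
  rw [← smul_sub, norm_smul]
  by_cases hz : z ∈ K
  · exact mul_le_mul_of_nonneg_right ((hC z hz).trans (le_abs_self C)) (norm_nonneg _)
  · have h1 : f n z = 0 := by_contra fun h => hz (hn h)
    have h2 : g z = 0 := by_contra fun h => hz (hgK h)
    simp [h1, h2]

variable {E : Type*} [NormedAddCommGroup E] [NormedSpace ℝ E] {ι : Type*} [Fintype ι]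
  [DecidableEq ι] [MeasurableSpace E] [BorelSpace E] [FiniteDimensional ℝ E] {μ : Measure E}
  [μ.IsAddHaarMeasure] {e : ι → E} {y : ι → E → ℝ}

theorem carleman_smooth_complex (hy : IsCoordSystem e y) (σ ρ : ι → ℝ) {γ δ κ R : ℝ}
    (hδ : 0 < δ) (hκ : 0 < κ) {S : Set E} (hR : ∀ z ∈ S, ∀ a, y a z ^ 2 ≤ R)
    (hσ : ∀ a, δ ≤ σ a * (γ + σ a * ρ a))
    (hS : ∀ z ∈ S, κ ≤ ∑ a, 4 * σ a * ρ a ^ 2 * (σ a * ρ a - γ) * y a z ^ 2) :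
    ∃ η > 0, ∃ s₀ : ℝ, ∀ s ≥ s₀, ∀ w : E → ℂ, IsTest w → Function.support w ⊆ S →
      ENNReal.ofReal (s * η) *
        ((∑ a, eLpNorm (fun z => Real.exp (s * quadWeight y ρ z) • dirDeriv (e a) w z) 2 μ ^ 2)
        + eLpNorm (fun z => Real.exp (s * quadWeight y ρ z) • w z) 2 μ ^ 2)
      ≤ eLpNorm (fun z => Real.exp (s * quadWeight y ρ z) • diagOp e σ w z) 2 μ ^ 2 := by
  obtain ⟨η, hη, s₀, h⟩ := carleman_smooth (μ := μ) hy σ ρ hδ hκ hR hσ hS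
  refine ⟨η, hη, s₀, fun s hs w hw hwS => ?_⟩
  have hφ : ContDiff ℝ (⊤ : ℕ∞) (fun z => Real.exp (s * quadWeight y ρ z)) :=
    (contDiff_const.mul (contDiff_quadWeight hy ρ)).exp
  have key : ∀ {f : E → ℂ}, IsTest f →
      eLpNorm (fun z => Real.exp (s * quadWeight y ρ z) • f z) 2 μ ^ 2
        = ENNReal.ofReal (∫ z, (Real.exp (s * quadWeight y ρ z) * (f z).re) ^ 2 ∂μ
          + ∫ z, (Real.exp (s * quadWeight y ρ z) * (f z).im) ^ 2 ∂μ) := by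
    intro f hf
    have hm : MemLp (fun z => Real.exp (s * quadWeight y ρ z) • f z) 2 μ :=
      (hφ.continuous.smul hf.continuous).memLp_of_hasCompactSupport hf.compact.smul_left
    rw [eLpNorm_two_eq hm, ← ENNReal.ofReal_pow (Real.sqrt_nonneg _),
      Real.sq_sqrt (integral_nonneg fun _ => sq_nonneg _), integrable_re_im_sq hm]
    simp only [Complex.smul_re, Complex.smul_im, smul_eq_mul]
  have hre := h s hs _ hw.re fun z hz => hwS fun h0 => hz (by simp [h0])
  have him := h s hs _ hw.im fun z hz => hwS fun h0 => hz (by simp [h0])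
  simp only [dirDeriv_re hw.differentiable, diagOp_re _ _ hw] at hre
  simp only [dirDeriv_im hw.differentiable, diagOp_im _ _ hw] at him
  simp only [key hw, key (hw.dirDeriv _), key hw.diagOp]
  have hnn : ∀ f : E → ℝ, 0 ≤ ∫ z, (Real.exp (s * quadWeight y ρ z) * f z) ^ 2 ∂μ :=
    fun f => integral_nonneg fun _ => sq_nonneg _
  rw [← ENNReal.ofReal_sum_of_nonneg fun a _ => add_nonneg (hnn _) (hnn _),
    ← ENNReal.ofReal_add (Finset.sum_nonneg fun a _ => add_nonneg (hnn _) (hnn _))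
      (add_nonneg (hnn _) (hnn _)), ← ENNReal.ofReal_mul' (add_nonneg
      (Finset.sum_nonneg fun a _ => add_nonneg (hnn _) (hnn _)) (add_nonneg (hnn _) (hnn _)))]
  refine ENNReal.ofReal_le_ofReal ?_
  rw [Finset.sum_add_distrib]
  linarith

/-- The Carleman estimate for compactly supported functions with weak derivatives in `L²`. -/
theorem carleman_weak (hy : IsCoordSystem e y) (σ ρ : ι → ℝ) {γ δ κ R : ℝ}
    (hδ : 0 < δ) (hκ : 0 < κ) {S : Set E} (hSo : IsOpen S) (hR : ∀ z ∈ S, ∀ a, y a z ^ 2 ≤ R)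
    (hσ : ∀ a, δ ≤ σ a * (γ + σ a * ρ a))
    (hS : ∀ z ∈ S, κ ≤ ∑ a, 4 * σ a * ρ a ^ 2 * (σ a * ρ a - γ) * y a z ^ 2) :
    ∃ η > 0, ∃ s₀ : ℝ, ∀ s ≥ s₀, ∀ (w : E → ℂ) (D : ι → E → ℂ) (H : E → ℂ) (K : Set E),
      IsCompact K → K ⊆ S → Function.support w ⊆ K → (∀ a, Function.support (D a) ⊆ K) →
      Function.support H ⊆ K → MemLp w 2 μ → (∀ a, MemLp (D a) 2 μ) → MemLp H 2 μ →
      (∀ a, IsGlobalWeakDeriv μ (e a) w (D a)) → IsGlobalWeakDiagOp μ e σ w H →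
      ENNReal.ofReal (s * η) *
        ((∑ a, eLpNorm (fun z => Real.exp (s * quadWeight y ρ z) • D a z) 2 μ ^ 2)
        + eLpNorm (fun z => Real.exp (s * quadWeight y ρ z) • w z) 2 μ ^ 2)
      ≤ eLpNorm (fun z => Real.exp (s * quadWeight y ρ z) • H z) 2 μ ^ 2 := by
  obtain ⟨η, hη, s₀, h⟩ := carleman_smooth_complex (μ := μ) hy σ ρ hδ hκ hR hσ hS
  refine ⟨η, hη, s₀, fun s hs w D H K hK hKS hwK hDK hHK hw hD hH hwD hwH => ?_⟩
  -- Room for mollification: kernels of radius less than `r` keep the supports inside `S`, where the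
  -- smooth estimate is available.
  obtain ⟨r, hr, hrS⟩ := hK.exists_cthickening_subset_open hSo hKS
  have hloc : ∀ {f : E → ℂ}, MemLp f 2 μ → LocallyIntegrable f μ :=
    fun hf => hf.locallyIntegrable one_le_two
  have hsupp : ∀ᶠ n in atTop, ∀ f : E → ℂ, Function.support f ⊆ K →
      Function.support (smoothApprox μ n f) ⊆ Metric.cthickening r K := by
    filter_upwards [(tendsto_order.1 (tendsto_shrinkingBump_rOut (E := E))).2 r hr] with n hn f hf
    refine (support_mollify_subset ?_ hf).trans (Metric.cthickening_mono hn.le K)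
    rw [ContDiffBump.support_normed_eq]
  have hcont : Continuous fun z => Real.exp (s * quadWeight y ρ z) :=
    (continuous_const.mul (contDiff_quadWeight hy ρ).continuous).rexp
  have hlim : ∀ {f : E → ℂ}, MemLp f 2 μ → Function.support f ⊆ K →
      Tendsto (fun n => eLpNorm (fun z => Real.exp (s * quadWeight y ρ z) •
        smoothApprox μ n f z) 2 μ ^ 2) atTop
      (𝓝 (eLpNorm (fun z => Real.exp (s * quadWeight y ρ z) • f z) 2 μ ^ 2)) := by
    intro f hf hfK
    refine (ENNReal.continuous_pow 2).continuousAt.tendsto.comp ?_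
    refine tendsto_eLpNorm_smul_of_support (fun n => (contDiff_mollify (isTest_normed _)
      (hloc hf)).continuous.aestronglyMeasurable) hf.1 (hK.cthickening (r := r)) ?_
      (hfK.trans (Metric.self_subset_cthickening K)) hcont (tendsto_eLpNorm_smoothApprox_sub hf)
    filter_upwards [hsupp] with n hn using hn f hfK
  refine le_of_tendsto_of_tendsto (ENNReal.Tendsto.const_mul
    ((tendsto_finsetSum _ fun a _ => hlim (hD a) (hDK a)).add (hlim hw hwK))
    (Or.inr ENNReal.ofReal_ne_top)) (hlim hH hHK) ?_
  filter_upwards [hsupp] with n hn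
  have ht : IsTest (smoothApprox μ n w) := isTest_mollify (isTest_normed _) (hloc hw) hK hwK
  have := h s hs _ ht ((hn w hwK).trans hrS)
  simp only [smoothApprox] at this ⊢
  simp only [dirDeriv_mollify_eq (isTest_normed _) (hloc hw) (hwD _),
    diagOp_mollify_eq (isTest_normed _) (hloc hw) hwH] at this
  exact this

end WeakCarleman

/-! ### Localization by cutoff functions and unique continuation -/

section Localization

variable {E : Type*} [NormedAddCommGroup E] [NormedSpace ℝ E] {ι : Type*} [Fintype ι]
  [MeasurableSpace E] [BorelSpace E] [FiniteDimensional ℝ E] {μ : Measure E}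

theorem exists_isTest_eq_one_nhds {L Ω : Set E} (hL : IsCompact L) (hΩ : IsOpen Ω)
    (hLΩ : L ⊆ Ω) : ∃ θ : E → ℝ, IsTest θ ∧ tsupport θ ⊆ Ω ∧ ∀ z ∈ L, ∀ᶠ z' in 𝓝 z, θ z' = 1 := by
  obtain ⟨δ, hδ, hδΩ⟩ := hL.exists_cthickening_subset_open hΩ hLΩ
  have hint : L ⊆ interior (Metric.cthickening δ L) :=
    (Metric.self_subset_thickening hδ L).trans (Metric.isOpen_thickening.subset_interior_iff.2
      (Metric.thickening_subset_cthickening δ L))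
  obtain ⟨f, h1, h0, -⟩ := exists_contMDiffMap_one_nhds_of_subset_interior (n := (⊤ : ℕ∞))
    (modelWithCornersSelf ℝ E) hL.isClosed hint
  have hs : tsupport f ⊆ Metric.cthickening δ L := by
    refine closure_minimal (fun z hz => ?_) Metric.isClosed_cthickening
    by_contra h
    exact hz (h0 z h)
  exact ⟨f, ⟨f.contMDiff.contDiff, hL.cthickening.of_isClosed_subset (isClosed_tsupport _) hs⟩,
    hs.trans hδΩ, fun z hz => (eventually_nhdsSet_iff_forall.1 h1) z hz⟩

/-- `U ∈ L²` has weak derivatives `D a ∈ L²` on `Ω`, and `∑ σ a ∂_a² U = F ∈ L²` weakly on `Ω`. -/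
structure IsLocalSolution (μ : Measure E) (Ω : Set E) (e : ι → E) (σ : ι → ℝ)
    (U : E → ℂ) (D : ι → E → ℂ) (F : E → ℂ) : Prop where
  memLp : MemLp U 2 μ
  memLp_deriv : ∀ a, MemLp (D a) 2 μ
  memLp_rhs : MemLp F 2 μ
  deriv : ∀ a, ∀ φ : E → ℝ, IsTest φ → tsupport φ ⊆ Ω →
    ∫ z, dirDeriv (e a) φ z • U z ∂μ = - ∫ z, φ z • D a z ∂μ
  eqn : ∀ φ : E → ℝ, IsTest φ → tsupport φ ⊆ Ω →
    ∫ z, diagOp e σ φ z • U z ∂μ = ∫ z, φ z • F z ∂μ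

theorem IsTest.integrable_smul [IsFiniteMeasureOnCompacts μ] [IsLocallyFiniteMeasure μ]
    {φ : E → ℝ} (hφ : IsTest φ) {f : E → ℂ} (hf : MemLp f 2 μ) :
    Integrable (fun z => φ z • f z) μ :=
  (hf.locallyIntegrable one_le_two).integrable_smul_left_of_hasCompactSupport hφ.continuous
    hφ.compact

theorem IsTest.memLp_smul {φ : E → ℝ} (hφ : IsTest φ) {f : E → ℂ} (hf : MemLp f 2 μ) :
    MemLp (fun z => φ z • f z) 2 μ := by
  obtain ⟨C, hC⟩ := hφ.continuous.bounded_above_of_compact_support hφ.compact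
  refine hf.of_le_mul (c := C) (hφ.continuous.aestronglyMeasurable.smul hf.1)
    (ae_of_all _ fun z => ?_)
  rw [norm_smul]
  exact mul_le_mul_of_nonneg_right (hC z) (norm_nonneg _)

/-- The weak derivatives of `χ U`. -/
def cutoffDeriv (e : ι → E) (χ : E → ℝ) (U : E → ℂ) (D : ι → E → ℂ) (a : ι) (z : E) : ℂ :=
  χ z • D a z + dirDeriv (e a) χ z • U z

/-- The image of `χ U` under `∑ σ a ∂_a²`. -/
def cutoffRhs (e : ι → E) (σ : ι → ℝ) (χ : E → ℝ) (U : E → ℂ) (D : ι → E → ℂ) (F : E → ℂ)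
    (z : E) : ℂ :=
  χ z • F z + (∑ a, (2 * σ a) • (dirDeriv (e a) χ z • D a z)) + diagOp e σ χ z • U z

variable [μ.IsAddHaarMeasure] {Ω : Set E} {e : ι → E} {σ : ι → ℝ} {U : E → ℂ} {D : ι → E → ℂ}
  {F : E → ℂ} {χ : E → ℝ}

theorem IsLocalSolution.memLp_cutoffDeriv (h : IsLocalSolution μ Ω e σ U D F) (hχ : IsTest χ)
    (a : ι) : MemLp (cutoffDeriv e χ U D a) 2 μ :=
  (hχ.memLp_smul (h.memLp_deriv a)).add ((hχ.dirDeriv _).memLp_smul h.memLp)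

theorem IsLocalSolution.memLp_cutoffRhs (h : IsLocalSolution μ Ω e σ U D F) (hχ : IsTest χ) :
    MemLp (cutoffRhs e σ χ U D F) 2 μ :=
  ((hχ.memLp_smul h.memLp_rhs).add (memLp_finsetSum _ fun a _ =>
    ((hχ.dirDeriv _).memLp_smul (h.memLp_deriv a)).const_smul (2 * σ a))).add
    (hχ.diagOp.memLp_smul h.memLp)

theorem tsupport_mul_right_subset_of {φ χ : E → ℝ} (h : tsupport χ ⊆ Ω) :
    tsupport (fun z => φ z * χ z) ⊆ Ω :=
  (closure_mono fun z (hz : φ z * χ z ≠ 0) => right_ne_zero_of_mul hz).trans h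

theorem IsLocalSolution.isGlobalWeakDeriv_cutoff (h : IsLocalSolution μ Ω e σ U D F)
    (hχ : IsTest χ) (hχΩ : tsupport χ ⊆ Ω) (a : ι) :
    IsGlobalWeakDeriv μ (e a) (fun z => χ z • U z) (cutoffDeriv e χ U D a) := by
  intro φ hφ
  have h1 := h.deriv a (fun z => φ z * χ z) (hφ.mul hχ) (tsupport_mul_right_subset_of hχΩ)
  rw [dirDeriv_mul hφ.differentiable hχ.differentiable] at h1
  simp only [add_smul] at h1
  rw [integral_add (((hφ.dirDeriv _).mul hχ).integrable_smul h.memLp)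
    ((hφ.mul (hχ.dirDeriv _)).integrable_smul h.memLp)] at h1
  simp only [cutoffDeriv, smul_add, smul_smul]
  rw [integral_add ((hφ.mul hχ).integrable_smul (h.memLp_deriv a))
    ((hφ.mul (hχ.dirDeriv _)).integrable_smul h.memLp), eq_sub_of_add_eq h1]
  ring

/-- The transposed Leibniz rule. The cross term has the form `∂_a (φ ∂_a χ)`, so that against `U` it
can be evaluated by the weak first derivatives. -/
theorem diagOp_mul {φ χ : E → ℝ} (hφ : IsTest φ) (hχ : IsTest χ) (z : E) :
    diagOp e σ φ z * χ z = diagOp e σ (fun z => φ z * χ z) z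
      - (∑ a, 2 * σ a * dirDeriv (e a) (fun z => φ z * dirDeriv (e a) χ z) z)
      + φ z * diagOp e σ χ z := by
  simp only [diagOp, smul_eq_mul, Finset.sum_mul, Finset.mul_sum, ← Finset.sum_sub_distrib,
    ← Finset.sum_add_distrib]
  refine Finset.sum_congr rfl fun a _ => ?_
  rw [dirDeriv_mul hφ.differentiable (hχ.dirDeriv _).differentiable,
    dirDeriv_mul hφ.differentiable hχ.differentiable,
    dirDeriv_add ((hφ.dirDeriv _).mul hχ).differentiable (hφ.mul (hχ.dirDeriv _)).differentiable,
    dirDeriv_mul (hφ.dirDeriv _).differentiable hχ.differentiable,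
    dirDeriv_mul hφ.differentiable (hχ.dirDeriv _).differentiable]
  ring

theorem IsLocalSolution.isGlobalWeakDiagOp_cutoff (h : IsLocalSolution μ Ω e σ U D F)
    (hχ : IsTest χ) (hχΩ : tsupport χ ⊆ Ω) :
    IsGlobalWeakDiagOp μ e σ (fun z => χ z • U z) (cutoffRhs e σ χ U D F) := by
  intro φ hφ
  have h1 := h.eqn (fun z => φ z * χ z) (hφ.mul hχ) (tsupport_mul_right_subset_of hχΩ)
  have h2 := fun a => h.deriv a (fun z => φ z * dirDeriv (e a) χ z) (hφ.mul (hχ.dirDeriv _))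
    (tsupport_mul_right_subset_of ((tsupport_dirDeriv_subset _ _).trans hχΩ))
  have t2 : ∀ a, IsTest fun z => φ z * dirDeriv (e a) χ z := fun a => hφ.mul (hχ.dirDeriv _)
  have j1 := ((hφ.mul hχ).diagOp (e := e) (σ := σ)).integrable_smul h.memLp
  have j2 : ∀ a, Integrable (fun z => (2 * σ a) •
      (dirDeriv (e a) (fun z => φ z * dirDeriv (e a) χ z) z • U z)) μ := fun a =>
    (((t2 a).dirDeriv (e a)).integrable_smul h.memLp).smul (2 * σ a)
  have j3 := (hφ.mul (hχ.diagOp (e := e) (σ := σ))).integrable_smul h.memLp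
  have k1 := (hφ.mul hχ).integrable_smul h.memLp_rhs
  have k2 : ∀ a, Integrable (fun z => (2 * σ a) • ((φ z * dirDeriv (e a) χ z) • D a z)) μ :=
    fun a => ((t2 a).integrable_smul (h.memLp_deriv a)).smul (2 * σ a)
  have hl : ∀ z, diagOp e σ φ z • (χ z • U z) = diagOp e σ (fun z => φ z * χ z) z • U z
      - (∑ a, (2 * σ a) • (dirDeriv (e a) (fun z => φ z * dirDeriv (e a) χ z) z • U z))
      + (φ z * diagOp e σ χ z) • U z := by
    intro z
    rw [smul_smul, diagOp_mul hφ hχ, add_smul, sub_smul, Finset.sum_smul]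
    simp only [smul_smul]
  have hr : ∀ z, φ z • cutoffRhs e σ χ U D F z = (φ z * χ z) • F z
      + (∑ a, (2 * σ a) • ((φ z * dirDeriv (e a) χ z) • D a z))
      + (φ z * diagOp e σ χ z) • U z := by
    intro z
    simp only [cutoffRhs, smul_add, smul_smul, Finset.smul_sum]
    congr 2
    exact Finset.sum_congr rfl fun a _ => by congr 1; ring
  simp only [hl, hr]
  have j2s : Integrable (fun z => ∑ a, (2 * σ a) •
      (dirDeriv (e a) (fun z => φ z * dirDeriv (e a) χ z) z • U z)) μ :=
    integrable_finsetSum _ fun a _ => j2 a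
  have j12 : Integrable (fun z => diagOp e σ (fun z => φ z * χ z) z • U z - ∑ a, (2 * σ a) •
      (dirDeriv (e a) (fun z => φ z * dirDeriv (e a) χ z) z • U z)) μ := j1.sub j2s
  have k2s : Integrable (fun z => ∑ a, (2 * σ a) • ((φ z * dirDeriv (e a) χ z) • D a z)) μ :=
    integrable_finsetSum _ fun a _ => k2 a
  have k12 : Integrable (fun z => (φ z * χ z) • F z
      + ∑ a, (2 * σ a) • ((φ z * dirDeriv (e a) χ z) • D a z)) μ := k1.add k2s
  rw [integral_add j12 j3, integral_sub j1 j2s, integral_finsetSum _ fun a _ => j2 a,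
    integral_add k12 j3, integral_add k1 k2s, integral_finsetSum _ fun a _ => k2 a, h1]
  simp only [integral_smul, h2, smul_neg, Finset.sum_neg_distrib, sub_neg_eq_add]

theorem dirDeriv_eq_zero_of_eventually_eq_const {G : Type*} [NormedAddCommGroup G]
    [NormedSpace ℝ G] {f : E → G} {z : E} {c : G} (h : ∀ᶠ z' in 𝓝 z, f z' = c) (d : E) :
    ∀ᶠ z' in 𝓝 z, dirDeriv d f z' = 0 := by
  filter_upwards [eventually_eventually_nhds.2 h] with z' hz'
  have : f =ᶠ[𝓝 z'] fun _ => c := hz'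
  simp [dirDeriv, this.fderiv_eq]

/-- Since `χ` is constant on a neighbourhood and not merely equal to `1` at the point, both of its
derivatives vanish and no commutator term remains. -/
theorem cutoff_eq_of_eventually_eq_one {z : E} (h : ∀ᶠ z' in 𝓝 z, χ z' = 1) :
    (∀ a, cutoffDeriv e χ U D a z = D a z) ∧ cutoffRhs e σ χ U D F z = F z := by
  have h0 := h.self_of_nhds
  have h1 := fun a => dirDeriv_eq_zero_of_eventually_eq_const h (e a)
  have h2 := fun a => (dirDeriv_eq_zero_of_eventually_eq_const (h1 a) (e a)).self_of_nhds
  simp [cutoffDeriv, cutoffRhs, h0, (h1 _).self_of_nhds, diagOp, h2]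

theorem support_cutoffDeriv_subset (a : ι) :
    Function.support (cutoffDeriv e χ U D a) ⊆ tsupport χ := by
  intro z hz
  by_contra h
  have h1 : dirDeriv (e a) χ z = 0 :=
    image_eq_zero_of_notMem_tsupport fun h' => h (tsupport_dirDeriv_subset _ _ h')
  exact hz (by simp [cutoffDeriv, h1, image_eq_zero_of_notMem_tsupport h])

theorem support_cutoffRhs_subset :
    Function.support (cutoffRhs e σ χ U D F) ⊆ tsupport χ := by
  intro z hz
  by_contra h
  have h1 : ∀ a, dirDeriv (e a) χ z = 0 := fun a =>
    image_eq_zero_of_notMem_tsupport fun h' => h (tsupport_dirDeriv_subset _ _ h')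
  have h2 : ∀ a, dirDeriv (e a) (dirDeriv (e a) χ) z = 0 := fun a =>
    image_eq_zero_of_notMem_tsupport fun h' => h (tsupport_dirDeriv_subset _ _
      (tsupport_dirDeriv_subset _ _ h'))
  exact hz (by simp [cutoffRhs, diagOp, h1, h2, image_eq_zero_of_notMem_tsupport h])

end Localization

/-! ### Unique continuation -/

section UniqueContinuation

variable {E : Type*} [NormedAddCommGroup E] [NormedSpace ℝ E] {ι : Type*} [Fintype ι]
  [DecidableEq ι] [MeasurableSpace E] [BorelSpace E] [FiniteDimensional ℝ E] {μ : Measure E}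
  [μ.IsAddHaarMeasure] {e : ι → E} {y : ι → E → ℝ}

theorem enorm_exp_smul_sq (a : ℝ) (x : ℂ) :
    ‖Real.exp a • x‖ₑ ^ 2 = ENNReal.ofReal (Real.exp (2 * a)) * ‖x‖ₑ ^ 2 := by
  rw [enorm_smul, mul_pow, Real.enorm_eq_ofReal (Real.exp_pos a).le,
    ← ENNReal.ofReal_pow (Real.exp_pos a).le, ← Real.exp_nat_mul]
  norm_num

/-- On the set the weight squared is at least `e^{2sc₂}`, while the right side grows only like
`e^{2sc₁}`; let `s → ∞`. -/
theorem setLIntegral_eq_zero_of_exp_bound {α : Type*} [MeasurableSpace α] {μ : Measure α}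
    {w : α → ℂ} {ψ : α → ℝ} {c₁ c₂ s₁ : ℝ} (hc : c₁ < c₂) {A : ℝ≥0∞} (hA : A ≠ ∞)
    (h : ∀ s ≥ s₁, ∫⁻ z, ‖Real.exp (s * ψ z) • w z‖ₑ ^ 2 ∂μ
      ≤ ENNReal.ofReal (Real.exp (2 * (s * c₁))) * A)
    (hm : MeasurableSet {z | c₂ < ψ z}) : ∫⁻ z in {z | c₂ < ψ z}, ‖w z‖ₑ ^ 2 ∂μ = 0 := by
  set X := ∫⁻ z in {z | c₂ < ψ z}, ‖w z‖ₑ ^ 2 ∂μ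
  have hb : ∀ s ≥ max s₁ 0, X ≤ ENNReal.ofReal (Real.exp (-(s * (2 * (c₂ - c₁))))) * A := by
    intro s hs
    have hs0 : 0 ≤ s := (le_max_right _ _).trans hs
    have h1 : ENNReal.ofReal (Real.exp (2 * (s * c₂))) * X
        ≤ ENNReal.ofReal (Real.exp (2 * (s * c₁))) * A := by
      refine le_trans ?_ (h s ((le_max_left _ _).trans hs))
      rw [← lintegral_const_mul' _ _ ENNReal.ofReal_ne_top]
      refine le_trans (setLIntegral_mono' hm fun z hz => ?_) (setLIntegral_le_lintegral _ _)
      rw [enorm_exp_smul_sq]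
      gcongr
      exact le_of_lt hz
    calc X = ENNReal.ofReal (Real.exp (-(2 * (s * c₂))))
          * (ENNReal.ofReal (Real.exp (2 * (s * c₂))) * X) := by
          rw [← mul_assoc, ← ENNReal.ofReal_mul (Real.exp_pos _).le, ← Real.exp_add]
          simp
      _ ≤ ENNReal.ofReal (Real.exp (-(2 * (s * c₂))))
          * (ENNReal.ofReal (Real.exp (2 * (s * c₁))) * A) := by gcongr
      _ = _ := by
          rw [← mul_assoc, ← ENNReal.ofReal_mul (Real.exp_pos _).le, ← Real.exp_add]
          congr 3; ring
  have hlim : Tendsto (fun s : ℝ => ENNReal.ofReal (Real.exp (-(s * (2 * (c₂ - c₁))))) * A) atTop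
      (𝓝 (ENNReal.ofReal 0 * A)) := by
    refine ENNReal.Tendsto.mul_const (ENNReal.tendsto_ofReal ?_) (Or.inr hA)
    refine Real.tendsto_exp_neg_atTop_nhds_zero.comp ?_
    exact tendsto_id.atTop_mul_const (by linarith)
  rw [ENNReal.ofReal_zero, zero_mul] at hlim
  exact le_antisymm (ge_of_tendsto hlim (eventually_ge_atTop (max s₁ 0) |>.mono hb)) zero_le

/-- Unique continuation across the level sets of a quadratic weight. -/
theorem ae_eq_zero_of_lt_quadWeight (hy : IsCoordSystem e y) (σ ρ : ι → ℝ) {γ δ κ R : ℝ}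
    (hδ : 0 < δ) (hκ : 0 < κ) {S : Set E} (hSo : IsOpen S) (hR : ∀ z ∈ S, ∀ a, y a z ^ 2 ≤ R)
    (hσ : ∀ a, δ ≤ σ a * (γ + σ a * ρ a))
    (hS : ∀ z ∈ S, κ ≤ ∑ a, 4 * σ a * ρ a ^ 2 * (σ a * ρ a - γ) * y a z ^ 2)
    {Ω : Set E} (hΩ : IsOpen Ω) {U : E → ℂ} {D : ι → E → ℂ} {F : E → ℂ}
    (h : IsLocalSolution μ Ω e σ U D F) {C : NNReal}
    (hF : ∀ᵐ z ∂μ, ‖F z‖ₑ ^ 2 ≤ C * ((∑ a, ‖D a z‖ₑ ^ 2) + ‖U z‖ₑ ^ 2))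
    {Z : Set E} (hZ : ∀ᵐ z ∂μ, z ∉ Z → U z = 0 ∧ ∀ a, D a z = 0) {c c' : ℝ} (hc : c < c')
    {L : Set E} (hL : IsCompact L) (hLΩ : L ⊆ Ω ∩ S)
    (hZL : ∀ z ∈ Z, c ≤ quadWeight y ρ z → z ∈ L) :
    ∀ᵐ z ∂μ, c' < quadWeight y ρ z → U z = 0 := by
  obtain ⟨χ, hχ, hχΩ, hχL⟩ := exists_isTest_eq_one_nhds hL (hΩ.inter hSo) hLΩ
  obtain ⟨η, hη, s₀, hcarl⟩ := carleman_weak (μ := μ) hy σ ρ hδ hκ hSo hR hσ hS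
  have hψ := contDiff_quadWeight hy ρ
  have hχ1 : ∀ z ∈ Z, c < quadWeight y ρ z → ∀ᶠ z' in 𝓝 z, χ z' = 1 :=
    fun z hz hzc => hχL z (hZL z hz hzc.le)
  set w : E → ℂ := fun z => χ z • U z
  set D' := cutoffDeriv e χ U D
  set H := cutoffRhs e σ χ U D F
  have hw : MemLp w 2 μ := hχ.memLp_smul h.memLp
  have hD' : ∀ a, MemLp (D' a) 2 μ := h.memLp_cutoffDeriv hχ
  have hH : MemLp H 2 μ := h.memLp_cutoffRhs hχ
  have hψm : Continuous fun z => quadWeight y ρ z := hψ.continuous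
  -- Above the level `c` the commutator terms are absent: on `Z` the cutoff is locally `1`, and off
  -- `Z` the functions `U`, `D` and, by `hF`, also `F` vanish.
  have hae : ∀ᵐ z ∂μ, (c < quadWeight y ρ z →
      ‖H z‖ₑ ^ 2 ≤ C * ((∑ a, ‖D' a z‖ₑ ^ 2) + ‖w z‖ₑ ^ 2)) := by
    filter_upwards [hF, hZ] with z hFz hZz hzc
    by_cases hz : z ∈ Z
    · obtain ⟨h1, h2⟩ := cutoff_eq_of_eventually_eq_one (e := e) (σ := σ) (U := U) (D := D)
        (F := F) (hχ1 z hz hzc)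
      have h3 : w z = U z := by simp [w, (hχ1 z hz hzc).self_of_nhds]
      simp only [D', H, h1, h2, h3]
      exact hFz
    · obtain ⟨hU, hD⟩ := hZz hz
      have hFz0 : F z = 0 := by simpa [hU, hD] using hFz
      have : H z = 0 := by simp [H, cutoffRhs, hU, hD, hFz0]
      simp [this]
  have hbound : ∀ s ≥ max (max s₀ ((C + 1) / η)) 0,
      ∫⁻ z, ‖Real.exp (s * quadWeight y ρ z) • w z‖ₑ ^ 2 ∂μ
      ≤ ENNReal.ofReal (Real.exp (2 * (s * c))) * eLpNorm H 2 μ ^ 2 := by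
    intro s hs
    have hs0 : 0 ≤ s := (le_max_right _ _).trans hs
    have hs1 : s₀ ≤ s := (le_max_left _ _).trans ((le_max_left _ _).trans hs)
    -- Of the `C + 1` copies of the weighted norm on the left, `C` absorb the lower order terms
    -- above level `c` and one is kept.
    have hs2 : (C : ℝ) + 1 ≤ s * η := by
      rw [← div_le_iff₀ hη]; exact (le_max_right _ _).trans ((le_max_left _ _).trans hs)
    have hexp : Continuous fun z => Real.exp (s * quadWeight y ρ z) :=
      (continuous_const.mul hψm).rexp
    have main := hcarl s hs1 w D' H (tsupport χ) hχ.compact (hχΩ.trans inter_subset_right)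
      ((fun z hz => subset_tsupport _ fun h0 => hz (by simp [w, h0])))
      support_cutoffDeriv_subset support_cutoffRhs_subset
      hw hD' hH (fun a => h.isGlobalWeakDeriv_cutoff hχ (hχΩ.trans inter_subset_left) a)
      (h.isGlobalWeakDiagOp_cutoff hχ (hχΩ.trans inter_subset_left))
    set N : (E → ℂ) → ℝ≥0∞ :=
      fun f => eLpNorm (fun z => Real.exp (s * quadWeight y ρ z) • f z) 2 μ ^ 2 with hN
    have hNi : ∀ f, N f = ∫⁻ z, ‖Real.exp (s * quadWeight y ρ z) • f z‖ₑ ^ 2 ∂μ :=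
      fun f => eLpNorm_two_sq _
    set I := (∑ a, N (D' a)) + N w with hI
    have hm : ∀ {f : E → ℂ}, MemLp f 2 μ →
        AEMeasurable (fun z => ‖Real.exp (s * quadWeight y ρ z) • f z‖ₑ ^ 2) μ := fun hf =>
      ((hexp.aestronglyMeasurable.smul hf.1).enorm).pow_const 2
    have hNfin : ∀ {f : E → ℂ}, MemLp f 2 μ → Function.support f ⊆ tsupport χ → N f ≠ ∞ := by
      intro f hf hfs
      obtain ⟨B, hB⟩ := hχ.compact.exists_bound_of_continuousOn hexp.continuousOn
      have : MemLp (fun z => Real.exp (s * quadWeight y ρ z) • f z) 2 μ := by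
        refine hf.of_le_mul (c := B) (hexp.aestronglyMeasurable.smul hf.1)
          (ae_of_all _ fun z => ?_)
        by_cases hz : z ∈ tsupport χ
        · rw [norm_smul]
          exact mul_le_mul_of_nonneg_right (hB z hz) (norm_nonneg _)
        · have : f z = 0 := by_contra fun h0 => hz (hfs h0)
          simp [this]
      exact ENNReal.pow_ne_top this.2.ne
    -- Finiteness allows `C * I` to be cancelled in `ℝ≥0∞`.
    have hIfin : I ≠ ∞ := by
      refine ENNReal.add_ne_top.2 ⟨ENNReal.sum_ne_top.2 fun a _ => hNfin (hD' a)
        (support_cutoffDeriv_subset a), hNfin hw fun z hz =>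
        subset_tsupport _ fun h0 => hz (by simp [w, h0])⟩
    have hNH : N H ≤ C * I + ENNReal.ofReal (Real.exp (2 * (s * c))) * eLpNorm H 2 μ ^ 2 := by
      rw [hNi, eLpNorm_two_sq, hI]
      simp only [hNi]
      have hms : AEMeasurable (fun z =>
          ∑ a, ‖Real.exp (s * quadWeight y ρ z) • D' a z‖ₑ ^ 2) μ :=
        Finset.aemeasurable_fun_sum _ fun a _ => hm (hD' a)
      have hmc : AEMeasurable (fun z =>
          (C : ℝ≥0∞) * (∑ a, ‖Real.exp (s * quadWeight y ρ z) • D' a z‖ₑ ^ 2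
            + ‖Real.exp (s * quadWeight y ρ z) • w z‖ₑ ^ 2)) μ := (hms.add (hm hw)).const_mul _
      rw [← lintegral_finsetSum' _ fun a _ => hm (hD' a), ← lintegral_add_left' hms,
        ← lintegral_const_mul' _ _ ENNReal.coe_ne_top,
        ← lintegral_const_mul' _ _ ENNReal.ofReal_ne_top,
        ← lintegral_add_left' hmc]
      refine lintegral_mono_ae ?_
      filter_upwards [hae] with z hz
      by_cases hzc : c < quadWeight y ρ z
      · refine le_add_right ?_
        simp only [enorm_exp_smul_sq, ← Finset.mul_sum, ← mul_add]
        exact (mul_le_mul' le_rfl (hz hzc)).trans_eq (mul_left_comm _ _ _)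
      · refine le_add_left ?_
        rw [enorm_exp_smul_sq]
        gcongr
        exact not_lt.1 hzc
    have hfin : (C : ℝ≥0∞) * I + I
        ≤ C * I + ENNReal.ofReal (Real.exp (2 * (s * c))) * eLpNorm H 2 μ ^ 2 := by
      refine le_trans ?_ (main.trans hNH)
      have : (C : ℝ≥0∞) + 1 ≤ ENNReal.ofReal (s * η) := by
        calc (C : ℝ≥0∞) + 1 = ENNReal.ofReal ((C : ℝ) + 1) := by
              rw [ENNReal.ofReal_add C.coe_nonneg zero_le_one]; simp
          _ ≤ _ := ENNReal.ofReal_le_ofReal hs2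
      calc (C : ℝ≥0∞) * I + I = (C + 1) * I := by rw [add_mul, one_mul]
        _ ≤ ENNReal.ofReal (s * η) * I := by gcongr
    rw [← hNi w]
    exact le_trans le_add_self ((ENNReal.add_le_add_iff_left
      (ENNReal.mul_ne_top ENNReal.coe_ne_top hIfin)).1 hfin)
  have hopen : MeasurableSet {z | c' < quadWeight y ρ z} :=
    (isOpen_lt continuous_const hψm).measurableSet
  have h0 := setLIntegral_eq_zero_of_exp_bound hc (ENNReal.pow_ne_top hH.2.ne) hbound hopen
  rw [lintegral_eq_zero_iff' (hw.1.restrict.enorm.pow_const 2)] at h0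
  filter_upwards [ae_imp_of_ae_restrict h0, hZ] with z hz hZz hzc
  by_cases hzZ : z ∈ Z
  · have h1 : w z = 0 := by simpa using hz hzc
    simpa [w, (hχ1 z hzZ (hc.trans hzc)).self_of_nhds] using h1
  · exact (hZz hzZ).1

end UniqueContinuation

/-! ### Continuity in time of weak solutions -/

section Curves

theorem exists_tendstoUniformly_of_edist_le {B : Type*} [NormedAddCommGroup B] [CompleteSpace B]
    {v : ℕ → ℝ → B} {a : ℕ → ℝ≥0∞} (ha : Tendsto a atTop (𝓝 0))
    (h : ∀ n m t, edist (v n t) (v m t) ≤ a n + a m) :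
    ∃ V : ℝ → B, TendstoUniformly v V atTop := by
  have hcau : UniformCauchySeqOn v atTop univ := by
    rw [Metric.uniformCauchySeqOn_iff]
    intro ε hε
    have hε2 : 0 < ENNReal.ofReal ε / 2 := ENNReal.half_pos (ENNReal.ofReal_pos.2 hε).ne'
    obtain ⟨N, hN⟩ := eventually_atTop.1 ((tendsto_order.1 ha).2 _ hε2)
    refine ⟨N, fun m hm n hn t _ => edist_lt_ofReal.1 ((h m n t).trans_lt ?_)⟩
    calc a m + a n < ENNReal.ofReal ε / 2 + ENNReal.ofReal ε / 2 :=
          ENNReal.add_lt_add (hN m hm) (hN n hn)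
      _ = ENNReal.ofReal ε := ENNReal.add_halves _
  have hlim : ∀ t, ∃ l, Tendsto (fun n => v n t) atTop (𝓝 l) := fun t =>
    cauchySeq_tendsto_of_complete (hcau.cauchySeq (mem_univ t))
  choose V hV using hlim
  exact ⟨V, tendstoUniformlyOn_univ.1
    (hcau.tendstoUniformlyOn_of_tendsto fun t _ => hV t)⟩

variable {X : Type*} [NormedAddCommGroup X] [NormedSpace ℝ X] [MeasurableSpace X] [BorelSpace X]
  [FiniteDimensional ℝ X] {ν : Measure X} [ν.IsAddHaarMeasure]

theorem eLpNorm_le_of_support_subset {g : X → ℂ} {K : Set X} (hg : Function.support g ⊆ K)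
    {C : ℝ} (hC : ∀ x, ‖g x‖ ≤ C) :
    eLpNorm g 2 ν ≤ ν K ^ (2⁻¹ : ℝ) * ENNReal.ofReal C := by
  rw [← eLpNorm_restrict_eq_of_support_subset hg]
  simpa using eLpNorm_le_of_ae_bound (μ := ν.restrict K) (p := 2) (ae_of_all _ hC)

/-- The time slice of a test function, as an element of `L²`. -/
def sliceLp (ν : Measure X) [ν.IsAddHaarMeasure] {f : ℝ × X → ℂ} (hf : IsTest f) (t : ℝ) :
    Lp ℂ 2 ν := ((hf.slice t).memLp 2).toLp

theorem edist_sliceLp {f g : ℝ × X → ℂ} (hf : IsTest f) (hg : IsTest g) (t : ℝ) :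
    edist (sliceLp ν hf t) (sliceLp ν hg t) = eLpNorm (fun x => f (t, x) - g (t, x)) 2 ν := by
  rw [sliceLp, sliceLp, Lp.edist_toLp_toLp]
  rfl

/-- The mean value inequality in time, uniform in `x` by uniform continuity of `∂_t f`, becomes an
`L²` bound because all slices are supported in one compact set. -/
theorem hasDerivAt_sliceLp {f : ℝ × X → ℂ} (hf : IsTest f) (t : ℝ) :
    HasDerivAt (sliceLp ν hf) (sliceLp ν (hf.dirDeriv ((1, 0) : ℝ × X)) t) t := by
  set ft := dirDeriv ((1, 0) : ℝ × X) f with hft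
  have htest : IsTest ft := hf.dirDeriv _
  set K : Set X := Prod.snd '' tsupport f with hK
  have hKc : IsCompact K := hf.compact.isCompact.image continuous_snd
  have hf0 : ∀ s x, x ∉ K → f (s, x) = 0 := fun s x hx =>
    image_eq_zero_of_notMem_tsupport fun h => hx ⟨(s, x), h, rfl⟩
  have hft0 : ∀ s x, x ∉ K → ft (s, x) = 0 := fun s x hx =>
    image_eq_zero_of_notMem_tsupport fun h => hx ⟨(s, x), tsupport_dirDeriv_subset _ _ h, rfl⟩
  set c := (ν K ^ (2⁻¹ : ℝ)).toReal with hc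
  have hctop : ν K ^ (2⁻¹ : ℝ) ≠ ∞ :=
    ENNReal.rpow_ne_top_of_nonneg (by norm_num) hKc.measure_lt_top.ne
  have hc0 : 0 ≤ c := ENNReal.toReal_nonneg
  rw [hasDerivAt_iff_isLittleO, Asymptotics.isLittleO_iff]
  intro ε hε
  -- Dividing by `c + 1` rather than `c` covers the case where `K` is null.
  obtain ⟨δ, hδ, hunif⟩ := Metric.uniformContinuous_iff.1
    (htest.compact.uniformContinuous_of_continuous htest.continuous) (ε / (c + 1)) (by positivity)
  filter_upwards [Metric.ball_mem_nhds t hδ] with s hs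
  have hpt : ∀ x, ‖f (s, x) - f (t, x) - (s - t) • ft (t, x)‖ ≤ ε / (c + 1) * ‖s - t‖ := by
    intro x
    have hder : ∀ r ∈ uIcc t s, HasDerivWithinAt (fun r => f (r, x) - r • ft (t, x))
        (ft (r, x) - (1 : ℝ) • ft (t, x)) (uIcc t s) r := fun r _ =>
      ((hasDerivAt_slice hf.differentiable r x).sub
        ((hasDerivAt_id r).smul_const (ft (t, x)))).hasDerivWithinAt
    have hb : ∀ r ∈ uIcc t s, ‖ft (r, x) - (1 : ℝ) • ft (t, x)‖ ≤ ε / (c + 1) := by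
      intro r hr
      rw [one_smul, ← dist_eq_norm]
      refine (hunif ?_).le
      rw [Prod.dist_eq, dist_self, max_eq_left dist_nonneg]
      calc dist r t ≤ dist s t := by
            rw [Real.dist_eq, Real.dist_eq]
            exact abs_sub_left_of_mem_uIcc hr
        _ < δ := hs
    have := (convex_uIcc t s).norm_image_sub_le_of_norm_hasDerivWithin_le hder hb left_mem_uIcc
      right_mem_uIcc
    refine le_trans (le_of_eq ?_) this
    congr 1
    rw [sub_smul]
    abel
  have heq : sliceLp ν hf s - sliceLp ν hf t - (s - t) • sliceLp ν htest t
      = ((((hf.slice s).memLp 2).sub ((hf.slice t).memLp 2)).sub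
        (((htest.slice t).memLp 2).const_smul (s - t))).toLp := rfl
  rw [heq, Lp.norm_toLp]
  have hbound := eLpNorm_le_of_support_subset (ν := ν) (K := K)
    (g := fun x => f (s, x) - f (t, x) - (s - t) • ft (t, x)) (fun x hx => by
      by_contra h
      exact hx (by simp [hf0 _ x h, hft0 _ x h])) hpt
  calc _ ≤ (ν K ^ (2⁻¹ : ℝ) * ENNReal.ofReal (ε / (c + 1) * ‖s - t‖)).toReal :=
        ENNReal.toReal_mono (ENNReal.mul_ne_top hctop ENNReal.ofReal_ne_top) hbound
    _ = c * (ε / (c + 1) * ‖s - t‖) := by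
        rw [ENNReal.toReal_mul, ENNReal.toReal_ofReal (by positivity)]
    _ ≤ (c + 1) * (ε / (c + 1) * ‖s - t‖) := by gcongr; linarith
    _ = ε * ‖s - t‖ := by field_simp

theorem continuous_sliceLp {f : ℝ × X → ℂ} (hf : IsTest f) : Continuous (sliceLp ν hf) :=
  continuous_iff_continuousAt.2 fun t => (hasDerivAt_sliceLp hf t).continuousAt

theorem continuous_integral_test_smul {φ : X → ℝ} (hφ : IsTest φ) :
    Continuous fun g : Lp ℂ 2 ν => ∫ x, φ x • g x ∂ν := by
  have hm : MemLp (fun x => (φ x : ℂ)) 2 ν :=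
    (hφ.clm_comp Complex.ofRealCLM).memLp 2
  have : (fun g : Lp ℂ 2 ν => ∫ x, φ x • g x ∂ν) = fun g => inner ℂ hm.toLp g := by
    ext g
    rw [L2.inner_def]
    refine integral_congr_ae ?_
    filter_upwards [hm.coeFn_toLp] with x hx
    rw [hx]
    simp [mul_comm]
  rw [this]
  exact continuous_const.inner continuous_id

theorem integral_dirDeriv_smul_eq {φ : X → ℝ} (hφ : IsTest φ) {f : X → ℂ} (hf : IsTest f) (d : X) :
    ∫ x, dirDeriv d φ x • f x ∂ν = - ∫ x, φ x • dirDeriv d f x ∂ν := by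
  have h := integral_bilinear_hasLineDerivAt_right_eq_neg_left_of_integrable (μ := ν)
    (f := φ) (f' := dirDeriv d φ) (g := f) (g' := dirDeriv d f) (v := d)
    (B := ContinuousLinearMap.lsmul ℝ ℝ (E := ℂ))
    ((hφ.dirDeriv d).integrable_smul (hf.memLp 2))
    (hφ.integrable_smul ((hf.dirDeriv d).memLp 2)) (hφ.integrable_smul (hf.memLp 2))
    (fun x _ => (hφ.differentiable x).hasFDerivAt.hasLineDerivAt d)
    (fun x _ => (hf.differentiable x).hasFDerivAt.hasLineDerivAt d)
  simp only [ContinuousLinearMap.lsmul_apply] at h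
  rw [h, neg_neg]

/-- By Tonelli the slice errors tend to zero in mean over `t`, so by Fatou their lower limit
vanishes for almost every `t`. Along the indices where the error is small, the limit of the slices
is identified with the slice of `w`. -/
theorem ae_eq_slice_of_tendsto {w : ℝ × X → ℂ} (hw : MemLp w 2 ((volume : Measure ℝ).prod ν))
    {f : ℕ → ℝ × X → ℂ} (hf : ∀ n, IsTest (f n))
    (hfw : Tendsto (fun n => eLpNorm (fun z => f n z - w z) 2 ((volume : Measure ℝ).prod ν))
      atTop (𝓝 0)) {V : ℝ → Lp ℂ 2 ν}
    (hV : ∀ t, Tendsto (fun n => sliceLp ν (hf n) t) atTop (𝓝 (V t))) :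
    ∀ᵐ t : ℝ, V t =ᵐ[ν] fun x => w (t, x) := by
  set A : ℕ → ℝ → ℝ≥0∞ := fun n t => ∫⁻ x, ‖f n (t, x) - w (t, x)‖ₑ ^ 2 ∂ν with hA
  have hm : ∀ n, AEMeasurable (fun z => ‖f n z - w z‖ₑ ^ 2) ((volume : Measure ℝ).prod ν) :=
    fun n => (((hf n).continuous.aestronglyMeasurable.sub hw.1).enorm).pow_const 2
  have hint : ∀ n, ∫⁻ t, A n t
      = eLpNorm (fun z => f n z - w z) 2 ((volume : Measure ℝ).prod ν) ^ 2 := fun n => by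
    rw [eLpNorm_two_sq, lintegral_prod _ (hm n)]
  have hlim : Tendsto (fun n => ∫⁻ t, A n t) atTop (𝓝 0) := by
    simp only [hint]
    have := (ENNReal.continuous_pow 2).continuousAt.tendsto.comp hfw
    simpa [Function.comp_def] using this
  have hfatou : ∫⁻ t, liminf (fun n => A n t) atTop = 0 := by
    refine le_antisymm ?_ zero_le
    have := lintegral_liminf_le' (μ := (volume : Measure ℝ)) (u := atTop) fun n => (hm n).lintegral_prod_right'
    exact this.trans_eq hlim.liminf_eq
  have hmeas : AEMeasurable (fun t => liminf (fun n => A n t) atTop) volume := by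
    simp only [liminf_eq_iSup_iInf_of_nat']
    exact AEMeasurable.iSup fun n => AEMeasurable.iInf fun i => (hm _).lintegral_prod_right'
  rw [lintegral_eq_zero_iff' hmeas] at hfatou
  filter_upwards [hfatou, hw.1.prodMk_left] with t ht hwt
  have hsub : AEStronglyMeasurable (fun x => V t x - w (t, x)) ν :=
    (Lp.aestronglyMeasurable (V t)).sub hwt
  suffices h0 : eLpNorm (fun x => V t x - w (t, x)) 2 ν = 0 by
    rw [eLpNorm_eq_zero_iff hsub (by simp)] at h0
    filter_upwards [h0] with x hx using sub_eq_zero.1 hx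
  refine le_antisymm (ENNReal.le_of_forall_pos_le_add fun ε hε _ => ?_) zero_le
  have hε2 : (0 : ℝ≥0∞) < ε / 2 := by simpa using hε.ne'
  have h1 : ∃ᶠ n in atTop, A n t < (ε / 2 : ℝ≥0∞) ^ 2 := by
    refine frequently_lt_of_liminf_lt (by isBoundedDefault) ?_
    rw [ht]
    exact ENNReal.pow_pos hε2 2
  have h2 : ∀ᶠ n in atTop, edist (sliceLp ν (hf n) t) (V t) < ε / 2 :=
    (EMetric.tendsto_nhds.1 (hV t)) _ hε2
  obtain ⟨n, hn1, hn2⟩ := (h1.and_eventually h2).exists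
  have hc : sliceLp ν (hf n) t =ᵐ[ν] fun x => f n (t, x) := MemLp.coeFn_toLp _
  have e1 : eLpNorm (fun x => V t x - f n (t, x)) 2 ν < ε / 2 := by
    rw [edist_comm, Lp.edist_def] at hn2
    refine lt_of_eq_of_lt (eLpNorm_congr_ae ?_) hn2
    filter_upwards [hc] with x hx
    simp [hx]
  have e2 : eLpNorm (fun x => f n (t, x) - w (t, x)) 2 ν < ε / 2 := by
    rw [← ENNReal.pow_lt_pow_left_iff two_ne_zero, eLpNorm_two_sq]
    exact hn1
  have hsplit : (fun x => V t x - w (t, x))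
      = (fun x => V t x - f n (t, x)) + fun x => f n (t, x) - w (t, x) := by
    ext x; simp
  have hfm : AEStronglyMeasurable (fun x => f n (t, x)) ν :=
    ((hf n).slice t).continuous.aestronglyMeasurable
  rw [hsplit, zero_add]
  calc _ ≤ _ := eLpNorm_add_le ((Lp.aestronglyMeasurable (V t)).sub hfm) (hfm.sub hwt) one_le_two
    _ ≤ ε / 2 + ε / 2 := add_le_add e1.le e2.le
    _ = ε := ENNReal.add_halves _

/-- A compactly supported solution of the wave equation with weak derivatives and source in `L²`
is continuous in time with values in `H¹`, and continuously differentiable in time with values in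
`L²`. -/
theorem exists_continuous_curves {κ : Type*} [Fintype κ] (b : κ → X) {w : ℝ × X → ℂ}
    {D : Option κ → ℝ × X → ℂ} {H : ℝ × X → ℂ} {K : Set (ℝ × X)} (hK : IsCompact K)
    (hwK : Function.support w ⊆ K)
    (hw : MemLp w 2 ((volume : Measure ℝ).prod ν))
    (hD : ∀ a, MemLp (D a) 2 ((volume : Measure ℝ).prod ν))
    (hH : MemLp H 2 ((volume : Measure ℝ).prod ν))
    (hwD : ∀ a, IsGlobalWeakDeriv ((volume : Measure ℝ).prod ν) (waveDir b a) w (D a))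
    (hwH : IsGlobalWeakDiagOp ((volume : Measure ℝ).prod ν) (waveDir b) waveSign w H) :
    ∃ (V : ℝ → Lp ℂ 2 ν) (G : Option κ → ℝ → Lp ℂ 2 ν),
      (∀ t, HasDerivAt V (G none t) t) ∧ (∀ a, Continuous (G a)) ∧
      (∀ i t, ∀ φ : X → ℝ, IsTest φ →
        ∫ x, dirDeriv (b i) φ x • V t x ∂ν = - ∫ x, φ x • G (some i) t x ∂ν) ∧
      (∀ᵐ t : ℝ, V t =ᵐ[ν] fun x => w (t, x)) ∧
      ∀ a, ∀ᵐ t : ℝ, G a t =ᵐ[ν] fun x => D a (t, x) := by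
  set μ := (volume : Measure ℝ).prod ν
  have hloc : LocallyIntegrable w μ := hw.locallyIntegrable one_le_two
  set f : ℕ → ℝ × X → ℂ := fun n => smoothApprox μ n w with hfdef
  have hf : ∀ n, IsTest (f n) := fun n => isTest_mollify (isTest_normed _) hloc hK hwK
  have hfD : ∀ n a, dirDeriv (waveDir b a) (f n) = smoothApprox μ n (D a) := fun n a =>
    dirDeriv_mollify_eq (isTest_normed _) hloc (hwD a)
  have hfH : ∀ n, diagOp (waveDir b) waveSign (f n) = smoothApprox μ n H := fun n =>
    diagOp_mollify_eq (isTest_normed _) hloc hwH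
  have t0 := tendsto_eLpNorm_smoothApprox_sub hw
  have tD := fun a => tendsto_eLpNorm_smoothApprox_sub (hD a)
  have tH := tendsto_eLpNorm_smoothApprox_sub hH
  have tri : ∀ {g : ℝ × X → ℂ}, MemLp g 2 μ → ∀ n m,
      eLpNorm (fun z => smoothApprox μ n g z - smoothApprox μ m g z) 2 μ
      ≤ eLpNorm (fun z => smoothApprox μ n g z - g z) 2 μ
        + eLpNorm (fun z => smoothApprox μ m g z - g z) 2 μ := by
    intro g hg n m
    have hsm : ∀ n, AEStronglyMeasurable (fun z => smoothApprox μ n g z - g z) μ := fun n =>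
      (contDiff_mollify (isTest_normed _)
        (hg.locallyIntegrable one_le_two)).continuous.aestronglyMeasurable.sub hg.1
    have : (fun z => smoothApprox μ n g z - smoothApprox μ m g z)
        = (fun z => smoothApprox μ n g z - g z) - fun z => smoothApprox μ m g z - g z := by
      ext z; simp
    rw [this]
    exact eLpNorm_sub_le (hsm n) (hsm m) one_le_two
  have hsubD : ∀ n m a, dirDeriv (waveDir b a) (fun z => f n z - f m z)
      = fun z => smoothApprox μ n (D a) z - smoothApprox μ m (D a) z := by
    intro n m a
    rw [dirDeriv_sub (hf n).differentiable (hf m).differentiable, hfD, hfD]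
  have hsubH : ∀ n m, diagOp (waveDir b) waveSign (fun z => f n z - f m z)
      = fun z => smoothApprox μ n H z - smoothApprox μ m H z := by
    intro n m
    rw [← hfH, ← hfH]
    ext z
    simp only [diagOp]
    rw [← Finset.sum_sub_distrib]
    refine Finset.sum_congr rfl fun a _ => ?_
    rw [dirDeriv_sub (hf n).differentiable (hf m).differentiable,
      dirDeriv_sub ((hf n).dirDeriv _).differentiable ((hf m).dirDeriv _).differentiable, smul_sub]
  set a0 : ℕ → ℝ≥0∞ := fun n => eLpNorm (fun z => smoothApprox μ n w z - w z) 2 μ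
    + eLpNorm (fun z => smoothApprox μ n (D none) z - D none z) 2 μ
  set a1 : ℕ → ℝ≥0∞ := fun n => eLpNorm (fun z => smoothApprox μ n (D none) z - D none z) 2 μ
    + eLpNorm (fun z => smoothApprox μ n H z - H z) 2 μ
  have ha0 : Tendsto a0 atTop (𝓝 0) := by simpa using t0.add (tD none)
  have ha1 : Tendsto a1 atTop (𝓝 0) := by simpa using (tD none).add tH
  -- A difference of two regularizations is a test function whose derivatives and d'Alembertian are
  -- differences of regularizations of `D` and `H`. The slice estimates therefore make the slices
  -- Cauchy uniformly in time.
  obtain ⟨V, hV⟩ := exists_tendstoUniformly_of_edist_le (v := fun n => sliceLp ν (hf n)) ha0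
    fun n m t => by
      rw [edist_sliceLp]
      refine (eLpNorm_slice_le ((hf n).sub (hf m)) t).trans ?_
      have := hsubD n m none
      simp only [waveDir] at this
      rw [this]
      refine (add_le_add (tri hw n m) (tri (hD none) n m)).trans_eq ?_
      simp only [a0]; ring
  have hG : ∀ a, ∃ G : ℝ → Lp ℂ 2 ν, TendstoUniformly
      (fun n => sliceLp ν ((hf n).dirDeriv (waveDir b a))) G atTop := fun a =>
    exists_tendstoUniformly_of_edist_le ha1 fun n m t => by
      rw [edist_sliceLp]
      have h := eLpNorm_slice_dirDeriv_le (ν := ν) b ((hf n).sub (hf m)) t a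
      rw [dirDeriv_sub (hf n).differentiable (hf m).differentiable, hsubH] at h
      have h2 := hsubD n m none
      simp only [waveDir] at h2
      rw [h2] at h
      refine h.trans ((add_le_add (tri (hD none) n m) (tri hH n m)).trans_eq ?_)
      simp only [a1]; ring
  choose G hG using hG
  refine ⟨V, G, ?_, ?_, ?_, ?_, ?_⟩
  · exact fun t => hasDerivAt_of_tendstoUniformly (hG none)
      (Eventually.of_forall fun n s => hasDerivAt_sliceLp (hf n) s) (fun s => hV.tendsto_at s) t
  · exact fun a => (hG a).continuous
      (Eventually.of_forall fun n => continuous_sliceLp _).frequently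
  · intro i t φ hφ
    have l1 := (continuous_integral_test_smul (ν := ν) (hφ.dirDeriv (b i))).tendsto (V t) |>.comp
      (hV.tendsto_at t)
    have l2 := ((continuous_integral_test_smul (ν := ν) hφ).tendsto (G (some i) t) |>.comp
      ((hG (some i)).tendsto_at t)).neg
    refine tendsto_nhds_unique l1 (l2.congr fun n => ?_)
    have hc1 : sliceLp ν (hf n) t =ᵐ[ν] fun x => f n (t, x) := MemLp.coeFn_toLp _
    have hc2 : sliceLp ν ((hf n).dirDeriv (waveDir b (some i))) t
        =ᵐ[ν] fun x => dirDeriv (waveDir b (some i)) (f n) (t, x) := MemLp.coeFn_toLp _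
    have hp := integral_dirDeriv_smul_eq (ν := ν) hφ ((hf n).slice t) (b i)
    rw [dirDeriv_slice (hf n).differentiable] at hp
    have hq1 : ∫ x, dirDeriv (b i) φ x • sliceLp ν (hf n) t x ∂ν
        = ∫ x, dirDeriv (b i) φ x • f n (t, x) ∂ν :=
      integral_congr_ae (by filter_upwards [hc1] with x hx; rw [hx])
    have hq2 : ∫ x, φ x • sliceLp ν ((hf n).dirDeriv (waveDir b (some i))) t x ∂ν
        = ∫ x, φ x • dirDeriv (waveDir b (some i)) (f n) (t, x) ∂ν :=
      integral_congr_ae (by filter_upwards [hc2] with x hx; rw [hx])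
    exact (congrArg Neg.neg hq2).trans (hp.symm.trans hq1.symm)
  · exact ae_eq_slice_of_tendsto hw hf t0 fun t => hV.tendsto_at t
  · intro a
    refine ae_eq_slice_of_tendsto (hD a) (fun n => (hf n).dirDeriv (waveDir b a)) ?_
      fun t => (hG a).tendsto_at t
    simpa only [hfD] using tD a

end Curves

/-! ### Curves of local solutions -/

section LocalCurves

variable {X : Type*} [NormedAddCommGroup X] [NormedSpace ℝ X] [MeasurableSpace X] [BorelSpace X]
  [FiniteDimensional ℝ X] {ν : Measure X} [ν.IsAddHaarMeasure] {κ : Type*} [Fintype κ] {b : κ → X}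
  {T : ℝ} {O K₀ : Set X} {U : ℝ × X → ℂ} {D : Option κ → ℝ × X → ℂ} {F : ℝ × X → ℂ}

/-- A cutoff equal to `1` near `[-T', T'] × K₀` reduces to the compactly supported case. It changes
nothing at times `|t| < T'`, because `U` and `D` vanish off `K₀`. -/
theorem exists_curves_of_lt (hO : IsOpen O) (hK₀ : IsCompact K₀) (hKO : K₀ ⊆ O)
    (h : IsLocalSolution ((volume : Measure ℝ).prod ν) (Ioo (-T) T ×ˢ O) (waveDir b) waveSign U D F)
    (hZ : ∀ᵐ z ∂((volume : Measure ℝ).prod ν),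
      z ∉ Ioo (-T) T ×ˢ K₀ → U z = 0 ∧ ∀ a, D a z = 0) {T' : ℝ} (hT' : T' < T) :
    ∃ (V : ℝ → Lp ℂ 2 ν) (G : Option κ → ℝ → Lp ℂ 2 ν),
      (∀ t, HasDerivAt V (G none t) t) ∧ (∀ a, Continuous (G a)) ∧
      (∀ i t, ∀ φ : X → ℝ, IsTest φ →
        ∫ x, dirDeriv (b i) φ x • V t x ∂ν = - ∫ x, φ x • G (some i) t x ∂ν) ∧
      (∀ᵐ t : ℝ, |t| < T' → V t =ᵐ[ν] fun x => U (t, x)) ∧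
      ∀ a, ∀ᵐ t : ℝ, |t| < T' → G a t =ᵐ[ν] fun x => D a (t, x) := by
  have hL : IsCompact (Icc (-T') T' ×ˢ K₀) := isCompact_Icc.prod hK₀
  have hLΩ : Icc (-T') T' ×ˢ K₀ ⊆ Ioo (-T) T ×ˢ O :=
    prod_mono (Icc_subset_Ioo (by linarith) hT') hKO
  obtain ⟨χ, hχ, hχΩ, hχ1⟩ := exists_isTest_eq_one_nhds hL (isOpen_Ioo.prod hO) hLΩ
  have hs : Function.support (fun z => χ z • U z) ⊆ tsupport χ := fun z hz =>
    subset_tsupport _ fun h0 => hz (by simp [h0])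
  obtain ⟨V, G, h1, h2, h3, h4, h5⟩ := exists_continuous_curves b hχ.compact hs
    (hχ.memLp_smul h.memLp) (h.memLp_cutoffDeriv hχ) (h.memLp_cutoffRhs hχ)
    (h.isGlobalWeakDeriv_cutoff hχ hχΩ) (h.isGlobalWeakDiagOp_cutoff hχ hχΩ)
  have hZ' : ∀ᵐ t : ℝ, ∀ᵐ x ∂ν, |t| < T' →
      χ (t, x) • U (t, x) = U (t, x) ∧
        ∀ a, cutoffDeriv (waveDir b) χ U D a (t, x) = D a (t, x) := by
    refine Measure.ae_ae_of_ae_prod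
      (p := fun z : ℝ × X => |z.1| < T' → χ z • U z = U z ∧
        ∀ a, cutoffDeriv (waveDir b) χ U D a z = D a z) ?_
    filter_upwards [hZ] with z hz hzT
    by_cases hzZ : z ∈ Ioo (-T) T ×ˢ K₀
    · have hzL : z ∈ Icc (-T') T' ×ˢ K₀ := ⟨abs_le.1 hzT.le, hzZ.2⟩
      refine ⟨by simp [(hχ1 z hzL).self_of_nhds], ?_⟩
      exact (cutoff_eq_of_eventually_eq_one (e := waveDir b) (σ := waveSign) (U := U) (D := D)
        (F := F) (hχ1 z hzL)).1
    · obtain ⟨hU, hD⟩ := hz hzZ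
      simp [cutoffDeriv, hU, hD]
  refine ⟨V, G, h1, h2, h3, ?_, fun a => ?_⟩
  · filter_upwards [h4, hZ'] with t ht htZ htT
    filter_upwards [ht, htZ] with x hx hxZ
    rw [hx, (hxZ htT).1]
  · filter_upwards [h5 a, hZ'] with t ht htZ htT
    filter_upwards [ht, htZ] with x hx hxZ
    rw [hx, (hxZ htT).2 a]

theorem eq_of_ae_eq_of_continuous {V W : ℝ → Lp ℂ 2 ν} {f : ℝ × X → ℂ} (hV : Continuous V)
    (hW : Continuous W) {T₁ T₂ : ℝ} (h1 : ∀ᵐ t : ℝ, |t| < T₁ → V t =ᵐ[ν] fun x => f (t, x))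
    (h2 : ∀ᵐ t : ℝ, |t| < T₂ → W t =ᵐ[ν] fun x => f (t, x)) {t : ℝ} (ht1 : |t| < T₁)
    (ht2 : |t| < T₂) : V t = W t := by
  have hopen : IsOpen {t : ℝ | |t| < T₁ ∧ |t| < T₂} :=
    (isOpen_lt continuous_abs continuous_const).inter (isOpen_lt continuous_abs continuous_const)
  refine Measure.eqOn_open_of_ae_eq (μ := (volume : Measure ℝ)) (f := V) (g := W) ?_ hopen
    hV.continuousOn hW.continuousOn ⟨ht1, ht2⟩
  rw [EventuallyEq, ae_restrict_iff' hopen.measurableSet]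
  filter_upwards [h1, h2] with t h1 h2 ht
  exact Lp.ext ((h1 ht.1).trans (h2 ht.2).symm)

theorem exists_curves (hO : IsOpen O) (hK₀ : IsCompact K₀) (hKO : K₀ ⊆ O)
    (h : IsLocalSolution ((volume : Measure ℝ).prod ν) (Ioo (-T) T ×ˢ O) (waveDir b) waveSign U D F)
    (hZ : ∀ᵐ z ∂((volume : Measure ℝ).prod ν),
      z ∉ Ioo (-T) T ×ˢ K₀ → U z = 0 ∧ ∀ a, D a z = 0) :
    ∃ (V : ℝ → Lp ℂ 2 ν) (G : Option κ → ℝ → Lp ℂ 2 ν),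
      (∀ t, |t| < T → HasDerivAt V (G none t) t) ∧ (∀ a t, |t| < T → ContinuousAt (G a) t) ∧
      (∀ i t, |t| < T → ∀ φ : X → ℝ, IsTest φ →
        ∫ x, dirDeriv (b i) φ x • V t x ∂ν = - ∫ x, φ x • G (some i) t x ∂ν) ∧
      ∀ᵐ t : ℝ, |t| < T → V t =ᵐ[ν] fun x => U (t, x) := by
  have hex := fun T' (hT' : T' < T) => exists_curves_of_lt hO hK₀ hKO h hZ hT'
  choose! V G h1 h2 h3 h4 h5 using hex
  have hVc : ∀ T' < T, Continuous (V T') := fun T' hT' =>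
    continuous_iff_continuousAt.2 fun t => (h1 T' hT' t).continuousAt
  -- The curves for different `T'` agree where both represent `U`, so the value at `t` may be read
  -- from any admissible `T'`; the midpoint of `|t|` and `T` works for all times near `t` as well.
  set τ : ℝ → ℝ := fun t => (|t| + T) / 2 with hτ
  have hτ1 : ∀ {t}, |t| < T → |t| < τ t := fun ht => by simp only [hτ]; linarith
  have hτ2 : ∀ {t}, |t| < T → τ t < T := fun ht => by simp only [hτ]; linarith
  have eV : ∀ {t T'}, T' < T → |t| < T' → V (τ t) t = V T' t := fun hT' ht =>
    eq_of_ae_eq_of_continuous (hVc _ (hτ2 (ht.trans hT'))) (hVc _ hT')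
      (h4 _ (hτ2 (ht.trans hT'))) (h4 _ hT') (hτ1 (ht.trans hT')) ht
  have eG : ∀ {t T'} a, T' < T → |t| < T' → G (τ t) a t = G T' a t := fun a hT' ht =>
    eq_of_ae_eq_of_continuous (h2 _ (hτ2 (ht.trans hT')) a) (h2 _ hT' a)
      (h5 _ (hτ2 (ht.trans hT')) a) (h5 _ hT' a) (hτ1 (ht.trans hT')) ht
  have hnear : ∀ {t}, |t| < T → ∀ᶠ s in 𝓝 t, |s| < τ t := fun ht =>
    continuous_abs.continuousAt.eventually (eventually_lt_nhds (hτ1 ht))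
  refine ⟨fun t => V (τ t) t, fun a t => G (τ t) a t, fun t ht => ?_, fun a t ht => ?_,
    fun i t ht => h3 _ (hτ2 ht) i t, ?_⟩
  · refine (h1 _ (hτ2 ht) t).congr_of_eventuallyEq ?_
    filter_upwards [hnear ht] with s hs using eV (hτ2 ht) hs
  · refine ((h2 _ (hτ2 ht) a).continuousAt (x := t)).congr ?_
    filter_upwards [hnear ht] with s hs using (eG a (hτ2 ht) hs).symm
  -- Each `T'` has its own null set of times, so only the countable family `T - 1/(n+1)` is used.
  · have hall : ∀ᵐ t : ℝ, ∀ n : ℕ, |t| < T - 1 / ((n : ℝ) + 1) →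
        V (T - 1 / ((n : ℝ) + 1)) t =ᵐ[ν] fun x => U (t, x) :=
      ae_all_iff.2 fun n => h4 _ (sub_lt_self _ (by positivity))
    filter_upwards [hall] with t ht htT
    obtain ⟨n, hn⟩ := exists_nat_one_div_lt (sub_pos.2 htT)
    have hlt : |t| < T - 1 / ((n : ℝ) + 1) := by linarith
    rw [eV (sub_lt_self _ (by positivity)) hlt]
    exact ht n hlt

/-- If a curve vanishes almost everywhere on `A` at almost all small times, then so do its value
and its derivative at time `0`. -/
theorem ae_eq_zero_of_curve {V : ℝ → Lp ℂ 2 ν} {G₀ : Lp ℂ 2 ν} {A : Set X} {t₀ : ℝ} (ht₀ : 0 < t₀)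
    (hV : ∀ t, |t| < t₀ → ContinuousAt V t) (hG : HasDerivAt V G₀ 0)
    (h0 : ∀ᵐ t : ℝ, |t| < t₀ → V t =ᵐ[ν.restrict A] 0) :
    V 0 =ᵐ[ν.restrict A] 0 ∧ G₀ =ᵐ[ν.restrict A] 0 := by
  -- Restriction to `A` is continuous and linear, hence commutes with the time derivative; the
  -- restricted curve vanishes identically near `0`.
  set P := LpToLpRestrictCLM X ℂ ℝ ν 2 A
  have hP : ∀ g : Lp ℂ 2 ν, P g =ᵐ[ν.restrict A] g := fun g => LpToLpRestrictCLM_coeFn ℝ A g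
  have hP0 : ∀ g : Lp ℂ 2 ν, P g = 0 ↔ g =ᵐ[ν.restrict A] 0 := by
    intro g
    rw [Lp.ext_iff]
    constructor
    · intro hg
      exact (hP g).symm.trans (hg.trans (Lp.coeFn_zero _ _ _))
    · intro hg
      exact (hP g).trans (hg.trans (Lp.coeFn_zero _ _ _).symm)
  have hopen : IsOpen {t : ℝ | |t| < t₀} := isOpen_lt continuous_abs continuous_const
  have heq : EqOn (fun t => P (V t)) (fun _ => 0) {t : ℝ | |t| < t₀} := by
    refine Measure.eqOn_open_of_ae_eq (μ := (volume : Measure ℝ)) ?_ hopen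
      (fun t ht => (P.continuous.continuousAt.comp (hV t ht)).continuousWithinAt)
      continuousOn_const
    rw [EventuallyEq, ae_restrict_iff' hopen.measurableSet]
    filter_upwards [h0] with t ht htt
    exact (hP0 _).2 (ht htt)
  have hz : (0 : ℝ) ∈ {t : ℝ | |t| < t₀} := by simpa using ht₀
  refine ⟨(hP0 _).1 (heq hz), (hP0 _).1 ?_⟩
  have hd : HasDerivAt (fun t => P (V t)) (P G₀) 0 := P.hasFDerivAt.comp_hasDerivAt 0 hG
  have hd0 : HasDerivAt (fun t => P (V t)) 0 0 :=
    (hasDerivAt_const (0 : ℝ) (0 : Lp ℂ 2 (ν.restrict A))).congr_of_eventuallyEq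
      (by filter_upwards [hopen.mem_nhds hz] with t ht using heq ht)
  exact hd.unique hd0

end LocalCurves

/-! ### Solutions of the wave equation as local solutions -/

section WaveSolution

theorem isTest_testFunction {E : Type*} [NormedAddCommGroup E] [NormedSpace ℝ E] {Ω : Opens E}
    (φ : 𝓓(Ω, ℝ)) : IsTest φ :=
  ⟨φ.contDiff, φ.hasCompactSupport⟩

theorem coe_lineDerivOp_testFunction {E : Type*} [NormedAddCommGroup E] [NormedSpace ℝ E]
    {Ω : Opens E} (φ : 𝓓(Ω, ℝ)) (v : E) : ⇑(∂_{v} φ : 𝓓(Ω, ℝ)) = dirDeriv v φ := by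
  ext z
  rw [TestFunction.lineDerivOp_eq_lineDerivCLM ℝ, TestFunction.lineDerivCLM_apply_of_le (by simp),
    ((isTest_testFunction φ).differentiable z).lineDeriv_eq_fderiv]
  rfl

/-- The coordinate directions of space. -/
def coordDir {d : ℕ} (i : Fin d) : Space d := EuclideanSpace.single i 1

theorem coe_waveOp {d : ℕ} {Ω : Opens (SpaceTime d)} (φ : 𝓓(Ω, ℝ)) :
    ⇑(waveOp φ) = diagOp (waveDir coordDir) waveSign φ := by
  rw [diagOp_wave]
  ext z
  have hsum : ∀ s : Finset (Fin d), (∑ i ∈ s, ∂_{spaceDir i} (∂_{spaceDir i} φ) : 𝓓(Ω, ℝ)) z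
      = ∑ i ∈ s, (∂_{spaceDir i} (∂_{spaceDir i} φ) : 𝓓(Ω, ℝ)) z := by
    intro s
    induction s using Finset.cons_induction with
    | empty => simp
    | cons a s ha ih => rw [Finset.sum_cons, Finset.sum_cons, ← ih]; rfl
  have hsub : waveOp φ z = (∂_{timeDir d} (∂_{timeDir d} φ) : 𝓓(Ω, ℝ)) z
      - (∑ i : Fin d, ∂_{spaceDir i} (∂_{spaceDir i} φ) : 𝓓(Ω, ℝ)) z := rfl
  rw [hsub, hsum]
  simp only [coe_lineDerivOp_testFunction]
  rfl

theorem smul_indicator_of_tsupport_subset {E : Type*} [TopologicalSpace E] {φ : E → ℝ} {Ω : Set E}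
    (h : tsupport φ ⊆ Ω) (f : E → ℂ) (z : E) : φ z • Ω.indicator f z = φ z • f z := by
  by_cases hz : z ∈ Ω
  · rw [indicator_of_mem hz]
  · rw [image_eq_zero_of_notMem_tsupport fun h' => hz (h h'), zero_smul, zero_smul]

/-- The lower order terms of the wave equation. -/
def lowerOrder {d : ℕ} (q₀ q₁ : SpaceTime d → ℂ) (q₂ : SpaceTime d → EuclideanSpace ℂ (Fin d))
    (u ut : SpaceTime d → ℂ) (ux : Fin d → SpaceTime d → ℂ) (z : SpaceTime d) : ℂ :=
  q₀ z * u z + q₁ z * ut z + ∑ i, q₂ z i * ux i z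

/-- The time derivative and the space derivatives, as one family. -/
def gradFamily {d : ℕ} (ut : SpaceTime d → ℂ) (ux : Fin d → SpaceTime d → ℂ) :
    Option (Fin d) → SpaceTime d → ℂ
  | none => ut
  | some i => ux i

theorem exists_ae_norm_le {α G : Type*} [MeasurableSpace α] {μ : Measure α} [NormedAddCommGroup G]
    {f : α → G} (hf : MemLp f ∞ μ) : ∃ B : NNReal, ∀ᵐ z ∂μ, ‖f z‖₊ ≤ B := by
  have h := hf.eLpNorm_lt_top
  rw [eLpNorm_exponent_top] at h
  refine ⟨(eLpNormEssSup f μ).toNNReal, ?_⟩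
  filter_upwards [ae_le_eLpNormEssSup (f := f) (μ := μ)] with z hz
  rw [← ENNReal.coe_le_coe, ENNReal.coe_toNNReal h.ne]
  exact hz

variable {d : ℕ} {Ω : Opens (SpaceTime d)} {q₀ q₁ : SpaceTime d → ℂ}
  {q₂ : SpaceTime d → EuclideanSpace ℂ (Fin d)} {u ut : SpaceTime d → ℂ}
  {ux : Fin d → SpaceTime d → ℂ}

theorem memLp_lowerOrder {μ : Measure (SpaceTime d)} (hq₀ : MemLp q₀ ∞ μ) (hq₁ : MemLp q₁ ∞ μ)
    (hq₂ : MemLp q₂ ∞ μ) (hu : MemLp u 2 μ) (hut : MemLp ut 2 μ) (hux : ∀ i, MemLp (ux i) 2 μ) :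
    MemLp (lowerOrder q₀ q₁ q₂ u ut ux) 2 μ := by
  have h2 : ∀ i, MemLp (fun z => q₂ z i) ∞ μ := fun i =>
    hq₂.of_le ((EuclideanSpace.proj (𝕜 := ℂ) i).continuous.comp_aestronglyMeasurable hq₂.1)
      (Eventually.of_forall fun z => PiLp.norm_apply_le (q₂ z) i)
  exact ((hu.mul hq₀).add (hut.mul hq₁)).add
    (memLp_finsetSum _ fun i _ => (hux i).mul (h2 i))

theorem exists_nnnorm_lowerOrder_sq_le {μ : Measure (SpaceTime d)} (hq₀ : MemLp q₀ ∞ μ)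
    (hq₁ : MemLp q₁ ∞ μ) (hq₂ : MemLp q₂ ∞ μ) (u ut : SpaceTime d → ℂ)
    (ux : Fin d → SpaceTime d → ℂ) :
    ∃ C : NNReal, ∀ᵐ z ∂μ, ‖lowerOrder q₀ q₁ q₂ u ut ux z‖₊ ^ 2
      ≤ C * ((∑ a, ‖gradFamily ut ux a z‖₊ ^ 2) + ‖u z‖₊ ^ 2) := by
  obtain ⟨B₀, h₀⟩ := exists_ae_norm_le hq₀
  obtain ⟨B₁, h₁⟩ := exists_ae_norm_le hq₁
  obtain ⟨B₂, h₂⟩ := exists_ae_norm_le hq₂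
  set B := B₀ + B₁ + B₂
  -- The factor `2` separates `u` from its derivatives, and `d + 1` is the number of derivatives in
  -- Cauchy-Schwarz.
  refine ⟨B ^ 2 * (2 * (d + 1)), ?_⟩
  filter_upwards [h₀, h₁, h₂] with z h₀ h₁ h₂
  have hB₀ : B₀ ≤ B := by simp only [B, add_assoc]; exact le_self_add
  have hB₁ : B₁ ≤ B := by
    simp only [B, add_assoc, add_comm B₁, add_left_comm B₀]; exact le_add_self.trans (by rw [add_assoc])
  have hB₂ : B₂ ≤ B := le_add_self
  set S := ∑ a, ‖gradFamily ut ux a z‖₊ with hS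
  have hSe : S = ‖ut z‖₊ + ∑ i, ‖ux i z‖₊ := Fintype.sum_option _
  have hle : ‖lowerOrder q₀ q₁ q₂ u ut ux z‖₊ ≤ B * (‖u z‖₊ + S) := by
    calc ‖lowerOrder q₀ q₁ q₂ u ut ux z‖₊
        ≤ ‖q₀ z * u z‖₊ + ‖q₁ z * ut z‖₊ + ∑ i, ‖q₂ z i * ux i z‖₊ :=
          (nnnorm_add_le _ _).trans (add_le_add (nnnorm_add_le _ _) (nnnorm_sum_le _ _))
      _ ≤ B * ‖u z‖₊ + B * ‖ut z‖₊ + ∑ i, B * ‖ux i z‖₊ := by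
          simp only [nnnorm_mul]
          gcongr with i
          · exact h₀.trans hB₀
          · exact h₁.trans hB₁
          · exact (PiLp.nnnorm_apply_le (q₂ z) i).trans (h₂.trans hB₂)
      _ = B * (‖u z‖₊ + S) := by rw [hSe, ← Finset.mul_sum]; ring
  have hSsq : S ^ 2 ≤ (d + 1) * ∑ a, ‖gradFamily ut ux a z‖₊ ^ 2 := by
    have := sq_sum_le_card_mul_sum_sq (s := (Finset.univ : Finset (Option (Fin d))))
      (f := fun a => ‖gradFamily ut ux a z‖₊)
    simpa [hS] using this
  set Q := ∑ a, ‖gradFamily ut ux a z‖₊ ^ 2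
  calc ‖lowerOrder q₀ q₁ q₂ u ut ux z‖₊ ^ 2 ≤ (B * (‖u z‖₊ + S)) ^ 2 := by gcongr
    _ = B ^ 2 * (‖u z‖₊ + S) ^ 2 := mul_pow _ _ _
    _ ≤ B ^ 2 * (2 * (‖u z‖₊ ^ 2 + S ^ 2)) := by gcongr; exact add_sq_le
    _ ≤ B ^ 2 * (2 * ((d + 1) * ‖u z‖₊ ^ 2 + (d + 1) * Q)) := by
        gcongr
        exact le_mul_of_one_le_left zero_le le_add_self
    _ = _ := by ring

/-- Extension by zero makes all functions globally `L²`. No equation is claimed across the boundary: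
test functions supported in `Ω` do not see the extension. -/
theorem isLocalSolution_of_isH1 (h : IsH1 Ω u ut ux)
    (hq₀ : MemLp q₀ ∞ (volume.restrict (Ω : Set (SpaceTime d))))
    (hq₁ : MemLp q₁ ∞ (volume.restrict (Ω : Set (SpaceTime d))))
    (hq₂ : MemLp q₂ ∞ (volume.restrict (Ω : Set (SpaceTime d))))
    (heq : ∀ φ : 𝓓(Ω, ℝ), ∫ z, (waveOp φ z • u z + φ z • lowerOrder q₀ q₁ q₂ u ut ux z) = 0) :
    IsLocalSolution ((volume : Measure ℝ).prod (volume : Measure (Space d))) (Ω : Set (SpaceTime d))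
      (waveDir coordDir) waveSign ((Ω : Set (SpaceTime d)).indicator u)
      (fun a => (Ω : Set (SpaceTime d)).indicator (gradFamily ut ux a))
      (fun z => -(Ω : Set (SpaceTime d)).indicator (lowerOrder q₀ q₁ q₂ u ut ux) z) := by
  have hΩ := Ω.isOpen.measurableSet
  have hU : MemLp ((Ω : Set (SpaceTime d)).indicator u) 2
      ((volume : Measure ℝ).prod (volume : Measure (Space d))) :=
    (memLp_indicator_iff_restrict hΩ).2 h.memLp
  have hF : MemLp ((Ω : Set (SpaceTime d)).indicator (lowerOrder q₀ q₁ q₂ u ut ux)) 2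
      ((volume : Measure ℝ).prod (volume : Measure (Space d))) :=
    (memLp_indicator_iff_restrict hΩ).2
      (memLp_lowerOrder hq₀ hq₁ hq₂ h.memLp h.memLp_time h.memLp_space)
  refine ⟨hU, fun a => (memLp_indicator_iff_restrict hΩ).2 ?_, hF.neg, ?_, ?_⟩
  · cases a with
    | none => exact h.memLp_time
    | some i => exact h.memLp_space i
  · intro a φ hφ hsub
    let ψ : 𝓓(Ω, ℝ) := ⟨φ, hφ.smooth, hφ.compact, hsub⟩
    have hw : IsWeakDeriv Ω (waveDir coordDir a) u (gradFamily ut ux a) := by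
      cases a with
      | none => exact h.deriv_time
      | some i => exact h.deriv_space i
    have := hw.2.2 ψ
    rw [coe_lineDerivOp_testFunction] at this
    simp only [smul_indicator_of_tsupport_subset hsub,
      smul_indicator_of_tsupport_subset ((tsupport_dirDeriv_subset (waveDir coordDir a) φ).trans
        hsub)]
    exact this
  · intro φ hφ hsub
    let ψ : 𝓓(Ω, ℝ) := ⟨φ, hφ.smooth, hφ.compact, hsub⟩
    have hψ := heq ψ
    have hP : diagOp (waveDir coordDir) waveSign φ = waveOp ψ := (coe_waveOp ψ).symm
    rw [hP]
    have hPs : tsupport (waveOp ψ) ⊆ Ω := (waveOp ψ).tsupport_subset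
    have e : ∀ z, waveOp ψ z • u z + ψ z • lowerOrder q₀ q₁ q₂ u ut ux z
        = waveOp ψ z • (Ω : Set (SpaceTime d)).indicator u z
          + φ z • (Ω : Set (SpaceTime d)).indicator (lowerOrder q₀ q₁ q₂ u ut ux) z := fun z => by
      rw [smul_indicator_of_tsupport_subset hPs, smul_indicator_of_tsupport_subset hsub]; rfl
    simp only [e] at hψ
    have hadd := integral_add ((isTest_testFunction (waveOp ψ)).integrable_smul hU)
      (hφ.integrable_smul hF)
    simp only [smul_neg, integral_neg]
    exact eq_neg_of_add_eq_zero_left (hadd.symm.trans hψ)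

/-- A weak derivative vanishes where the function does. -/
theorem ae_eq_zero_deriv_of_ae_eq_zero {E ι : Type*} [NormedAddCommGroup E] [NormedSpace ℝ E]
    [Fintype ι] [MeasurableSpace E] [BorelSpace E] [FiniteDimensional ℝ E] {μ : Measure E}
    [IsLocallyFiniteMeasure μ] {Ω N : Set E}
    {e : ι → E} {σ : ι → ℝ} {U : E → ℂ} {D : ι → E → ℂ} {F : E → ℂ}
    (h : IsLocalSolution μ Ω e σ U D F) (hN : IsOpen N) (hNΩ : N ⊆ Ω)
    (hU : ∀ᵐ z ∂μ, z ∈ N → U z = 0) (a : ι) : ∀ᵐ z ∂μ, z ∈ N → D a z = 0 := by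
  refine hN.ae_eq_zero_of_integral_contDiff_smul_eq_zero
    (((h.memLp_deriv a).locallyIntegrable one_le_two).locallyIntegrableOn _) fun φ h1 h2 h3 => ?_
  have := h.deriv a φ ⟨h1, h2⟩ (h3.trans hNΩ)
  rw [← neg_eq_zero, ← this]
  refine integral_eq_zero_of_ae ?_
  filter_upwards [hU] with z hz
  by_cases hzN : z ∈ N
  · simp [hz hzN]
  · have : dirDeriv (e a) φ z = 0 :=
      image_eq_zero_of_notMem_tsupport fun h' => hzN (h3 (tsupport_dirDeriv_subset _ _ h'))
    simp [this]

end WaveSolution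

/-! ### Unique continuation across hyperboloids -/

section Hyperboloid

variable {d : ℕ}

/-- The coordinates of space-time centred at `(0, x₁)`. -/
def waveCoord (x₁ : Space d) : Option (Fin d) → SpaceTime d → ℝ
  | none => fun z => z.1
  | some i => fun z => z.2 i - x₁ i

/-- The coefficients of the weight `|x - x₁|² - β t²`. -/
def hyperbolicCoeff (β : ℝ) : Option (Fin d) → ℝ
  | none => -β
  | some _ => 1

theorem isCoordSystem_waveCoord (x₁ : Space d) :
    IsCoordSystem (waveDir coordDir) (waveCoord x₁) where
  smooth a := by
    cases a with
    | none => exact contDiff_fst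
    | some i =>
      exact (((EuclideanSpace.proj (𝕜 := ℝ) i).contDiff).comp contDiff_snd).sub contDiff_const
  deriv a b := by
    cases a with
    | none =>
      ext z
      have h : HasFDerivAt (waveCoord x₁ none) (ContinuousLinearMap.fst ℝ ℝ (Space d)) z :=
        hasFDerivAt_fst
      rw [dirDeriv, h.fderiv]
      cases b <;> simp [waveDir]
    | some i =>
      ext z
      have h : HasFDerivAt (waveCoord x₁ (some i)) ((EuclideanSpace.proj (𝕜 := ℝ) i).comp
          (ContinuousLinearMap.snd ℝ ℝ (Space d))) z :=
        (((EuclideanSpace.proj (𝕜 := ℝ) i).comp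
          (ContinuousLinearMap.snd ℝ ℝ (Space d))).hasFDerivAt).sub_const _
      rw [dirDeriv, h.fderiv]
      cases b with
      | none => simp [waveDir]
      | some j => simp [waveDir, coordDir]

theorem sum_waveCoord_sq (x₁ : Space d) (z : SpaceTime d) :
    ∑ i, waveCoord x₁ (some i) z ^ 2 = ‖z.2 - x₁‖ ^ 2 := by
  rw [EuclideanSpace.norm_sq_eq]
  simp [waveCoord]

theorem quadWeight_waveCoord (x₁ : Space d) (β : ℝ) (z : SpaceTime d) :
    quadWeight (waveCoord x₁) (hyperbolicCoeff β) z = ‖z.2 - x₁‖ ^ 2 - β * z.1 ^ 2 := by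
  rw [quadWeight, Fintype.sum_option]
  simp only [hyperbolicCoeff, one_mul, sum_waveCoord_sq]
  simp only [waveCoord]; ring

/-- Where `x ∈ K₀` and the weight is at least `ε/2`, one has `β t² ≤ R² - ε/2 < β T²`. Such points
form a compact subset of the open cylinder, as unique continuation requires. -/
theorem ae_eq_zero_of_hyperboloid {x₁ : Space d} {T R β : ℝ} {O K₀ : Set (Space d)}
    (hβ : 0 < β) (hβ1 : β < 1) (hT : 0 < T) (hRT : R ^ 2 < β * T ^ 2) (hO : IsOpen O)
    (hK₀ : IsCompact K₀) (hKO : K₀ ⊆ O) (hKR : ∀ x ∈ K₀, ‖x - x₁‖ ≤ R)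
    {U : SpaceTime d → ℂ} {D : Option (Fin d) → SpaceTime d → ℂ} {F : SpaceTime d → ℂ}
    (h : IsLocalSolution ((volume : Measure ℝ).prod (volume : Measure (Space d)))
      (Ioo (-T) T ×ˢ O) (waveDir coordDir) waveSign U D F) {C : NNReal}
    (hF : ∀ᵐ z, ‖F z‖ₑ ^ 2 ≤ C * ((∑ a, ‖D a z‖ₑ ^ 2) + ‖U z‖ₑ ^ 2))
    (hZ : ∀ᵐ z, z ∉ Ioo (-T) T ×ˢ K₀ → U z = 0 ∧ ∀ a, D a z = 0) {ε : ℝ} (hε : 0 < ε) :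
    ∀ᵐ z : SpaceTime d, ε < ‖z.2 - x₁‖ ^ 2 - β * z.1 ^ 2 → U z = 0 := by
  have hψ : ∀ z, quadWeight (waveCoord x₁) (hyperbolicCoeff β) z
    = ‖z.2 - x₁‖ ^ 2 - β * z.1 ^ 2 := quadWeight_waveCoord x₁ β
  have c1 : Continuous fun z : SpaceTime d => ‖z.2 - x₁‖ ^ 2 := by fun_prop
  have c2 : Continuous fun z : SpaceTime d => z.1 ^ 2 := by fun_prop
  have c3 : Continuous fun z : SpaceTime d => ‖z.2 - x₁‖ ^ 2 - β * z.1 ^ 2 := by fun_prop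
  -- The Carleman region is open and bounded. Its level `ε/4` lies below the level `ε/2` of `L`,
  -- leaving room for the cutoff.
  set S : Set (SpaceTime d) := {z | ε / 4 < ‖z.2 - x₁‖ ^ 2 - β * z.1 ^ 2} ∩
    ({z | z.1 ^ 2 < T ^ 2} ∩ {z | ‖z.2 - x₁‖ ^ 2 < R ^ 2 + 1})
  have hSo : IsOpen S := (isOpen_lt continuous_const c3).inter
    ((isOpen_lt c2 continuous_const).inter (isOpen_lt c1 continuous_const))
  set L : Set (SpaceTime d) := (Icc (-T) T ×ˢ K₀) ∩ {z | ε / 2 ≤ ‖z.2 - x₁‖ ^ 2 - β * z.1 ^ 2}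
  have hL : IsCompact L := (isCompact_Icc.prod hK₀).inter_right (isClosed_le continuous_const c3)
  have hcoord : ∀ z i, waveCoord x₁ (some i) z ^ 2 ≤ ‖z.2 - x₁‖ ^ 2 := fun z i => by
    rw [← sum_waveCoord_sq]
    exact Finset.single_le_sum (f := fun i => waveCoord x₁ (some i) z ^ 2)
      (fun j _ => sq_nonneg _) (Finset.mem_univ i)
  -- The gradient coefficients are `γ - β` in time and `1 - γ` in space; the midpoint `γ = (1 + β) /
  -- 2` makes both equal to `(1 - β) / 2`.
  have key := ae_eq_zero_of_lt_quadWeight (isCoordSystem_waveCoord x₁) waveSign (hyperbolicCoeff β)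
    (γ := (1 + β) / 2) (δ := (1 - β) / 2) (κ := ε) (R := T ^ 2 + (R ^ 2 + 1)) (by linarith) hε hSo
    ?_ ?_ ?_ (isOpen_Ioo.prod hO) h hF hZ (c := ε / 2) (c' := ε) (by linarith) hL ?_ ?_
  · filter_upwards [key] with z hz hzε
    exact hz (by rwa [hψ])
  · rintro z ⟨-, h2, h3⟩ (_ | i)
    · exact (le_of_lt h2).trans (le_add_of_nonneg_right (by positivity))
    · exact (hcoord z i).trans ((le_of_lt h3).trans (le_add_of_nonneg_left (sq_nonneg T)))
  · rintro (_ | i) <;> simp only [waveSign, hyperbolicCoeff] <;> linarith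
  · rintro z ⟨h1, -, -⟩
    rw [Fintype.sum_option]
    have : ∑ i, 4 * waveSign (some i) * hyperbolicCoeff β (some i) ^ 2
        * (waveSign (some i) * hyperbolicCoeff β (some i) - (1 + β) / 2)
          * waveCoord x₁ (some i) z ^ 2 = 4 * (1 + (1 + β) / 2) * ‖z.2 - x₁‖ ^ 2 := by
      rw [← sum_waveCoord_sq, Finset.mul_sum]
      refine Finset.sum_congr rfl fun i _ => ?_
      simp only [waveSign, hyperbolicCoeff]; ring
    rw [this]
    simp only [waveSign, hyperbolicCoeff, waveCoord]
    change ε / 4 < _ at h1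
    have ht := sq_nonneg z.1
    have hβt : 0 ≤ β * z.1 ^ 2 := by positivity
    -- The zeroth order coefficient is `4 ((1 + γ) |x - x₁|² - β² (β + γ) t²)`. Inserting `|x - x₁|²
    -- > β t² + ε/4`, the `t²` part is nonnegative by this inequality and at least `(1 + γ) ε ≥ ε`
    -- remains.
    have hβ2 : β * (β + (1 + β) / 2) ≤ 1 + (1 + β) / 2 := by nlinarith
    have h5 : β * z.1 ^ 2 * (β * (β + (1 + β) / 2)) ≤ β * z.1 ^ 2 * (1 + (1 + β) / 2) :=
      mul_le_mul_of_nonneg_left hβ2 hβt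
    have h6 : (1 + (1 + β) / 2) * (ε / 4 + β * z.1 ^ 2) ≤ (1 + (1 + β) / 2) * ‖z.2 - x₁‖ ^ 2 :=
      mul_le_mul_of_nonneg_left (by linarith) (by linarith)
    have h7 : ε * β > 0 := mul_pos hε hβ
    linarith
  · rintro z ⟨⟨-, hz2⟩, hz⟩
    change ε / 2 ≤ _ at hz
    have hr : ‖z.2 - x₁‖ ^ 2 ≤ R ^ 2 := by gcongr; exact hKR _ hz2
    have ht : z.1 ^ 2 < T ^ 2 := by
      refine lt_of_mul_lt_mul_left ?_ hβ.le
      linarith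
    refine ⟨⟨abs_lt.1 ((sq_lt_sq₀ (abs_nonneg _) hT.le).1 (by rwa [sq_abs])), hKO hz2⟩, ?_, ht, ?_⟩
    · change ε / 4 < _; linarith
    · exact lt_of_le_of_lt hr (lt_add_one _)
  · rintro z ⟨hz1, hz2⟩ hz
    rw [hψ] at hz
    exact ⟨⟨Ioo_subset_Icc_self hz1, hz2⟩, hz⟩

/-- A curve vanishing outside of the hyperboloids `|x - x₁|² = β t² + ε` vanishes at time `0`,
with its derivative. -/
theorem ae_eq_zero_of_curve_of_hyperboloid (hd : 1 ≤ d) {x₁ : Space d} {T β : ℝ} (hβ : 0 < β)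
    (hT : 0 < T) {U : SpaceTime d → ℂ} {V : ℝ → Lp ℂ 2 (volume : Measure (Space d))}
    {G₀ : Lp ℂ 2 (volume : Measure (Space d))} (hV : ∀ t, |t| < T → ContinuousAt V t)
    (hG : HasDerivAt V G₀ 0) (hVU : ∀ᵐ t : ℝ, |t| < T → V t =ᵐ[volume] fun x => U (t, x))
    (hU : ∀ ε : ℝ, 0 < ε → ∀ᵐ z : SpaceTime d, ε < ‖z.2 - x₁‖ ^ 2 - β * z.1 ^ 2 → U z = 0) :
    V 0 =ᵐ[volume] 0 ∧ G₀ =ᵐ[volume] 0 := by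
  have hA : ∀ n : ℕ, V 0 =ᵐ[volume.restrict {x | 2 * (1 / ((n : ℝ) + 1)) < ‖x - x₁‖ ^ 2}] 0 ∧
      G₀ =ᵐ[volume.restrict {x | 2 * (1 / ((n : ℝ) + 1)) < ‖x - x₁‖ ^ 2}] 0 := by
    intro n
    set ε : ℝ := 1 / ((n : ℝ) + 1)
    have hε : 0 < ε := Nat.one_div_pos_of_nat
    have hAm : MeasurableSet {x : Space d | 2 * ε < ‖x - x₁‖ ^ 2} :=
      (isOpen_lt continuous_const (by fun_prop)).measurableSet
    -- For `|t| < t₀` one has `β t² ≤ ε`, so every `x` with `|x - x₁|² > 2ε` lies in the region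
    -- where `U` vanishes.
    set t₀ : ℝ := min T (Real.sqrt (ε / β))
    have ht₀ : 0 < t₀ := lt_min hT (Real.sqrt_pos.2 (by positivity))
    refine ae_eq_zero_of_curve ht₀ (fun t ht => hV t (ht.trans_le (min_le_left _ _))) hG ?_
    have h1 : ∀ᵐ t : ℝ, ∀ᵐ x : Space d, ε < ‖x - x₁‖ ^ 2 - β * t ^ 2 → U (t, x) = 0 :=
      Measure.ae_ae_of_ae_prod (hU ε hε)
    filter_upwards [h1, hVU] with t ht htV htt
    have hle : β * t ^ 2 ≤ ε := by
      have h2 : |t| ^ 2 ≤ Real.sqrt (ε / β) ^ 2 := by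
        gcongr
        exact (htt.trans_le (min_le_right _ _)).le
      rw [sq_abs, Real.sq_sqrt (by positivity), le_div_iff₀ hβ] at h2
      linarith
    rw [EventuallyEq, ae_restrict_iff' hAm]
    filter_upwards [ht, htV (htt.trans_le (min_le_left _ _))] with x hx hxV hxA
    rw [hxV]
    exact hx (by change 2 * ε < _ at hxA; linarith)
  -- For `d ≥ 1` the point `x₁`, the only one not reached as `ε → 0`, is null.
  have : Nonempty (Fin d) := ⟨⟨0, hd⟩⟩
  have hx₁ : ∀ᵐ x : Space d, x ≠ x₁ := by
    rw [ae_iff]; simp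
  have hfin : ∀ g : Space d → ℂ,
      (∀ n : ℕ, g =ᵐ[volume.restrict {x | 2 * (1 / ((n : ℝ) + 1)) < ‖x - x₁‖ ^ 2}] 0) →
      g =ᵐ[volume] 0 := by
    intro g hg
    have hg' : ∀ᵐ x : Space d, ∀ n : ℕ, 2 * (1 / ((n : ℝ) + 1)) < ‖x - x₁‖ ^ 2 → g x = 0 := by
      refine ae_all_iff.2 fun n => ?_
      exact (ae_restrict_iff' (isOpen_lt continuous_const (by fun_prop)).measurableSet).1 (hg n)
    filter_upwards [hg', hx₁] with x hx hne
    have hpos : 0 < ‖x - x₁‖ ^ 2 / 2 := by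
      have := norm_pos_iff.2 (sub_ne_zero.2 hne)
      positivity
    obtain ⟨n, hn⟩ := exists_nat_one_div_lt hpos
    exact hx n (by linarith)
  exact ⟨hfin _ fun n => (hA n).1, hfin _ fun n => (hA n).2⟩

end Hyperboloid

/-! ### Cauchy data of curves -/

section CauchyData

variable {d : ℕ}

theorem eLpNorm_restrict_le_edist {X : Type*} [MeasurableSpace X] {ν : Measure X} (f g : Lp ℂ 2 ν)
    {h : X → ℂ} (hh : h =ᵐ[ν] fun x => f x - g x) (K : Set X) :
    eLpNorm h 2 (ν.restrict K) ≤ edist f g := by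
  rw [Lp.edist_def]
  exact (eLpNorm_mono_measure _ Measure.restrict_le_self).trans (eLpNorm_congr_ae hh).le

theorem continuousOnL2loc_of_continuousAt {W : Opens (Space d)} {I : Set ℝ}
    {V : ℝ → Lp ℂ 2 (volume : Measure (Space d))} (hV : ∀ t ∈ I, ContinuousAt V t) :
    ContinuousOnL2loc I W (fun t => V t) := by
  intro t ht K _ _
  refine ⟨(Lp.memLp (V t)).restrict K, ?_⟩
  have h0 : Tendsto (fun s => edist (V s) (V t)) (𝓝[I] t) (𝓝 0) :=
    tendsto_iff_edist_tendsto_0.1 ((hV t ht).tendsto.mono_left nhdsWithin_le_nhds)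
  exact tendsto_of_tendsto_of_tendsto_of_le_of_le tendsto_const_nhds h0 (fun _ => zero_le)
    fun s => eLpNorm_restrict_le_edist _ _ (EventuallyEq.refl _ _) K

theorem hasDerivOnL2loc_of_hasDerivAt {W : Opens (Space d)} {I : Set ℝ}
    {V G : ℝ → Lp ℂ 2 (volume : Measure (Space d))} (hV : ∀ t ∈ I, HasDerivAt V (G t) t) :
    HasDerivOnL2loc I W (fun t => V t) (fun t => G t) := by
  intro t ht K _ _
  have h0 : Tendsto (fun s => edist (slope V t s) (G t)) (𝓝[≠] t) (𝓝 0) :=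
    tendsto_iff_edist_tendsto_0.1 (hasDerivAt_iff_tendsto_slope.1 (hV t ht))
  refine tendsto_of_tendsto_of_tendsto_of_le_of_le tendsto_const_nhds h0 (fun _ => zero_le)
    fun s => eLpNorm_restrict_le_edist _ _ ?_ K
  rw [slope_def_module]
  filter_upwards [Lp.coeFn_smul (s - t)⁻¹ (V s - V t), Lp.coeFn_sub (V s) (V t)] with x h1 h2
  rw [h1, Pi.smul_apply, h2, Pi.sub_apply]

theorem hasCauchyData_zero_of_curves {T : ℝ} {W : Opens (Space d)} {u : SpaceTime d → ℂ}
    {V : ℝ → Lp ℂ 2 (volume : Measure (Space d))}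
    {G : Option (Fin d) → ℝ → Lp ℂ 2 (volume : Measure (Space d))}
    (hV : ∀ t, |t| < T → HasDerivAt V (G none t) t) (hG : ∀ a t, |t| < T → ContinuousAt (G a) t)
    (hw : ∀ i t, |t| < T → ∀ φ : Space d → ℝ, IsTest φ →
      ∫ x, dirDeriv (coordDir i) φ x • V t x = - ∫ x, φ x • G (some i) t x)
    (hu : ∀ᵐ t : ℝ, |t| < T → V t =ᵐ[volume.restrict (W : Set (Space d))] fun x => u (t, x))
    (h0 : V 0 =ᵐ[volume] 0) (h1 : G none 0 =ᵐ[volume] 0) :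
    HasCauchyData T W u (fun _ => 0) (fun _ => 0) := by
  have hI : ∀ t ∈ Ioo (-T) T, |t| < T := fun t ht => abs_lt.2 ht
  have hloc : ∀ f : Lp ℂ 2 (volume : Measure (Space d)), LocallyIntegrableOn f (W : Set (Space d)) :=
    fun f => ((Lp.memLp f).locallyIntegrable one_le_two).locallyIntegrableOn _
  refine ⟨fun t => V t, fun t => G none t, fun i t => G (some i) t, ?_,
    continuousOnL2loc_of_continuousAt fun t ht => (hV t (hI t ht)).continuousAt,
    fun i t ht => ⟨hloc _, hloc _, fun φ => ?_⟩,
    fun i => continuousOnL2loc_of_continuousAt fun t ht => hG _ t (hI t ht),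
    hasDerivOnL2loc_of_hasDerivAt fun t ht => hV t (hI t ht),
    continuousOnL2loc_of_continuousAt fun t ht => hG _ t (hI t ht),
    ae_restrict_of_ae h0, ae_restrict_of_ae h1⟩
  · rw [ae_restrict_iff' measurableSet_Ioo]
    filter_upwards [hu] with t ht htI
    exact (ht (hI t htI)).symm
  · rw [coe_lineDerivOp_testFunction]
    exact hw i t (hI t ht) φ (isTest_testFunction φ)

end CauchyData

theorem exists_lt_one_sq_lt {R T : ℝ} (hR : 0 ≤ R) (hRT : R < T) :
    ∃ β : ℝ, 0 < β ∧ β < 1 ∧ R ^ 2 < β * T ^ 2 := by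
  have hT : 0 < T ^ 2 := by have := hR.trans_lt hRT; positivity
  have h : R ^ 2 / T ^ 2 < 1 := by rw [div_lt_one hT]; gcongr
  obtain ⟨β, h1, h2⟩ := exists_between h
  exact ⟨β, (by positivity : 0 ≤ R ^ 2 / T ^ 2).trans_lt h1, h2, (div_lt_iff₀ hT).1 h1⟩

end

/-! ### Unique continuation from a neighbourhood of the boundary -/

theorem propositionp (d : ℕ) (hd : 1 ≤ d)
    (M : Set (Space d))
    (hM : ∃ O : Set (Space d), IsOpen O ∧ Bornology.IsBounded O ∧ M = closure O)
    (ω : Set (Space d))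
    (hωopen : ∃ O : Set (Space d), IsOpen O ∧ ω = M ∩ O)
    (hωbdry : frontier M ⊆ ω)
    (x₁ : Space d) (T : ℝ)
    (hT : sSup ((fun x => ‖x - x₁‖) '' (M \ ω)) < T)
    (q₀ q₁ : SpaceTime d → ℂ) (q₂ : SpaceTime d → EuclideanSpace ℂ (Fin d))
    (hq₀ : MemLp q₀ ∞ (volume.restrict (Ioo (-T) T ×ˢ M)))
    (hq₁ : MemLp q₁ ∞ (volume.restrict (Ioo (-T) T ×ˢ M)))
    (hq₂ : MemLp q₂ ∞ (volume.restrict (Ioo (-T) T ×ˢ M)))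
    (u : SpaceTime d → ℂ)
    (hu : IsWaveSolution (timeCylinder T (Opens.interior M)) q₀ q₁ q₂ u)
    (huω : ∀ᵐ z ∂(volume.restrict (Ioo (-T) T ×ˢ ω)), u z = 0) :
    HasCauchyData T (Opens.interior M) u (fun _ => 0) (fun _ => 0) := by
  obtain ⟨O₀, hO₀, hO₀b, rfl⟩ := hM
  set M := closure O₀
  obtain ⟨N, hN, rfl⟩ := hωopen
  have hMc : IsCompact M := hO₀b.isCompact_closure
  set K₀ : Set (Space d) := M \ (M ∩ N)
  have hK₀ : IsCompact K₀ := by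
    simp only [K₀, sdiff_self_inter]; exact hMc.diff hN
  -- A point of the closed set `M` outside its interior is a frontier point, hence lies in `ω`.
  have hKO : K₀ ⊆ interior M := by
    rintro x ⟨hxM, hx⟩
    by_contra hi
    exact hx (hωbdry ⟨subset_closure hxM, hi⟩)
  set R := sSup ((fun x => ‖x - x₁‖) '' K₀)
  -- This includes the case of empty `K₀`, where the real supremum is `0`.
  have hR : 0 ≤ R := Real.sSup_nonneg (by rintro _ ⟨x, -, rfl⟩; exact norm_nonneg _)
  have hKR : ∀ x ∈ K₀, ‖x - x₁‖ ≤ R := fun x hx =>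
    le_csSup (hK₀.image (by fun_prop)).bddAbove (mem_image_of_mem _ hx)
  have hT0 : 0 < T := hR.trans_lt hT
  obtain ⟨β, hβ, hβ1, hRT⟩ := exists_lt_one_sq_lt hR hT
  obtain ⟨ut, ux, hH, heq⟩ := hu
  set Ω : Set (SpaceTime d) := Ioo (-T) T ×ˢ interior M
  have hΩo : IsOpen Ω := isOpen_Ioo.prod isOpen_interior
  have hΩM : volume.restrict Ω ≤ volume.restrict (Ioo (-T) T ×ˢ M) :=
    Measure.restrict_mono (prod_mono_right interior_subset) le_rfl
  have h₀ := hq₀.mono_measure hΩM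
  have h₁ := hq₁.mono_measure hΩM
  have h₂ := hq₂.mono_measure hΩM
  have hloc := isLocalSolution_of_isH1 hH h₀ h₁ h₂ heq
  have hcoe : ((timeCylinder T (Opens.interior M) : Opens (SpaceTime d)) : Set (SpaceTime d)) = Ω :=
    rfl
  rw [hcoe] at hloc
  obtain ⟨C, hC⟩ := exists_nnnorm_lowerOrder_sq_le h₀ h₁ h₂ u ut ux
  have hF : ∀ᵐ z : SpaceTime d, ‖-Ω.indicator (lowerOrder q₀ q₁ q₂ u ut ux) z‖ₑ ^ 2
      ≤ C * ((∑ a, ‖Ω.indicator (gradFamily ut ux a) z‖ₑ ^ 2) + ‖Ω.indicator u z‖ₑ ^ 2) := by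
    filter_upwards [(ae_restrict_iff' hΩo.measurableSet).1 hC] with z hz
    by_cases hzΩ : z ∈ Ω
    · simp only [indicator_of_mem hzΩ, enorm_eq_nnnorm, nnnorm_neg]
      exact_mod_cast hz hzΩ
    · simp [indicator_of_notMem hzΩ]
  have hU0 : ∀ᵐ z : SpaceTime d, z ∈ Ω ∩ (univ ×ˢ N) → Ω.indicator u z = 0 := by
    have := ae_restrict_of_ae_restrict_of_subset
      (s := Ω ∩ (univ ×ˢ N)) (t := Ioo (-T) T ×ˢ (M ∩ N))
      (fun z hz => ⟨hz.1.1, interior_subset hz.1.2, hz.2.2⟩) huω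
    filter_upwards [(ae_restrict_iff' (hΩo.inter (isOpen_univ.prod hN)).measurableSet).1 this]
      with z hz hzN
    rw [indicator_of_mem hzN.1, hz hzN]
  -- Openness of `N` makes the weak derivatives vanish along with `u` on `Ω ∩ (ℝ × N)`; thus
  -- everything is supported over `K₀`.
  have hD0 := ae_all_iff.2 fun a => ae_eq_zero_deriv_of_ae_eq_zero hloc
    (hΩo.inter (isOpen_univ.prod hN)) inter_subset_left hU0 a
  have hZ : ∀ᵐ z : SpaceTime d, z ∉ Ioo (-T) T ×ˢ K₀ →
      Ω.indicator u z = 0 ∧ ∀ a, Ω.indicator (gradFamily ut ux a) z = 0 := by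
    filter_upwards [hU0, hD0] with z hzU hzD hzZ
    by_cases hzΩ : z ∈ Ω
    · have hzM : z.2 ∈ M := interior_subset hzΩ.2
      have hzN : z ∈ Ω ∩ (univ ×ˢ N) := by
        refine ⟨hzΩ, mem_univ _, ?_⟩
        by_contra hn
        exact hzZ ⟨hzΩ.1, hzM, fun h => hn h.2⟩
      exact ⟨hzU hzN, fun a => hzD a hzN⟩
    · simp [indicator_of_notMem hzΩ]
  obtain ⟨V, G, hV, hG, hw, hVU⟩ := exists_curves isOpen_interior hK₀ hKO hloc hZ
  obtain ⟨hV0, hG0⟩ := ae_eq_zero_of_curve_of_hyperboloid hd hβ hT0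
    (fun t ht => (hV t ht).continuousAt) (hV 0 (by simpa using hT0)) hVU fun ε hε =>
      ae_eq_zero_of_hyperboloid hβ hβ1 hT0 hRT isOpen_interior hK₀ hKO hKR hloc hF hZ hε
  refine hasCauchyData_zero_of_curves hV hG hw ?_ hV0 hG0
  filter_upwards [hVU] with t ht htT
  rw [EventuallyEq, ae_restrict_iff' (Opens.interior M).isOpen.measurableSet]
  filter_upwards [ht htT] with x hx hxW
  rw [hx]
  have hm : ((t, x) : SpaceTime d) ∈ Ω := ⟨abs_lt.1 htT, hxW⟩
  exact indicator_of_mem hm u
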